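/- Let $(M,g)$ be a compact smooth Riemannian manifold of dimension $d\ge 2$ with boundary. Assume that $\partial M$ is strictly convex (its second fundamental form with respect to the inward unit normal is positive definite everywhere) and that $M$ is non-trapping (for every unit tangent vector $(x,v)$, the geodesic starting at $x$ with velocity $v$ exits $M$ in finite time). Let $SM=\{(x,v)\in TM: |v|_g=1\}$ be the unit sphere bundle, let $X$ be the geodesic vector field on $SM$, and let $m\ge 1$. Fix, for each integer $k\ge 0$, a $C^k$-norm $\|\cdot\|_{C^k(SM)}$ defined by means of a finite atlas, for matrix-valued functions on $SM$ (derivatives taken up to the boundary). Then there are constants $c_{1,k},c_{2,k}>0$ ($k=0,1,2,\dots$), depending only on $k$, $m$ and $(M,g)$ (with the chosen norms), such that every $\mathcal A\in C^\infty(SM,\mathbb C^{m\times m})$ admits an integrating factor $R_{\mathcal A}\in C^\infty(SM,\mathrm{GL}(m,\mathbb C))$, that is, a solution of $$(X+\mathcal A)R_{\mathcal A}=0\quad\text{on } SM,$$ which satisfies for all integers $k\ge 0$ simultaneously $$\|R_{\mathcal A}^{\pm1}\|_{C^k(SM)}\le c_{1,k}\,\exp\!\big(c_{2,k}\|\mathcal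 A\|_{L^\infty(SM)}\big)\,\big(1+\|\mathcal A\|_{C^k(SM)}\big)^k .$$ If moreover $\mathcal A$ takes values in $\mathfrak u(m)=\{B\in\mathbb C^{m\times m}:B^*=-B\}$, then also $\|R_{\mathcal A}^{\pm1}\|_{C^k(SM)}\le c_{1,k}\,(1+\|\mathcal A\|_{C^k(SM)})^k$ for all $k\ge 0$. Here $R_{\mathcal A}^{-1}$ denotes the pointwise inverse matrix. -/

import Mathlib

open Set Bundle
open scoped Manifold ContDiff ENNReal NNReal

-- Complex `m × m` matrices carry the Frobenius norm.
attribute [local instance] Matrix.frobeniusNormedAddCommGroup Matrix.frobeniusNormedSpace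

noncomputable section

namespace XRay

section Geometry

variable {d : ℕ} [NeZero d]
  {M : Type*} [TopologicalSpace M] [ChartedSpace (EuclideanHalfSpace d) M]
  [IsManifold (𝓡∂ d) ∞ M]

/-- A smooth Riemannian metric on a smooth manifold with boundary modelled on the
`d`-dimensional half space `{y | 0 ≤ y 0}`. -/
abbrev Metric (d : ℕ) [NeZero d] (M : Type*) [TopologicalSpace M]
    [ChartedSpace (EuclideanHalfSpace d) M] [IsManifold (𝓡∂ d) ∞ M] :=
  ContMDiffRiemannianMetric (𝓡∂ d) ∞ (EuclideanSpace ℝ (Fin d))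
    (fun x : M => TangentSpace (𝓡∂ d) x)

/-- The coefficients of the metric in the chart at `c`: for `y` in the target of that chart and
constant vectors `u`, `w` this is `g(dφ⁻¹ u, dφ⁻¹ w)` at the point `φ⁻¹ y`. -/
def chartMetric (g : Metric d M) (c : M) (y u w : EuclideanSpace ℝ (Fin d)) : ℝ :=
  let x : M := (extChartAt (𝓡∂ d) c).symm y
  let e := trivializationAt (EuclideanSpace ℝ (Fin d)) (TangentSpace (𝓡∂ d) : M → Type _) c
  g.inner x (e.symmL ℝ x u) (e.symmL ℝ x w)

/-- `D_z (G(u, w))` at `y`: derivative in direction `z` of a coefficient of the metric in the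
chart at `c` (one-sided at boundary points). -/
def dChartMetric (g : Metric d M) (c : M) (y z u w : EuclideanSpace ℝ (Fin d)) : ℝ :=
  fderivWithin ℝ (fun y' => chartMetric g c y' u w) (range (𝓡∂ d)) y z

/-- Christoffel symbols of the first kind,
`Γ(u, w; z) = (D_u G(w, z) + D_w G(u, z) - D_z G(u, w)) / 2`. -/
def christoffelLower (g : Metric d M) (c : M) (y u w z : EuclideanSpace ℝ (Fin d)) : ℝ :=
  (dChartMetric g c y u w z + dChartMetric g c y w u z - dChartMetric g c y z u w) / 2

/-- The matrix `(g_{ij})` of the metric in the chart at `c`. -/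
def gramMatrix (g : Metric d M) (c : M) (y : EuclideanSpace ℝ (Fin d)) :
    Matrix (Fin d) (Fin d) ℝ :=
  Matrix.of fun i j =>
    chartMetric g c y (EuclideanSpace.single i 1) (EuclideanSpace.single j 1)

/-- Christoffel symbols of the second kind in the chart at `c`, as a bilinear map:
`Γ(u, w)^i = ∑_j g^{ij} Γ(u, w; e_j)`. -/
def christoffel (g : Metric d M) (c : M) (y u w : EuclideanSpace ℝ (Fin d)) :
    EuclideanSpace ℝ (Fin d) :=
  WithLp.toLp 2 fun i =>
    ∑ j, (gramMatrix g c y)⁻¹ i j * christoffelLower g c y u w (EuclideanSpace.single j 1)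

/-- Christoffel symbols at `x`, in the preferred chart at `x`; in Mathlib the tangent space at `x`
is the model space, identified through exactly this chart. -/
def christoffelAt (g : Metric d M) (x : M) (u w : TangentSpace (𝓡∂ d) x) :
    EuclideanSpace ℝ (Fin d) :=
  christoffel g x (extChartAt (𝓡∂ d) x x) u w

/-- The geodesic vector field `X` on `TM`: in coordinates `X(y, v) = (v, -Γ_y(v, v))`, so that its
integral curves are the velocity fields of geodesics. It is tangent to the unit sphere bundle. -/
def geodesicField (g : Metric d M) (p : TangentBundle (𝓡∂ d) M) :
    TangentSpace (𝓡∂ d).tangent p :=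
  ((p.2, -christoffelAt g p.1 p.2 p.2) :
    EuclideanSpace ℝ (Fin d) × EuclideanSpace ℝ (Fin d))

/-- The unit sphere bundle `SM = {(x, v) ∈ TM : |v| = 1}`. -/
def UnitSphereBundle (g : Metric d M) : Type _ :=
  {p : TangentBundle (𝓡∂ d) M // g.inner p.1 p.2 p.2 = 1}

/-- The exit time `τ(x, v) ∈ [0, ∞]`: the supremum of all `T ≥ 0` such that the geodesic issued
from `(x, v)` exists in `M` on `[0, T]`. -/
def exitTime (g : Metric d M) (p : UnitSphereBundle g) : ℝ≥0∞ :=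
  ⨆ (T : ℝ≥0) (_ : ∃ γ : ℝ → TangentBundle (𝓡∂ d) M,
    γ 0 = p.1 ∧ IsMIntegralCurveOn γ (geodesicField g) (Icc 0 (T : ℝ))), (T : ℝ≥0∞)

/-- `(M, g)` is non-trapping: every geodesic exits in finite time. -/
def NonTrapping (g : Metric d M) : Prop :=
  ∀ p : UnitSphereBundle g, exitTime g p < ⊤

/-- `v ∈ T_x M` is tangent to the boundary at a boundary point `x`; the chart at `x` maps the
boundary to `{y | y 0 = 0}`. -/
def TangentToBoundary (x : M) (v : TangentSpace (𝓡∂ d) x) : Prop :=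
  (show EuclideanSpace ℝ (Fin d) from v) 0 = 0

/-- `ν` is the inward pointing unit normal at the boundary point `x`. -/
def IsInwardUnitNormal (g : Metric d M) (x : M) (ν : TangentSpace (𝓡∂ d) x) : Prop :=
  g.inner x ν ν = 1 ∧ (∀ v : TangentSpace (𝓡∂ d) x, TangentToBoundary x v → g.inner x ν v = 0) ∧
    0 < (show EuclideanSpace ℝ (Fin d) from ν) 0

/-- The second fundamental form `⟨ν, ∇_v W⟩` of the boundary at `x` with respect to a unit normal
`ν`, for `v`, `w` tangent to the boundary and `W` any extension of `w` which is tangent to the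
boundary. In a chart straightening the boundary the constant extension is such a `W`, and for it
`∇_v W = Γ(v, w)`. -/
def secondFundamentalForm (g : Metric d M) (x : M) (ν v w : TangentSpace (𝓡∂ d) x) : ℝ :=
  g.inner x ν (show TangentSpace (𝓡∂ d) x from christoffelAt g x v w)

/-- The boundary is strictly convex: its second fundamental form with respect to the inward unit
normal is positive definite at every boundary point. -/
def StrictlyConvexBoundary (g : Metric d M) : Prop :=
  ∀ x ∈ (𝓡∂ d).boundary M, ∀ ν : TangentSpace (𝓡∂ d) x, IsInwardUnitNormal g x ν →
    ∀ v : TangentSpace (𝓡∂ d) x, TangentToBoundary x v → v ≠ 0 →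
      0 < secondFundamentalForm g x ν v v

/-- The unit vector `v / |v|` of a nonzero tangent vector. -/
def toUnit (g : Metric d M) (p : TangentBundle (𝓡∂ d) M) (hp : p.2 ≠ 0) :
    UnitSphereBundle g :=
  ⟨⟨p.1, (√(g.inner p.1 p.2 p.2))⁻¹ • p.2⟩, by
    have h : 0 < g.inner p.1 p.2 p.2 := g.pos p.1 p.2 hp
    have hs := Real.sq_sqrt h.le
    have h0 : √(g.inner p.1 p.2 p.2) ≠ 0 := (Real.sqrt_pos.2 h).ne'
    simp only [map_smul, smul_apply, smul_eq_mul]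
    field_simp
    exact hs.symm⟩

end Geometry

section Functions

variable {d : ℕ} [NeZero d]
  {M : Type*} [TopologicalSpace M] [ChartedSpace (EuclideanHalfSpace d) M]
  [IsManifold (𝓡∂ d) ∞ M]
  {F : Type*} [NormedAddCommGroup F] [NormedSpace ℝ F]

open Classical in
/-- The extension of a function on `SM` to `TM` minus the zero section which is homogeneous of
degree `0`, i.e. the composition with the retraction `(x, v) ↦ (x, v / |v|)` (and `0` on the zero
section). -/
def homExt (g : Metric d M) (f : UnitSphereBundle g → F) (p : TangentBundle (𝓡∂ d) M) : F :=
  if hp : p.2 ≠ 0 then f (toUnit g p hp) else 0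

/-- `f ∈ C^∞(SM, F)` (up to the boundary). As `SM` is an embedded submanifold of `TM` and
`(x, v) ↦ (x, v / |v|)` is a smooth retraction onto it, this means that the degree-`0` homogeneous
extension is smooth away from the zero section. -/
def SmoothOnSM (g : Metric d M) (f : UnitSphereBundle g → F) : Prop :=
  ContMDiffOn (𝓡∂ d).tangent 𝓘(ℝ, F) ∞ (homExt g f) {p | p.2 ≠ 0}

/-- The derivative `X f` of `f : SM → F` along the geodesic vector field. As `X` is tangent to
`SM`, it may be computed on an extension of `f`. -/
def geodesicDeriv (g : Metric d M) (f : UnitSphereBundle g → F) (p : UnitSphereBundle g) : F :=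
  mfderiv (𝓡∂ d).tangent 𝓘(ℝ, F) (homExt g f) p.1 (geodesicField g p.1)

/-- The supremum norm `‖f‖_{L^∞(SM)}`, with values in `[0, ∞]`. -/
def supNorm (g : Metric d M) (f : UnitSphereBundle g → F) : ℝ≥0∞ :=
  ⨆ p : UnitSphereBundle g, ‖f p‖ₑ

/-- A finite family of charts of `M` together with compact subsets of their domains which cover
`M`: the choices in the definition of a `C^k`-norm. -/
structure FiniteAtlas (d : ℕ) [NeZero d] (M : Type*) [TopologicalSpace M]
    [ChartedSpace (EuclideanHalfSpace d) M] where
  /-- the number of charts -/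
  N : ℕ
  /-- the point at which the chart is centred -/
  center : Fin N → M
  /-- the compact set on which the chart is used -/
  K : Fin N → Set M
  isCompact_K : ∀ i, IsCompact (K i)
  K_subset : ∀ i, K i ⊆ (chartAt (EuclideanHalfSpace d) (center i)).source
  cover : (⋃ i, K i) = univ

theorem FiniteAtlas.nonempty (d : ℕ) [NeZero d] (M : Type*) [TopologicalSpace M]
    [ChartedSpace (EuclideanHalfSpace d) M] [CompactSpace M] : Nonempty (FiniteAtlas d M) := by
  have : LocallyCompactSpace (EuclideanHalfSpace d) := (𝓡∂ d).locallyCompactSpace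
  have : LocallyCompactSpace M := ChartedSpace.locallyCompactSpace (EuclideanHalfSpace d) M
  have h : ∀ x : M, ∃ K ∈ nhds x, K ⊆ (chartAt (EuclideanHalfSpace d) x).source ∧ IsCompact K :=
    fun x => local_compact_nhds (chart_source_mem_nhds (EuclideanHalfSpace d) x)
  choose K hK hs hc using h
  obtain ⟨t, -, ht⟩ := isCompact_univ.elim_nhds_subcover K fun x _ => hK x
  refine ⟨⟨t.card, fun i => (t.equivFin.symm i : M), fun i => K (t.equivFin.symm i),
    fun i => hc _, fun i => hs _, ?_⟩⟩
  refine eq_univ_of_forall fun x => ?_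
  obtain ⟨y, hy, hx⟩ := mem_iUnion₂.1 (ht (mem_univ x))
  exact mem_iUnion.2 ⟨t.equivFin ⟨y, hy⟩, by simpa using hx⟩

/-- `f : SM → F`, extended homogeneously of degree `0`, in the natural coordinates `(y, w)` on `TM`
over the chart of `M` at `c`. -/
def localRep (g : Metric d M) (f : UnitSphereBundle g → F) (c : M) :
    EuclideanSpace ℝ (Fin d) × EuclideanSpace ℝ (Fin d) → F :=
  homExt g f ∘ (extChartAt (𝓡∂ d).tangent (⟨c, 0⟩ : TangentBundle (𝓡∂ d) M)).symm

/-- The norm `‖f‖_{C^k(SM)}` (with values in `[0, ∞]`) attached to a finite atlas. Over each chart,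
`SM` is parametrised by `(y, w)` with `y` in the chart and `w` in the Euclidean unit sphere; the
norm is the largest size of a derivative of order at most `k` of the coordinate representation
over the compact sets of the atlas. Derivatives are one-sided at the boundary. -/
def ckNorm (g : Metric d M) (𝒜 : FiniteAtlas d M) (k : ℕ) (f : UnitSphereBundle g → F) : ℝ≥0∞ :=
  ⨆ (i : Fin 𝒜.N) (j : ℕ) (_ : j ≤ k)
    (q : EuclideanSpace ℝ (Fin d) × EuclideanSpace ℝ (Fin d))
    (_ : q.1 ∈ extChartAt (𝓡∂ d) (𝒜.center i) '' 𝒜.K i ∧ ‖q.2‖ = 1),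
      ‖iteratedFDerivWithin ℝ j (localRep g f (𝒜.center i)) (range (𝓡∂ d).tangent) q‖ₑ

/-- `R ∈ C^∞(SM, GL(m, ℂ))` is a smooth integrating factor for `A`: `(X + A) R = 0` on `SM`. -/
def IsIntegratingFactor (g : Metric d M) {m : ℕ}
    (A : UnitSphereBundle g → Matrix (Fin m) (Fin m) ℂ)
    (R : UnitSphereBundle g → GL (Fin m) ℂ) : Prop :=
  SmoothOnSM g (fun p => (R p : Matrix (Fin m) (Fin m) ℂ)) ∧
    ∀ p, geodesicDeriv g (fun p => (R p : Matrix (Fin m) (Fin m) ℂ)) p +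
      A p * (R p : Matrix (Fin m) (Fin m) ℂ) = 0

end Functions

end XRay

end

/-!
# Integrating factors on the unit sphere bundle of a non-trapping manifold

The equation `(X + A) R = 0` is a linear ordinary differential equation along each geodesic. Solving
it backwards from the exit point of the geodesic is not smooth in general, because the exit time is
not smooth at directions tangent to the boundary. The integrating factor is therefore constructed
in a larger space without boundary.

*Embedding.* `BumpCover.embed` maps `SM` onto a compact subset `Z` of a finite-dimensional vector
space `V`, one factor `ℝᵈ × ℝᵈ` for each chart of a finite cover. Functions on `SM` extend to `V` by
a linear operator `BumpCover.extension` of Seeley's type: it reflects at the boundary hyperplanes by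
`halfSpaceExt`, whose coefficients come from `exists_alternating_moments`, does not lose
derivatives (`exists_norm_iteratedFDeriv_extension_le`) and commutes with linear maps of the values
(`extension_comp_left`), so that it preserves skew-adjointness. The image of the geodesic field
extends to a Lipschitz field on `V` (`exists_extension_geodesicField`). A piece of an orbit of that
field which stays in `Z` is a geodesic (`hasMFDerivWithinAt_of_embed`); hence, as `M` is
non-trapping, every orbit which starts in `Z` leaves `Z` (`exists_escapesBefore`). It may return,
but this does no harm.

*Transport equation.* By compactness the orbits leave `Z` before a common time `T`
(`exists_uniform_escape`). The orbits are given a memory `s`, which starts at `0`, grows only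
outside `Z`, and exceeds some `a > 0` after the time `T` (`exists_memory`). Let `ψ` be a cutoff
function with `ψ = 1` near `0` and `ψ = 0` on `[a, ∞)`. The coefficient `ψ(s) A` agrees with `A`
on `Z` where `s = 0`, and it vanishes along each orbit after the time `T`. The propagator `R` of
this coefficient over the time interval `[0, T]` depends smoothly on the initial value; as the
coefficient vanishes at the end of the interval, moving the initial value along its orbit changes
`R` at the initial end only, which is the transport equation on `Z` (`fderiv_propagator_eq`,
`exists_transport_solution`). No regularity of exit times is needed.

*Estimates.* Conjugation with the propagator at a fixed initial value `z` turns the equation into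
one whose coefficient vanishes at `z`; then each derivative at `z` is controlled by derivatives of
lower order, and a derivative of order `k` is bounded by `κ ^ (2 k + 1)` times the `k`-th power of a bound
for the derivatives of `A`, where `κ` bounds the propagators
(`exists_norm_iteratedFDeriv_propagator_le`). In general Gronwall's inequality gives
`κ ≤ C exp (C ‖A‖_∞)`; for skew-adjoint `A` the propagators are unitary
(`norm_propagator_le_of_skewAdjoint`), and `κ` depends on the size of the matrices only.
-/

noncomputable section

namespace XRay

set_option linter.unusedSectionVars false

/-! ### A sequence with prescribed moments -/

section Moments

open Polynomial in
/-- One step of Newton interpolation at the nodes `2 ^ j`. The correction `Q` keeps the values at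
the earlier nodes and is as small as desired there: multiplication by a high power of `X`, at fixed
value at `2 ^ n`, makes it small on the smaller nodes. -/
theorem exists_interpolation_correction (n : ℕ) (c ε : ℝ) (hε : 0 < ε) :
    ∃ Q D : ℝ[X], (∀ j < n, Q.eval (2 ^ j) = 0) ∧ Q.eval (2 ^ n) = c ∧
      (∀ k, |Q.coeff k| ≤ D.coeff k) ∧ ∀ j < n, D.eval (2 ^ j) ≤ ε := by
  -- `Q` is a multiple of `X ^ s * V` for large `s`; its majorant `D` is made in the same way from
  -- the polynomial `B` whose coefficients are the absolute values of those of `V`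
  set V : ℝ[X] := ∏ j ∈ Finset.range n, (X - C (2 ^ j)) with hV
  set B : ℝ[X] := ∑ k ∈ V.support, monomial k |V.coeff k| with hB
  have hBc : ∀ k, B.coeff k = |V.coeff k| := by
    intro k
    simp only [hB, finsetSum_coeff, coeff_monomial, Finset.sum_ite_eq', mem_support_iff]
    split_ifs with h
    · rfl
    · simp [not_not.1 h]
  have hVn : V.eval (2 ^ n) ≠ 0 := by
    simp only [hV, eval_prod, eval_sub, eval_X, eval_C]
    refine Finset.prod_ne_zero_iff.2 fun j hj => sub_ne_zero.2 ?_
    exact (pow_lt_pow_right₀ (by norm_num) (Finset.mem_range.1 hj)).ne'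
  set K : ℝ := |c| / |V.eval (2 ^ n)| * ∑ j ∈ Finset.range n, |B.eval (2 ^ j)| with hK
  obtain ⟨s, hs⟩ := exists_pow_lt_of_lt_one (div_pos hε (by positivity : (0 : ℝ) < K + 1))
    (by norm_num : (1 / 2 : ℝ) < 1)
  set b : ℝ := c / (V.eval (2 ^ n) * (2 ^ n) ^ s) with hb
  refine ⟨C b * (X ^ s * V), C |b| * (X ^ s * B), fun j hj => ?_, ?_, fun k => ?_, fun j hj => ?_⟩
  · have : V.eval (2 ^ j) = 0 := by
      simp only [hV, eval_prod, eval_sub, eval_X, eval_C]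
      exact Finset.prod_eq_zero (Finset.mem_range.2 hj) (by simp)
    simp [this]
  · simp only [eval_mul, eval_C, eval_pow, eval_X, hb]
    field_simp
  · simp only [coeff_C_mul, coeff_X_pow_mul', abs_mul]
    split_ifs
    · rw [hBc]
    · simp
  · simp only [eval_mul, eval_C, eval_pow, eval_X, hb, abs_div, abs_mul]
    have h1 : |B.eval (2 ^ j)| ≤ ∑ j ∈ Finset.range n, |B.eval (2 ^ j)| :=
      Finset.single_le_sum (f := fun j => |B.eval ((2 : ℝ) ^ j)|) (fun _ _ => abs_nonneg _)
        (Finset.mem_range.2 hj)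
    have h2 : ((2 : ℝ) ^ j) ^ s / (2 ^ n) ^ s ≤ (1 / 2) ^ s := by
      rw [← div_pow]
      refine pow_le_pow_left₀ (by positivity) ?_ _
      rw [div_le_div_iff₀ (by positivity) (by norm_num), one_mul, ← pow_succ]
      exact pow_le_pow_right₀ (by norm_num) hj
    calc |c| / (|V.eval (2 ^ n)| * |((2 : ℝ) ^ n) ^ s|) * ((2 ^ j) ^ s * B.eval (2 ^ j))
        = |c| / |V.eval (2 ^ n)| * B.eval (2 ^ j) * (((2 : ℝ) ^ j) ^ s / (2 ^ n) ^ s) := by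
          rw [abs_of_pos (by positivity : (0 : ℝ) < ((2 : ℝ) ^ n) ^ s)]
          field_simp
      _ ≤ K * (1 / 2) ^ s := by
          refine mul_le_mul ?_ h2 (by positivity) (by positivity)
          exact mul_le_mul_of_nonneg_left ((le_abs_self _).trans h1) (by positivity)
      _ ≤ (K + 1) * (ε / (K + 1)) := by
          refine mul_le_mul (by linarith) hs.le (by positivity) (by positivity)
      _ = ε := mul_div_cancel₀ _ (by positivity)

/-- There is a sequence whose moments along the powers of two are `1, -1, 1, -1, …`. These are the
coefficients of Seeley's extension operator. -/
theorem exists_alternating_moments :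
    ∃ a : ℕ → ℝ, ∀ n : ℕ, Summable (fun k => |a k| * (2 ^ k) ^ n) ∧
      ∑' k, a k * (2 ^ k) ^ n = (-1) ^ n := by
  classical
  choose Q D hQ0 hQ1 hQD hD using fun (n : ℕ) (P : Polynomial ℝ) =>
    exists_interpolation_correction n ((-1) ^ n - P.eval (2 ^ n)) ((1 / 2) ^ n) (by positivity)
  let P : ℕ → Polynomial ℝ := fun n => Nat.rec 0 (fun n p => p + Q n p) n
  have hP : ∀ n, P (n + 1) = P n + Q n (P n) := fun n => rfl
  set q : ℕ → Polynomial ℝ := fun n => Q n (P n) with hq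
  have hPs : ∀ n, P n = ∑ i ∈ Finset.range n, q i := by
    intro n
    induction n with
    | zero => rfl
    | succ n ih => rw [hP, Finset.sum_range_succ, ← ih]
  have hval : ∀ j n, j < n → (P n).eval (2 ^ j) = (-1) ^ j := by
    intro j n hjn
    induction n with
    | zero => omega
    | succ n ih =>
      rw [hP, Polynomial.eval_add]
      rcases Nat.lt_succ_iff_lt_or_eq.1 hjn with h | rfl
      · rw [ih h, hQ0 n _ j h, add_zero]
      · rw [hQ1]; ring
  -- absolute convergence of the double series
  have hsumm : ∀ (p : Polynomial ℝ) (x : ℝ), HasSum (fun k => p.coeff k * x ^ k) (p.eval x) := by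
    intro p x
    rw [Polynomial.eval_eq_sum_range]
    refine hasSum_sum_of_ne_finset_zero fun k hk => ?_
    rw [Polynomial.coeff_eq_zero_of_natDegree_lt (by simpa using hk), zero_mul]
  have hsabs : ∀ (p : Polynomial ℝ) (x : ℝ), Summable (fun k => |p.coeff k| * x ^ k) := by
    intro p x
    refine summable_of_ne_finset_zero (s := Finset.range (p.natDegree + 1)) fun k hk => ?_
    rw [Polynomial.coeff_eq_zero_of_natDegree_lt (by simpa using hk), abs_zero, zero_mul]
  -- the bound `D` is available at the node `2 ^ j` only for the corrections with index above `j`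
  have hrow : ∀ j : ℕ, Summable (fun n => ∑' k, |(q n).coeff k| * (2 ^ j : ℝ) ^ k) := by
    intro j
    refine (summable_nat_add_iff (j + 1)).1 ?_
    refine Summable.of_nonneg_of_le (fun n => tsum_nonneg fun k => by positivity) (fun n => ?_)
      ((summable_nat_add_iff (j + 1)).2 summable_geometric_two)
    refine le_trans ?_ (hD (n + (j + 1)) (P (n + (j + 1))) j (by omega))
    rw [← (hsumm _ _).tsum_eq]
    refine Summable.tsum_le_tsum (fun k => ?_) (hsabs _ _) (hsumm _ _).summable
    exact mul_le_mul_of_nonneg_right (hQD _ _ k) (by positivity)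
  have hdouble : ∀ j : ℕ, Summable (fun p : ℕ × ℕ => (q p.1).coeff p.2 * (2 ^ j : ℝ) ^ p.2) := by
    intro j
    refine Summable.of_norm ?_
    refine (summable_prod_of_nonneg fun _ => norm_nonneg _).2 ⟨fun n => ?_, ?_⟩
    · simpa [abs_mul] using hsabs (q n) (2 ^ j)
    · simpa [abs_mul] using hrow j
  have hcol : ∀ k, Summable fun n => (q n).coeff k := by
    intro k
    have := (hdouble 0).comp_injective (i := fun n => (n, k)) fun x y h => (Prod.ext_iff.1 h).1
    simpa [Function.comp_def] using this
  refine ⟨fun k => ∑' n, (q n).coeff k, fun j => ⟨?_, ?_⟩⟩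
  · have h1 := (((hdouble j).prod_symm).norm).prod
    refine Summable.of_nonneg_of_le (fun k => by positivity) (fun k => ?_) h1
    rw [← pow_mul, mul_comm k j, pow_mul]
    have h2 : |∑' n, (q n).coeff k| * (2 ^ j : ℝ) ^ k =
        ‖∑' n, (q n).coeff k * (2 ^ j : ℝ) ^ k‖ := by
      rw [tsum_mul_right, norm_mul, Real.norm_eq_abs, Real.norm_of_nonneg (by positivity)]
    rw [h2]
    exact norm_tsum_le_tsum_norm ((hdouble j).prod_symm.norm.prod_factor k)
  · have h1 : ∀ k : ℕ, (∑' n, (q n).coeff k) * ((2 : ℝ) ^ k) ^ j =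
        ∑' n, (q n).coeff k * (2 ^ j : ℝ) ^ k := by
      intro k
      rw [← pow_mul, mul_comm k j, pow_mul, tsum_mul_right]
    simp_rw [h1]
    have h2 := (hdouble j).tsum_comm (f := fun n k => (q n).coeff k * (2 ^ j : ℝ) ^ k)
    rw [h2]
    simp_rw [(hsumm _ _).tsum_eq]
    have h3 : HasSum (fun n => (q n).eval (2 ^ j : ℝ)) (∑' n, (q n).eval (2 ^ j : ℝ)) := by
      have := (hdouble j).prod
      simp_rw [(hsumm _ _).tsum_eq] at this
      exact this.hasSum
    -- from the index `j` on, the interpolation polynomials have the right value at `2 ^ j`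
    refine tendsto_nhds_unique h3.tendsto_sum_nat
      (tendsto_const_nhds.congr' ?_)
    filter_upwards [Filter.eventually_gt_atTop j] with n hn
    rw [← hval j n hn, hPs, Polynomial.eval_finsetSum]

end Moments

/-! ### Seeley's extension operator on a half space -/

section HalfSpace

open Filter Topology

variable {W : Type} [NormedAddCommGroup W] [NormedSpace ℝ W]
  {F : Type} [NormedAddCommGroup F] [NormedSpace ℝ F]

/-- The linear map `S_k` which dilates by `-2 ^ k` along `e` and is the identity on `ker ℓ`
(when `ℓ e = 1`). -/
def foldMap (ℓ : W →L[ℝ] ℝ) (e : W) (k : ℕ) : W →L[ℝ] W :=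
  ContinuousLinearMap.id ℝ W - (1 + 2 ^ k : ℝ) • ℓ.smulRight e

/-- The extension `∑ k, w k • f (S_k x)` to the half space `ℓ x < 0` of a function on the half
space `0 ≤ ℓ x`. -/
def halfSpaceExt (ℓ : W →L[ℝ] ℝ) (e : W) (w : ℕ → ℝ) (f : W → F) (x : W) : F :=
  if 0 ≤ ℓ x then f x else ∑' k, w k • f (foldMap ℓ e k x)

/-- `f` is smooth on the half space `0 ≤ ℓ x`, and each of its derivatives is bounded there. -/
structure BoundedSmooth (ℓ : W →L[ℝ] ℝ) (f : W → F) : Prop where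
  contDiffOn : ContDiffOn ℝ ∞ f {x | 0 ≤ ℓ x}
  bounded : ∀ j : ℕ, ∃ C, ∀ x, 0 ≤ ℓ x → ‖iteratedFDerivWithin ℝ j f {x | 0 ≤ ℓ x} x‖ ≤ C

variable {ℓ : W →L[ℝ] ℝ} {e : W}

theorem foldMap_apply (k : ℕ) (x : W) : foldMap ℓ e k x = x - ((1 + 2 ^ k) * ℓ x) • e := by
  simp [foldMap, mul_smul]

theorem apply_foldMap (he : ℓ e = 1) (k : ℕ) (x : W) : ℓ (foldMap ℓ e k x) = -2 ^ k * ℓ x := by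
  simp [foldMap_apply, he]; ring

theorem foldMap_of_apply_eq_zero (k : ℕ) {x : W} (hx : ℓ x = 0) : foldMap ℓ e k x = x := by
  simp [foldMap_apply, hx]

theorem foldMap_nonneg (he : ℓ e = 1) (k : ℕ) {x : W} (hx : ℓ x ≤ 0) :
    0 ≤ ℓ (foldMap ℓ e k x) := by
  rw [apply_foldMap he, neg_mul, ← mul_neg]
  exact mul_nonneg (by positivity) (by linarith)

theorem foldMap_pos (he : ℓ e = 1) (k : ℕ) {x : W} (hx : ℓ x < 0) :
    0 < ℓ (foldMap ℓ e k x) := by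
  rw [apply_foldMap he, neg_mul, ← mul_neg]
  exact mul_pos (by positivity) (by linarith)

theorem uniqueDiffOn_halfSpace (he : ℓ e = 1) : UniqueDiffOn ℝ {x | 0 ≤ ℓ x} := by
  refine uniqueDiffOn_convex (fun x hx y hy a b ha hb _ => ?_) ⟨e, ?_⟩
  · simp only [mem_ofPred_eq, map_add, map_smul, smul_eq_mul] at *
    positivity
  · refine interior_maximal (s := {x | 0 ≤ ℓ x}) (t := {x | 0 < ℓ x})
      (fun x (hx : 0 < ℓ x) => hx.le)
      (isOpen_lt continuous_const ℓ.continuous) ?_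
    simp [he]

theorem halfSpaceExt_of_nonneg (w : ℕ → ℝ) (f : W → F) {x : W} (hx : 0 ≤ ℓ x) :
    halfSpaceExt ℓ e w f x = f x := if_pos hx

/-- The series also describes the extension on the boundary hyperplane, as the weights add up
to one. -/
theorem halfSpaceExt_of_nonpos {w : ℕ → ℝ} (hw : Summable w) (hw1 : ∑' k, w k = 1) (f : W → F)
    {x : W} (hx : ℓ x ≤ 0) :
    halfSpaceExt ℓ e w f x = ∑' k, w k • f (foldMap ℓ e k x) := by
  rcases hx.lt_or_eq with h | h
  · exact if_neg (not_le.2 h)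
  · simp_rw [halfSpaceExt, h, le_refl, if_true, foldMap_of_apply_eq_zero _ h]
    rw [hw.tsum_smul_const, hw1, one_smul]

theorem norm_halfSpaceExt_le (he : ℓ e = 1) {w : ℕ → ℝ} (hw : Summable fun k => |w k|)
    {f : W → F} {M : ℝ} (hf : ∀ x, 0 ≤ ℓ x → ‖f x‖ ≤ M) (x : W) :
    ‖halfSpaceExt ℓ e w f x‖ ≤ (1 + ∑' k, |w k|) * M := by
  have hM : 0 ≤ M := (norm_nonneg _).trans (hf e (by simp [he]))
  have h0 : 0 ≤ ∑' k, |w k| := tsum_nonneg fun _ => abs_nonneg _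
  rw [halfSpaceExt]
  split_ifs with hx
  · nlinarith [hf x hx]
  · have h1 : ∀ k, ‖w k • f (foldMap ℓ e k x)‖ ≤ |w k| * M := fun k => by
      rw [norm_smul, Real.norm_eq_abs]
      exact mul_le_mul_of_nonneg_left (hf _ (foldMap_nonneg he k (not_le.1 hx).le)) (abs_nonneg _)
    refine (tsum_of_norm_bounded (hw.mul_right M).hasSum h1).trans ?_
    rw [tsum_mul_right]
    nlinarith

theorem continuous_halfSpaceExt [CompleteSpace F] (he : ℓ e = 1) {w : ℕ → ℝ}
    (hw : Summable fun k => |w k|) (hw1 : ∑' k, w k = 1) {f : W → F}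
    (hf : ContinuousOn f {x | 0 ≤ ℓ x}) {M : ℝ}
    (hM : ∀ x, 0 ≤ ℓ x → ‖f x‖ ≤ M) : Continuous (halfSpaceExt ℓ e w f) := by
  have hp : ContinuousOn (halfSpaceExt ℓ e w f) {x | 0 ≤ ℓ x} :=
    hf.congr fun x hx => halfSpaceExt_of_nonneg w f hx
  have hn : ContinuousOn (halfSpaceExt ℓ e w f) {x | ℓ x ≤ 0} := by
    refine ContinuousOn.congr ?_ fun x hx => halfSpaceExt_of_nonpos hw.of_abs hw1 f hx
    refine continuousOn_tsum (fun k => ?_) (hw.mul_right M) fun k x hx => ?_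
    · exact (hf.comp (foldMap ℓ e k).continuous.continuousOn
        fun x hx => foldMap_nonneg he k hx).const_smul (w k)
    · rw [norm_smul, Real.norm_eq_abs]
      exact mul_le_mul_of_nonneg_left (hM _ (foldMap_nonneg he k hx)) (abs_nonneg _)
  rw [← continuousOn_univ]
  have : (univ : Set W) = {x | 0 ≤ ℓ x} ∪ {x | ℓ x ≤ 0} := by
    ext x; simpa using le_total 0 (ℓ x)
  rw [this]
  exact hp.union_of_isClosed hn (isClosed_le continuous_const ℓ.continuous)
    (isClosed_le ℓ.continuous continuous_const)

/-- The derivative of a half space extension is made of half space extensions of the derivative: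
the part transversal to the boundary has its weights multiplied by the dilation factors `-2 ^ k`. -/
def halfSpaceExtDeriv (ℓ : W →L[ℝ] ℝ) (e : W) (w : ℕ → ℝ) (f : W → F) (x : W) : W →L[ℝ] F :=
  halfSpaceExt ℓ e w (fun y => (fderivWithin ℝ f {x | 0 ≤ ℓ x} y).comp
    (ContinuousLinearMap.id ℝ W - ℓ.smulRight e)) x +
  halfSpaceExt ℓ e (fun k => w k * -2 ^ k) (fun y => (fderivWithin ℝ f {x | 0 ≤ ℓ x} y).comp
    (ℓ.smulRight e)) x

theorem BoundedSmooth.comp_left {f : W → F} (hf : BoundedSmooth ℓ f) (he : ℓ e = 1)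
    {G : Type} [NormedAddCommGroup G] [NormedSpace ℝ G] (L : F →L[ℝ] G) :
    BoundedSmooth ℓ (fun x => L (f x)) := by
  refine ⟨L.contDiff.comp_contDiffOn hf.1, fun j => ?_⟩
  obtain ⟨C, hC⟩ := hf.2 j
  refine ⟨‖L‖ * C, fun x hx => ?_⟩
  refine (L.norm_iteratedFDerivWithin_comp_left (hf.1 x hx) (uniqueDiffOn_halfSpace he) hx
    (mod_cast le_top : (j : ℕ∞ω) ≤ (∞ : ℕ∞ω))).trans ?_
  exact mul_le_mul_of_nonneg_left (hC x hx) (norm_nonneg _)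

theorem BoundedSmooth.fderivWithin {f : W → F} (hf : BoundedSmooth ℓ f) (he : ℓ e = 1) :
    BoundedSmooth ℓ (fderivWithin ℝ f {x | 0 ≤ ℓ x}) := by
  refine ⟨hf.1.fderivWithin (uniqueDiffOn_halfSpace he) (by simp), fun j => ?_⟩
  obtain ⟨C, hC⟩ := hf.2 (j + 1)
  refine ⟨C, fun x hx => ?_⟩
  rw [norm_iteratedFDerivWithin_fderivWithin (uniqueDiffOn_halfSpace he) hx]
  exact hC x hx

theorem BoundedSmooth.fderivWithin_comp {f : W → F} (hf : BoundedSmooth ℓ f) (he : ℓ e = 1)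
    (P : W →L[ℝ] W) :
    BoundedSmooth ℓ (fun x => (_root_.fderivWithin ℝ f {x | 0 ≤ ℓ x} x).comp P) :=
  (hf.fderivWithin he).comp_left he ((ContinuousLinearMap.compL ℝ W W F).flip P)

theorem BoundedSmooth.norm_le {f : W → F} (hf : BoundedSmooth ℓ f) :
    ∃ M, ∀ x, 0 ≤ ℓ x → ‖f x‖ ≤ M := by
  obtain ⟨M, hM⟩ := hf.2 0
  exact ⟨M, fun x hx => by simpa using hM x hx⟩

theorem continuous_halfSpaceExtDeriv [CompleteSpace F] (he : ℓ e = 1) {w : ℕ → ℝ}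
    (hw : Summable fun k => |w k|) (hw1 : ∑' k, w k = 1) (hw' : Summable fun k => |w k * -2 ^ k|)
    (hw1' : ∑' k, w k * -2 ^ k = 1) {f : W → F} (hf : BoundedSmooth ℓ f) :
    Continuous (halfSpaceExtDeriv ℓ e w f) := by
  have h1 := hf.fderivWithin_comp he (ContinuousLinearMap.id ℝ W - ℓ.smulRight e)
  have h2 := hf.fderivWithin_comp he (ℓ.smulRight e)
  obtain ⟨M1, hM1⟩ := h1.norm_le
  obtain ⟨M2, hM2⟩ := h2.norm_le
  exact (continuous_halfSpaceExt he hw hw1 h1.1.continuousOn hM1).add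
    (continuous_halfSpaceExt he hw' hw1' h2.1.continuousOn hM2)

/-- On the open half spaces the derivative is computed directly; on the hyperplane the one-sided
derivatives exist by continuity of the derivative up to the boundary, and the two moment conditions
make them agree. -/
theorem hasFDerivAt_halfSpaceExt [CompleteSpace F] (he : ℓ e = 1) {w : ℕ → ℝ}
    (hw : Summable fun k => |w k|) (hw1 : ∑' k, w k = 1) (hw' : Summable fun k => |w k * -2 ^ k|)
    (hw1' : ∑' k, w k * -2 ^ k = 1) {f : W → F} (hf : BoundedSmooth ℓ f) (x : W) :
    HasFDerivAt (halfSpaceExt ℓ e w f) (halfSpaceExtDeriv ℓ e w f x) x := by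
  have hdiff : ∀ y, 0 ≤ ℓ y →
      HasFDerivWithinAt f (_root_.fderivWithin ℝ f {x | 0 ≤ ℓ x} y) {x | 0 ≤ ℓ x} y := fun y hy =>
    ((hf.1 y hy).differentiableWithinAt (by simp)).hasFDerivWithinAt
  have hnear : ∀ y, 0 < ℓ y → {x | 0 ≤ ℓ x} ∈ 𝓝 y := fun y hy =>
    mem_of_superset ((isOpen_lt continuous_const ℓ.continuous).mem_nhds hy)
      fun z (hz : 0 < ℓ z) => hz.le
  obtain ⟨M, hM⟩ := hf.norm_le
  obtain ⟨M', hM'⟩ := (hf.fderivWithin he).norm_le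
  have hpos : ∀ y, 0 ≤ ℓ y → halfSpaceExtDeriv ℓ e w f y =
      _root_.fderivWithin ℝ f {x | 0 ≤ ℓ x} y := by
    intro y hy
    rw [halfSpaceExtDeriv, halfSpaceExt_of_nonneg _ _ hy, halfSpaceExt_of_nonneg _ _ hy,
      ← ContinuousLinearMap.comp_add, sub_add_cancel, ContinuousLinearMap.comp_id]
  have hneg : ∀ y, ℓ y < 0 →
      HasFDerivAt (halfSpaceExt ℓ e w f) (halfSpaceExtDeriv ℓ e w f y) y := by
    intro y hy
    have hopen : IsOpen {x | ℓ x < 0} := isOpen_lt ℓ.continuous continuous_const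
    have hconv : Convex ℝ {x | ℓ x < 0} := convex_halfSpace_lt ℓ.isLinear 0
    set Df := _root_.fderivWithin ℝ f {x | 0 ≤ ℓ x}
    have hsplit : ∀ k, foldMap ℓ e k = (ContinuousLinearMap.id ℝ W - ℓ.smulRight e) +
        (-2 ^ k : ℝ) • ℓ.smulRight e := by
      intro k; ext z; simp [foldMap_apply, add_mul, add_smul, mul_smul]; abel
    have hs1 : Summable fun k => w k • (Df (foldMap ℓ e k y)).comp
        (ContinuousLinearMap.id ℝ W - ℓ.smulRight e) := by
      refine Summable.of_norm_bounded (hw.mul_right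
        (M' * ‖ContinuousLinearMap.id ℝ W - ℓ.smulRight e‖)) fun k => ?_
      rw [norm_smul, Real.norm_eq_abs]
      refine mul_le_mul_of_nonneg_left ?_ (abs_nonneg _)
      exact (ContinuousLinearMap.opNorm_comp_le _ _).trans
        (mul_le_mul_of_nonneg_right (hM' _ (foldMap_nonneg he k hy.le)) (norm_nonneg _))
    have hs2 : Summable fun k => (w k * -2 ^ k) • (Df (foldMap ℓ e k y)).comp
        (ℓ.smulRight e) := by
      refine Summable.of_norm_bounded (hw'.mul_right (M' * ‖ℓ.smulRight e‖)) fun k => ?_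
      rw [norm_smul, Real.norm_eq_abs]
      refine mul_le_mul_of_nonneg_left ?_ (abs_nonneg _)
      exact (ContinuousLinearMap.opNorm_comp_le _ _).trans
        (mul_le_mul_of_nonneg_right (hM' _ (foldMap_nonneg he k hy.le)) (norm_nonneg _))
    have hsum : halfSpaceExtDeriv ℓ e w f y =
        ∑' k, w k • (Df (foldMap ℓ e k y)).comp (foldMap ℓ e k) := by
      rw [halfSpaceExtDeriv, halfSpaceExt, halfSpaceExt, if_neg (not_le.2 hy),
        if_neg (not_le.2 hy), ← hs1.tsum_add hs2]
      refine tsum_congr fun k => ?_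
      rw [mul_smul, ← smul_add, hsplit k, ContinuousLinearMap.comp_add,
        ContinuousLinearMap.comp_smul]
    rw [hsum]
    refine HasFDerivAt.congr_of_eventuallyEq (f := fun y => ∑' k, w k • f (foldMap ℓ e k y)) ?_
      (eventually_of_mem (hopen.mem_nhds hy) fun z (hz : ℓ z < 0) => if_neg (not_le.2 hz))
    refine hasFDerivAt_tsum_of_isPreconnected (f := fun k y => w k • f (foldMap ℓ e k y))
      (f' := fun k y => w k • (Df (foldMap ℓ e k y)).comp (foldMap ℓ e k))
      (u := fun k => M' * ‖ContinuousLinearMap.id ℝ W - ℓ.smulRight e‖ * |w k| +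
        M' * ‖ℓ.smulRight e‖ * |w k * -2 ^ k|)
      ((hw.mul_left _).add (hw'.mul_left _)) hopen hconv.isPreconnected
      (fun k z hz => ?_) (fun k z hz => ?_) hy ?_ hy
    · have h1 : HasFDerivAt f (Df (foldMap ℓ e k z)) (foldMap ℓ e k z) :=
        (hdiff _ (foldMap_nonneg he k (le_of_lt hz))).hasFDerivAt (hnear _ (foldMap_pos he k hz))
      exact (h1.comp z (foldMap ℓ e k).hasFDerivAt).const_smul (w k)
    · have hb := hM' _ (foldMap_nonneg he k (le_of_lt hz))
      have hM'0 : 0 ≤ M' := (norm_nonneg _).trans hb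
      have hn : ‖foldMap ℓ e k‖ ≤ ‖ContinuousLinearMap.id ℝ W - ℓ.smulRight e‖ +
          |(-2 ^ k : ℝ)| * ‖ℓ.smulRight e‖ := by
        rw [hsplit k]
        refine (norm_add_le _ _).trans ?_
        rw [norm_smul, Real.norm_eq_abs]
      rw [norm_smul, Real.norm_eq_abs, abs_mul]
      calc |w k| * ‖(Df (foldMap ℓ e k z)).comp (foldMap ℓ e k)‖
          ≤ |w k| * (M' * (‖ContinuousLinearMap.id ℝ W - ℓ.smulRight e‖ +
          |(-2 ^ k : ℝ)| * ‖ℓ.smulRight e‖)) := by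
            refine mul_le_mul_of_nonneg_left ?_ (abs_nonneg _)
            exact (ContinuousLinearMap.opNorm_comp_le _ _).trans
              (mul_le_mul hb hn (norm_nonneg _) hM'0)
        _ = _ := by ring
    · refine Summable.of_norm_bounded (hw.mul_right M) fun k => ?_
      rw [norm_smul, Real.norm_eq_abs]
      exact mul_le_mul_of_nonneg_left (hM _ (foldMap_nonneg he k hy.le)) (abs_nonneg _)
  rcases lt_trichotomy (ℓ x) 0 with hx | hx | hx
  · exact hneg x hx
  · have hcl : closure {x | ℓ x < 0} = {x | ℓ x ≤ 0} := by
      refine Subset.antisymm (closure_minimal (fun z (hz : ℓ z < 0) => hz.le)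
        (isClosed_le ℓ.continuous continuous_const)) fun z (hz : ℓ z ≤ 0) => ?_
      have ht : Tendsto (fun t : ℝ => z - t • e) (𝓝[>] 0) (𝓝 z) := by
        have : Continuous fun t : ℝ => z - t • e := by fun_prop
        simpa using (this.tendsto 0).mono_left (nhdsWithin_le_nhds (s := Ioi 0))
      refine mem_closure_of_tendsto ht ?_
      filter_upwards [self_mem_nhdsWithin] with t (ht : 0 < t)
      simp only [map_sub, map_smul, he, smul_eq_mul, mul_one]
      linarith
    have h1 : HasFDerivWithinAt (halfSpaceExt ℓ e w f) (halfSpaceExtDeriv ℓ e w f x)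
        {x | 0 ≤ ℓ x} x := by
      rw [hpos x hx.ge]
      exact (hdiff x hx.ge).congr (fun z hz => halfSpaceExt_of_nonneg w f hz)
        (halfSpaceExt_of_nonneg w f hx.ge)
    have hcont := continuous_halfSpaceExt he hw hw1 hf.1.continuousOn hM
    have h2 : HasFDerivWithinAt (halfSpaceExt ℓ e w f) (halfSpaceExtDeriv ℓ e w f x)
        {x | ℓ x ≤ 0} x := by
      rw [← hcl]
      refine hasFDerivWithinAt_closure_of_tendsto_fderiv
        (fun z hz => (hneg z hz).differentiableAt.differentiableWithinAt)
        (convex_halfSpace_lt ℓ.isLinear 0) (isOpen_lt ℓ.continuous continuous_const)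
        (fun z _ => hcont.continuousWithinAt) ?_
      refine Tendsto.congr' (f₁ := halfSpaceExtDeriv ℓ e w f) ?_
        ((continuous_halfSpaceExtDeriv he hw hw1 hw' hw1' hf).tendsto x |>.mono_left
          nhdsWithin_le_nhds)
      filter_upwards [self_mem_nhdsWithin] with z hz
      exact (hneg z hz).fderiv.symm
    have h3 := h1.union h2
    have : {x | 0 ≤ ℓ x} ∪ {x | ℓ x ≤ 0} = univ := by
      ext x; simpa using le_total 0 (ℓ x)
    rwa [this, hasFDerivWithinAt_univ] at h3
  · rw [hpos x hx.le]
    refine ((hdiff x hx.le).hasFDerivAt (hnear x hx)).congr_of_eventuallyEq ?_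
    filter_upwards [hnear x hx] with z hz
    exact halfSpaceExt_of_nonneg w f hz

/-- All the weighted sequences `a k * (-2 ^ k) ^ r` are summable with sum one. -/
structure IsSeeleySequence (a : ℕ → ℝ) : Prop where
  summable : ∀ r : ℕ, Summable fun k => |a k * (-2 ^ k) ^ r|
  tsum_eq : ∀ r : ℕ, ∑' k, a k * (-2 ^ k) ^ r = 1

theorem exists_isSeeleySequence : ∃ a, IsSeeleySequence a := by
  obtain ⟨a, ha⟩ := exists_alternating_moments
  refine ⟨a, fun r => ?_, fun r => ?_⟩
  · simpa [abs_mul] using (ha r).1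
  · have : ∀ k : ℕ, a k * (-2 ^ k) ^ r = (-1) ^ r * (a k * (2 ^ k) ^ r) := fun k => by
      rw [neg_pow (2 ^ k : ℝ)]; ring
    simp_rw [this, tsum_mul_left, (ha r).2, ← mul_pow]
    norm_num

theorem IsSeeleySequence.succ_eq (a : ℕ → ℝ) (r : ℕ) :
    (fun k => a k * (-2 ^ k) ^ r * -2 ^ k) = fun k => a k * (-2 ^ k) ^ (r + 1) := by
  ext k; rw [pow_succ, mul_assoc]

variable {a : ℕ → ℝ} [CompleteSpace F]

theorem IsSeeleySequence.hasFDerivAt (ha : IsSeeleySequence a) (he : ℓ e = 1) (r : ℕ) {f : W → F}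
    (hf : BoundedSmooth ℓ f) (x : W) :
    HasFDerivAt (halfSpaceExt ℓ e (fun k => a k * (-2 ^ k) ^ r) f)
      (halfSpaceExtDeriv ℓ e (fun k => a k * (-2 ^ k) ^ r) f x) x := by
  refine hasFDerivAt_halfSpaceExt he (ha.summable r) (ha.tsum_eq r) ?_ ?_ hf x
  · rw [show (fun k => |a k * (-2 ^ k) ^ r * -2 ^ k|) = fun k => |a k * (-2 ^ k) ^ (r + 1)| from
      funext fun k => congrArg abs (congrFun (succ_eq a r) k)]
    exact ha.summable (r + 1)
  · rw [succ_eq]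
    exact ha.tsum_eq (r + 1)

theorem IsSeeleySequence.contDiff_nat (ha : IsSeeleySequence a) (he : ℓ e = 1) (n : ℕ) :
    ∀ {F : Type} [NormedAddCommGroup F] [NormedSpace ℝ F] [CompleteSpace F] (r : ℕ) {f : W → F},
      BoundedSmooth ℓ f → ContDiff ℝ n (halfSpaceExt ℓ e (fun k => a k * (-2 ^ k) ^ r) f) := by
  induction n with
  | zero =>
    intro F _ _ _ r f hf
    obtain ⟨M, hM⟩ := hf.norm_le
    exact contDiff_zero.2
      (continuous_halfSpaceExt he (ha.summable r) (ha.tsum_eq r) hf.1.continuousOn hM)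
  | succ n ih =>
    intro F _ _ _ r f hf
    refine contDiff_succ_iff_hasFDerivAt.2 ⟨_, ?_, ha.hasFDerivAt he r hf⟩
    unfold halfSpaceExtDeriv
    rw [succ_eq]
    exact (ih r (hf.fderivWithin_comp he _)).add (ih (r + 1) (hf.fderivWithin_comp he _))

/-- The extension operator does not lose derivatives: the derivatives of order `j` of the extension
are controlled by those of `f`, uniformly in `f`. -/
theorem IsSeeleySequence.norm_iteratedFDeriv_le (ha : IsSeeleySequence a) (he : ℓ e = 1) (j : ℕ) :
    ∀ r : ℕ, ∃ C : ℝ, 0 ≤ C ∧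
      ∀ {F : Type} [NormedAddCommGroup F] [NormedSpace ℝ F] [CompleteSpace F] {f : W → F},
      BoundedSmooth ℓ f → ∀ M : ℝ,
        (∀ x, 0 ≤ ℓ x → ‖iteratedFDerivWithin ℝ j f {x | 0 ≤ ℓ x} x‖ ≤ M) → ∀ x,
        ‖iteratedFDeriv ℝ j (halfSpaceExt ℓ e (fun k => a k * (-2 ^ k) ^ r) f) x‖ ≤ C * M := by
  induction j with
  | zero =>
    intro r
    refine ⟨1 + ∑' k, |a k * (-2 ^ k) ^ r|, ?_, ?_⟩
    · have : 0 ≤ ∑' k, |a k * (-2 ^ k) ^ r| := tsum_nonneg fun _ => abs_nonneg _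
      linarith
    · intro F _ _ _ f hf M hM x
      rw [norm_iteratedFDeriv_zero]
      exact norm_halfSpaceExt_le he (ha.summable r) (fun x hx => by simpa using hM x hx) x
  | succ j ih =>
    intro r
    obtain ⟨C₁, h₁, hC₁⟩ := ih r
    obtain ⟨C₂, h₂, hC₂⟩ := ih (r + 1)
    refine ⟨C₁ * ‖ContinuousLinearMap.id ℝ W - ℓ.smulRight e‖ + C₂ * ‖ℓ.smulRight e‖,
      by positivity, ?_⟩
    intro F _ _ _ f hf M hM x
    have hP : ∀ P : W →L[ℝ] W, ∀ x, 0 ≤ ℓ x → ‖iteratedFDerivWithin ℝ j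
        (fun y => (_root_.fderivWithin ℝ f {x | 0 ≤ ℓ x} y).comp P) {x | 0 ≤ ℓ x} x‖ ≤
        ‖P‖ * M := by
      intro P x hx
      set L := (ContinuousLinearMap.compL ℝ W W F).flip P
      have hL : ‖L‖ ≤ ‖P‖ := L.opNorm_le_bound (norm_nonneg _) fun Q => by
        rw [mul_comm]; exact ContinuousLinearMap.opNorm_comp_le Q P
      refine (L.norm_iteratedFDerivWithin_comp_left ((hf.fderivWithin he).1 x hx)
        (uniqueDiffOn_halfSpace he) hx (mod_cast le_top : (j : ℕ∞ω) ≤ (∞ : ℕ∞ω))).trans ?_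
      rw [norm_iteratedFDerivWithin_fderivWithin (uniqueDiffOn_halfSpace he) hx]
      exact mul_le_mul hL (hM x hx) (norm_nonneg _) (norm_nonneg _)
    rw [← norm_iteratedFDeriv_fderiv]
    have hd : fderiv ℝ (halfSpaceExt ℓ e (fun k => a k * (-2 ^ k) ^ r) f) =
        halfSpaceExtDeriv ℓ e (fun k => a k * (-2 ^ k) ^ r) f :=
      funext fun x => (ha.hasFDerivAt he r hf x).fderiv
    have h1 := hf.fderivWithin_comp he (ContinuousLinearMap.id ℝ W - ℓ.smulRight e)
    have h2 := hf.fderivWithin_comp he (ℓ.smulRight e)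
    rw [hd]
    unfold halfSpaceExtDeriv
    rw [succ_eq]
    rw [fun_iteratedFDeriv_add (ha.contDiff_nat he j r h1) (ha.contDiff_nat he j (r + 1) h2)]
    refine (norm_add_le _ _).trans ?_
    rw [add_mul, mul_assoc, mul_assoc]
    exact add_le_add (hC₁ h1 _ (hP _) x) (hC₂ h2 _ (hP _) x)

theorem IsSeeleySequence.contDiff (ha : IsSeeleySequence a) (he : ℓ e = 1) {f : W → F}
    (hf : BoundedSmooth ℓ f) : ContDiff ℝ ∞ (halfSpaceExt ℓ e a f) :=
  contDiff_infty.2 fun n => by simpa using ha.contDiff_nat he n 0 hf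

theorem IsSeeleySequence.norm_iteratedFDeriv_halfSpaceExt_le (ha : IsSeeleySequence a)
    (he : ℓ e = 1) (j : ℕ) : ∃ C : ℝ, 0 ≤ C ∧
      ∀ {F : Type} [NormedAddCommGroup F] [NormedSpace ℝ F] [CompleteSpace F] {f : W → F},
      BoundedSmooth ℓ f → ∀ M : ℝ,
        (∀ x, 0 ≤ ℓ x → ‖iteratedFDerivWithin ℝ j f {x | 0 ≤ ℓ x} x‖ ≤ M) → ∀ x,
        ‖iteratedFDeriv ℝ j (halfSpaceExt ℓ e a f) x‖ ≤ C * M := by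
  simpa using ha.norm_iteratedFDeriv_le he j 0

/-- The extension operator commutes with continuous linear maps of the values. -/
theorem IsSeeleySequence.halfSpaceExt_comp_left (ha : IsSeeleySequence a) (he : ℓ e = 1)
    {f : W → F} {M : ℝ} (hM : ∀ x, 0 ≤ ℓ x → ‖f x‖ ≤ M)
    {G : Type} [NormedAddCommGroup G] [NormedSpace ℝ G] (L : F →L[ℝ] G) (x : W) :
    halfSpaceExt ℓ e a (fun y => L (f y)) x = L (halfSpaceExt ℓ e a f x) := by
  rw [halfSpaceExt, halfSpaceExt]
  split_ifs with hx
  · rfl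
  · have hs : Summable fun k => a k • f (foldMap ℓ e k x) := by
      have h0 : Summable fun k => |a k| := by simpa using ha.summable 0
      refine Summable.of_norm_bounded (h0.mul_right M) fun k => ?_
      rw [norm_smul, Real.norm_eq_abs]
      exact mul_le_mul_of_nonneg_left (hM _ (foldMap_nonneg he k (not_le.1 hx).le)) (abs_nonneg _)
    rw [L.map_tsum hs]
    simp

end HalfSpace

set_option synthInstance.maxHeartbeats 200000
set_option maxSynthPendingDepth 6

/-! ### Calculus in spaces of continuous functions -/

section Superposition

open Filter Topology

variable {K : Type} [TopologicalSpace K] [CompactSpace K]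
  {E : Type} [NormedAddCommGroup E] [NormedSpace ℝ E]
  {F : Type} [NormedAddCommGroup F] [NormedSpace ℝ F]
  {G : Type} [NormedAddCommGroup G] [NormedSpace ℝ G]

/-- The bilinear map on continuous functions given by pointwise application of a bilinear map. -/
def pointwise (K : Type) [TopologicalSpace K] [CompactSpace K] (B : E →L[ℝ] F →L[ℝ] G) :
    C(K, E) →L[ℝ] C(K, F) →L[ℝ] C(K, G) :=
  LinearMap.mkContinuous₂
    (LinearMap.mk₂ ℝ (fun (γ : C(K, E)) (η : C(K, F)) =>
        (⟨fun t => B (γ t) (η t), by fun_prop⟩ : C(K, G)))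
      (fun _ _ _ => by ext; simp) (fun _ _ _ => by ext; simp)
      (fun _ _ _ => by ext; simp) (fun _ _ _ => by ext; simp)) ‖B‖ fun γ η => by
    refine (ContinuousMap.norm_le _ (by positivity)).2 fun t => ?_
    exact (B.le_opNorm₂ _ _).trans (mul_le_mul (mul_le_mul_of_nonneg_left (γ.norm_coe_le_norm t)
      (norm_nonneg B)) (η.norm_coe_le_norm t) (norm_nonneg _) (by positivity))

theorem norm_pointwise_le (B : E →L[ℝ] F →L[ℝ] G) : ‖pointwise K B‖ ≤ ‖B‖ :=
  LinearMap.mkContinuous₂_norm_le _ (norm_nonneg B) _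

/-- The superposition (Nemytskii) operator `γ ↦ f ∘ γ`. -/
def superposition (K : Type) [TopologicalSpace K] {f : E → F} (hf : Continuous f) (γ : C(K, E)) :
    C(K, F) := (⟨f, hf⟩ : C(E, F)).comp γ

@[simp] theorem superposition_apply {f : E → F} (hf : Continuous f) (γ : C(K, E)) (t : K) :
    superposition K hf γ t = f (γ t) := rfl

theorem hasFDerivAt_superposition {f : E → F} (hf : Continuous f) {f' : E → E →L[ℝ] F}
    (hf' : Continuous f') (hd : ∀ x, HasFDerivAt f (f' x) x) (γ : C(K, E)) :
    HasFDerivAt (superposition K hf)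
      (pointwise K (ContinuousLinearMap.id ℝ (E →L[ℝ] F)) (superposition K hf' γ)) γ := by
  rw [hasFDerivAt_iff_isLittleO_nhds_zero, Asymptotics.isLittleO_iff]
  intro ε hε
  have hc : Continuous (superposition K hf') := ContinuousMap.continuous_postcomp _
  obtain ⟨δ, hδ, h⟩ := Metric.continuousAt_iff.1 (hc.continuousAt (x := γ)) ε hε
  filter_upwards [Metric.ball_mem_nhds (0 : C(K, E)) hδ] with η hη
  refine (ContinuousMap.norm_le _ (by positivity)).2 fun t => ?_
  have hseg : ∀ x ∈ segment ℝ (γ t) (γ t + η t), ‖f' x - f' (γ t)‖ ≤ ε := by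
    intro x hx
    rw [segment_eq_image'] at hx
    obtain ⟨s, hs, rfl⟩ := hx
    have h1 : dist (γ + s • η) γ < δ := by
      rw [dist_eq_norm, add_sub_cancel_left, norm_smul, Real.norm_of_nonneg hs.1]
      have : ‖η‖ < δ := by simpa using hη
      nlinarith [norm_nonneg η, hs.2]
    have h2 := (h h1).le
    rw [dist_eq_norm] at h2
    have h3 := ((superposition K hf' (γ + s • η) - superposition K hf' γ).norm_coe_le_norm t).trans
      h2
    simpa using h3
  have := (convex_segment (𝕜 := ℝ) (γ t) (γ t + η t)).norm_image_sub_le_of_norm_hasFDerivWithin_le'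
    (fun x _ => (hd x).hasFDerivWithinAt) hseg (left_mem_segment ℝ _ _) (right_mem_segment ℝ _ _)
  simp only [add_sub_cancel_left] at this
  refine this.trans (mul_le_mul_of_nonneg_left (η.norm_coe_le_norm t) hε.le)

theorem contDiff_superposition_nat (n : ℕ) :
    ∀ {F : Type} [NormedAddCommGroup F] [NormedSpace ℝ F] {f : E → F} (hf : ContDiff ℝ n f),
      ContDiff ℝ n (superposition K hf.continuous) := by
  induction n with
  | zero =>
    intro F _ _ f hf
    exact contDiff_zero.2 (ContinuousMap.continuous_postcomp _)
  | succ n ih =>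
    intro F _ _ f hf
    obtain ⟨f', hf', hd⟩ := contDiff_succ_iff_hasFDerivAt.1 hf
    let L : C(K, E →L[ℝ] F) →L[ℝ] C(K, E) →L[ℝ] C(K, F) :=
      pointwise K (ContinuousLinearMap.id ℝ (E →L[ℝ] F))
    have h1 : ContDiff ℝ n (superposition K hf'.continuous) := ih hf'
    have h2 : ContDiff ℝ n (fun γ => L (superposition K hf'.continuous γ)) := by
      have h0 : ContDiff ℝ n (L : C(K, E →L[ℝ] F) → (C(K, E) →L[ℝ] C(K, F))) :=
        ContinuousLinearMap.contDiff L
      exact h0.comp h1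
    have h3 : ∀ γ, HasFDerivAt (superposition K hf.continuous)
        (L (superposition K hf'.continuous γ)) γ := fun γ => hasFDerivAt_superposition _ _ hd γ
    exact contDiff_succ_iff_hasFDerivAt.2 ⟨_, h2, h3⟩

theorem contDiff_superposition {f : E → F} (hf : ContDiff ℝ ∞ f) :
    ContDiff ℝ ∞ (superposition K hf.continuous) :=
  contDiff_infty.2 fun n => contDiff_superposition_nat n (contDiff_infty.1 hf n)

/-- Superposition operators inherit bounds on derivatives. -/
theorem norm_iteratedFDeriv_superposition_le (n : ℕ) :
    ∀ {F : Type} [NormedAddCommGroup F] [NormedSpace ℝ F] {f : E → F} (hf : ContDiff ℝ ∞ f) (M : ℝ),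
      0 ≤ M → (∀ x, ‖iteratedFDeriv ℝ n f x‖ ≤ M) → ∀ γ : C(K, E),
      ‖iteratedFDeriv ℝ n (superposition K hf.continuous) γ‖ ≤ M := by
  induction n with
  | zero =>
    intro F _ _ f hf M hM h γ
    rw [norm_iteratedFDeriv_zero]
    exact (ContinuousMap.norm_le _ hM).2 fun t => by simpa using h (γ t)
  | succ n ih =>
    intro F _ _ f hf M hM h γ
    have hf' : ContDiff ℝ ∞ (fderiv ℝ f) := hf.fderiv_right (by simp)
    have hd : fderiv ℝ (superposition K hf.continuous) = fun γ =>
        pointwise K (ContinuousLinearMap.id ℝ (E →L[ℝ] F)) (superposition K hf'.continuous γ) :=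
      funext fun γ => (hasFDerivAt_superposition _ _
        (fun x => (hf.differentiable (by simp) x).hasFDerivAt) γ).fderiv
    rw [← norm_iteratedFDeriv_fderiv, hd]
    refine ((pointwise K (ContinuousLinearMap.id ℝ (E →L[ℝ] F))).norm_iteratedFDeriv_comp_left
      (contDiff_superposition hf').contDiffAt (mod_cast le_top : (n : ℕ∞ω) ≤ (∞ : ℕ∞ω))).trans ?_
    have h1 := ih hf' M hM (fun x => by rw [norm_iteratedFDeriv_fderiv]; exact h x) γ
    have h2 : ‖pointwise K (ContinuousLinearMap.id ℝ (E →L[ℝ] F))‖ ≤ 1 :=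
      (norm_pointwise_le _).trans ContinuousLinearMap.norm_id_le
    exact (mul_le_mul h2 h1 (norm_nonneg _) zero_le_one).trans_eq (one_mul M)

/-- A smooth perturbation of the identity by a contraction has a smooth right inverse. -/
theorem exists_contDiff_rightInverse [CompleteSpace E] {k : E → E} (hk : ContDiff ℝ ∞ k)
    (hl : LipschitzWith (1 / 2) k) :
    ∃ h : E → E, ContDiff ℝ ∞ h ∧ ∀ y, h y - k (h y) = y := by
  have ha : ApproximatesLinearOn (fun x => x - k x)
      ((ContinuousLinearEquiv.refl ℝ E : E ≃L[ℝ] E) : E →L[ℝ] E) univ (1 / 2) := by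
    intro x _ y _
    have := hl.norm_sub_le x y
    rw [norm_sub_rev] at this
    simpa [sub_sub_sub_cancel_left, sub_sub_sub_comm] using this
  have hc : Subsingleton E ∨
      (1 / 2 : ℝ≥0) < ‖((ContinuousLinearEquiv.refl ℝ E).symm : E →L[ℝ] E)‖₊⁻¹ := by
    rcases subsingleton_or_nontrivial E with h | h
    · exact Or.inl h
    · right
      have : ‖((ContinuousLinearEquiv.refl ℝ E).symm : E →L[ℝ] E)‖₊ = 1 := by
        ext
        exact ContinuousLinearMap.norm_id
      rw [this, inv_one]
      exact NNReal.half_lt_self one_ne_zero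
  set f : E ≃ₜ E := ha.toHomeomorph _ hc
  have hf : (f : E → E) = fun x => x - k x := rfl
  have hn : ∀ x, ‖fderiv ℝ k x‖ < 1 := fun x =>
    (norm_fderiv_le_of_lipschitz ℝ hl).trans_lt (by norm_num)
  refine ⟨f.symm, ?_, fun y => f.apply_symm_apply y⟩
  refine f.contDiff_symm (f₀' := fun x =>
    ContinuousLinearEquiv.unitsEquiv ℝ E (Units.oneSub (fderiv ℝ k x) (hn x))) (fun x => ?_) ?_
  · exact (hasFDerivAt_id x).sub (hk.differentiable (by simp) x).hasFDerivAt
  · exact contDiff_id.sub hk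

end Superposition

/-! ### Differential equations on spaces of paths -/

section Paths

open Filter Topology

variable {T : ℝ} {E : Type} [NormedAddCommGroup E] [NormedSpace ℝ E]
  {F : Type} [NormedAddCommGroup F] [NormedSpace ℝ F]
  {G : Type} [NormedAddCommGroup G] [NormedSpace ℝ G]

/-- The primitive `t ↦ ∫₀ᵗ γ` of a path. -/
def primitive (hT : 0 ≤ T) : C(Icc (0 : ℝ) T, E) →L[ℝ] C(Icc (0 : ℝ) T, E) :=
  LinearMap.mkContinuous
    { toFun := fun γ => ⟨fun t => ∫ s in (0 : ℝ)..t, IccExtend hT γ s,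
        (intervalIntegral.continuous_primitive
          (fun a b => (γ.continuous.Icc_extend' (h := hT)).intervalIntegrable a b) 0).comp
          continuous_subtype_val⟩
      map_add' := fun γ η => by
        ext t
        exact intervalIntegral.integral_add
          ((γ.continuous.Icc_extend' (h := hT)).intervalIntegrable _ _)
          ((η.continuous.Icc_extend' (h := hT)).intervalIntegrable _ _)
      map_smul' := fun c γ => by
        ext t
        exact intervalIntegral.integral_smul c _ } T fun γ => by
    refine (ContinuousMap.norm_le _ (mul_nonneg hT (norm_nonneg γ))).2 fun t => ?_
    refine (intervalIntegral.norm_integral_le_of_norm_le_const (C := ‖γ‖)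
      fun s _ => γ.norm_coe_le_norm _).trans ?_
    rw [sub_zero, abs_of_nonneg t.2.1, mul_comm]
    exact mul_le_mul_of_nonneg_right t.2.2 (norm_nonneg γ)

theorem primitive_apply (hT : 0 ≤ T) (γ : C(Icc (0 : ℝ) T, E)) (t : Icc (0 : ℝ) T) :
    primitive hT γ t = ∫ s in (0 : ℝ)..t, IccExtend hT γ s := rfl

theorem norm_primitive_le (hT : 0 ≤ T) :
    ‖(primitive hT : C(Icc (0 : ℝ) T, E) →L[ℝ] C(Icc (0 : ℝ) T, E))‖ ≤ T :=
  LinearMap.mkContinuous_norm_le _ hT _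

/-- The path `γ` is differentiable with derivative `γ'`. -/
def HasPathDeriv (hT : 0 ≤ T) (γ γ' : C(Icc (0 : ℝ) T, E)) : Prop :=
  ∀ t : Icc (0 : ℝ) T, HasDerivWithinAt (IccExtend hT γ) (γ' t) (Icc 0 T) t

theorem hasPathDeriv_add_primitive [CompleteSpace E] (hT : 0 ≤ T) (c : E)
    (γ : C(Icc (0 : ℝ) T, E)) :
    HasPathDeriv hT (ContinuousMap.const _ c + primitive hT γ) γ := by
  intro t
  have h1 := ((γ.continuous.Icc_extend' (h := hT)).integral_hasStrictDerivAt 0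
    (t : ℝ)).hasDerivAt.const_add c
  rw [IccExtend_val] at h1
  refine h1.hasDerivWithinAt.congr (fun s hs => ?_) ?_
  · rw [IccExtend_of_mem hT _ hs]; rfl
  · rw [IccExtend_val]; rfl

theorem HasPathDeriv.eq_add_primitive [CompleteSpace E] {hT : 0 ≤ T} {γ γ' : C(Icc (0 : ℝ) T, E)}
    (h : HasPathDeriv hT γ γ') :
    γ = ContinuousMap.const _ (γ ⟨0, left_mem_Icc.2 hT⟩) + primitive hT γ' := by
  ext t
  have h1 : ∫ s in (0 : ℝ)..t, IccExtend hT γ' s =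
      IccExtend hT γ t - IccExtend hT γ 0 := by
    refine intervalIntegral.integral_eq_sub_of_hasDerivAt_of_le t.2.1
      (γ.continuous.Icc_extend' (h := hT)).continuousOn (fun s hs => ?_)
      ((γ'.continuous.Icc_extend' (h := hT)).intervalIntegrable _ _)
    have hs' : s ∈ Icc 0 T := ⟨hs.1.le, hs.2.le.trans t.2.2⟩
    rw [IccExtend_of_mem hT _ hs']
    exact (h ⟨s, hs'⟩).hasDerivAt (Icc_mem_nhds hs.1 (hs.2.trans_le t.2.2))
  simp only [ContinuousMap.add_apply, ContinuousMap.const_apply, primitive_apply, h1,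
    IccExtend_val]
  rw [IccExtend_left]
  abel

/-- Multiplication of paths by `t ↦ exp (c t)`. -/
def expWeight (T c : ℝ) : C(Icc (0 : ℝ) T, E) →L[ℝ] C(Icc (0 : ℝ) T, E) :=
  pointwise _ (ContinuousLinearMap.lsmul ℝ ℝ) ⟨fun t => Real.exp (c * t), by fun_prop⟩

@[simp] theorem expWeight_apply (c : ℝ) (γ : C(Icc (0 : ℝ) T, E)) (t : Icc (0 : ℝ) T) :
    expWeight T c γ t = Real.exp (c * t) • γ t := rfl

theorem expWeight_neg_apply (c : ℝ) (γ : C(Icc (0 : ℝ) T, E)) :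
    expWeight T c (expWeight T (-c) γ) = γ := by
  ext t
  simp [smul_smul, ← Real.exp_add]

theorem expWeight_apply_neg (c : ℝ) (γ : C(Icc (0 : ℝ) T, E)) :
    expWeight T (-c) (expWeight T c γ) = γ := by
  ext t
  simp [smul_smul, ← Real.exp_add]

/-- With exponential weights the primitive gains a factor `1 / c`. -/
theorem norm_expWeight_primitive_le (hT : 0 ≤ T) {c M : ℝ} (hc : 0 < c) (hM : 0 ≤ M)
    {γ : C(Icc (0 : ℝ) T, E)} (hγ : ∀ t : Icc (0 : ℝ) T, ‖γ t‖ ≤ M * Real.exp (c * t)) :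
    ‖expWeight T (-c) (primitive hT γ)‖ ≤ M / c := by
  refine (ContinuousMap.norm_le _ (by positivity)).2 fun t => ?_
  rw [expWeight_apply, norm_smul, Real.norm_of_nonneg (Real.exp_nonneg _), primitive_apply]
  have h1 : ‖∫ s in (0 : ℝ)..t, IccExtend hT γ s‖ ≤ ∫ s in (0 : ℝ)..t, M * Real.exp (c * s) := by
    refine intervalIntegral.norm_integral_le_of_norm_le t.2.1 ?_
      (Continuous.intervalIntegrable (by fun_prop) _ _)
    refine Filter.Eventually.of_forall fun s hs => ?_
    have hs' : s ∈ Icc 0 T := ⟨hs.1.le, hs.2.trans t.2.2⟩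
    rw [IccExtend_of_mem hT _ hs']
    exact hγ ⟨s, hs'⟩
  have h2 : ∫ s in (0 : ℝ)..t, M * Real.exp (c * s) = M / c * (Real.exp (c * t) - 1) := by
    have : ∀ s ∈ uIcc (0 : ℝ) t, HasDerivAt (fun s => M / c * Real.exp (c * s))
        (M * Real.exp (c * s)) s := by
      intro s _
      have h := ((hasDerivAt_id s).const_mul c).exp.const_mul (M / c)
      have h' : M / c * (Real.exp (c * s) * (c * 1)) = M * Real.exp (c * s) := by
        field_simp
      exact h' ▸ h
    rw [intervalIntegral.integral_eq_sub_of_hasDerivAt this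
      (Continuous.intervalIntegrable (by fun_prop) _ _)]
    simp [mul_sub]
  rw [h2] at h1
  calc Real.exp (-c * t) * ‖∫ s in (0 : ℝ)..t, IccExtend hT γ s‖
      ≤ Real.exp (-c * t) * (M / c * (Real.exp (c * t) - 1)) :=
        mul_le_mul_of_nonneg_left h1 (Real.exp_nonneg _)
    _ = M / c * (1 - Real.exp (-c * t)) := by
        have : Real.exp (-c * t) * Real.exp (c * t) = 1 := by
          rw [← Real.exp_add]; simp
        linear_combination (M / c) * this
    _ ≤ M / c := by
        have := Real.exp_pos (-c * t)
        have h3 : 0 ≤ M / c := by positivity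
        nlinarith

/-- The flow of a globally Lipschitz smooth vector field, as a smooth map from initial values
to paths. -/
theorem exists_contDiff_flow [CompleteSpace E] (hT : 0 ≤ T) {X : E → E} (hX : ContDiff ℝ ∞ X)
    {L : ℝ≥0} (hL : LipschitzWith L X) :
    ∃ Φ : E → C(Icc (0 : ℝ) T, E), ContDiff ℝ ∞ Φ ∧
      ∀ z, Φ z = ContinuousMap.const _ z + primitive hT (superposition _ hX.continuous (Φ z)) := by
  -- With the weight `exp (-c t)` the integral equation is a contraction, uniformly in `T`.
  set c : ℝ := 2 * L + 1 with hc
  have hc0 : 0 < c := by positivity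
  set k : C(Icc (0 : ℝ) T, E) → C(Icc (0 : ℝ) T, E) := fun u =>
    expWeight T (-c) (primitive hT (superposition _ hX.continuous (expWeight T c u))) with hk
  have hks : ContDiff ℝ ∞ k :=
    (expWeight T (-c)).contDiff.comp ((primitive hT).contDiff.comp
      ((contDiff_superposition hX).comp (expWeight T c).contDiff))
  have hkl : LipschitzWith (1 / 2) k := by
    refine LipschitzWith.of_dist_le_mul fun u v => ?_
    rw [dist_eq_norm, dist_eq_norm]
    simp only [hk]
    rw [← map_sub, ← map_sub]
    refine (norm_expWeight_primitive_le hT hc0 (M := L * ‖u - v‖) (by positivity)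
      fun t => ?_).trans ?_
    · refine (hL.norm_sub_le _ _).trans ?_
      rw [expWeight_apply, expWeight_apply, ← smul_sub, norm_smul,
        Real.norm_of_nonneg (Real.exp_nonneg _), mul_assoc, mul_comm (Real.exp _)]
      exact mul_le_mul_of_nonneg_left (mul_le_mul_of_nonneg_right
        ((u - v).norm_coe_le_norm t) (Real.exp_nonneg _)) L.2
    · rw [div_le_iff₀ hc0]
      push_cast
      have := norm_nonneg (u - v)
      nlinarith [L.2]
  obtain ⟨h, hh, hinv⟩ := exists_contDiff_rightInverse hks hkl
  refine ⟨fun z => expWeight T c (h (expWeight T (-c) (ContinuousMap.const _ z))), ?_, fun z => ?_⟩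
  · have h1 : ContDiff ℝ ∞ fun z : E => (ContinuousMap.const _ z : C(Icc (0 : ℝ) T, E)) :=
      (ContinuousLinearMap.const (R := ℝ) (M := E) (Icc (0 : ℝ) T)).contDiff
    have h2 : ∀ c, ContDiff ℝ ∞ (expWeight T c : C(Icc (0 : ℝ) T, E) → C(Icc (0 : ℝ) T, E)) :=
      fun c => (expWeight T c : C(Icc (0 : ℝ) T, E) →L[ℝ] C(Icc (0 : ℝ) T, E)).contDiff
    exact (h2 c).comp (hh.comp ((h2 (-c)).comp h1))
  · have h1 := congrArg (expWeight T c) (hinv (expWeight T (-c) (ContinuousMap.const _ z)))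
    rw [map_sub, expWeight_neg_apply, expWeight_neg_apply] at h1
    exact sub_eq_iff_eq_add.1 h1

/-- The linear equation `u' = β(b, u)`, `u(0) = c`: its solution depends smoothly on the
coefficient `b`. -/
theorem exists_contDiff_linear_solution [CompleteSpace E] (hT : 0 ≤ T) (β : F →L[ℝ] E →L[ℝ] E)
    (c : E) :
    ∃ S : C(Icc (0 : ℝ) T, F) → C(Icc (0 : ℝ) T, E), ContDiff ℝ ∞ S ∧
      ∀ b, S b = ContinuousMap.const _ c + primitive hT (pointwise _ β b (S b)) := by
  set Y := C(Icc (0 : ℝ) T, E)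
  let A : C(Icc (0 : ℝ) T, F) →L[ℝ] Y →L[ℝ] Y :=
    (ContinuousLinearMap.compL ℝ Y Y Y (primitive hT)).comp (pointwise _ β)
  have hA : ∀ b u, A b u = primitive hT (pointwise _ β b u) := fun b u => rfl
  -- `A b` becomes a contraction after conjugation with an exponential weight
  have hu : ∀ b, IsUnit (1 - A b) := by
    intro b
    set l : ℝ := 2 * (‖β‖ * ‖b‖) + 1 with hl
    have hl0 : 0 < l := by positivity
    let M : (Y →L[ℝ] Y)ˣ := ⟨expWeight T l, expWeight T (-l),
      ContinuousLinearMap.ext fun u => expWeight_neg_apply l u,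
      ContinuousLinearMap.ext fun u => expWeight_apply_neg l u⟩
    have hn : ‖(↑M⁻¹ * A b * ↑M : Y →L[ℝ] Y)‖ < 1 := by
      refine lt_of_le_of_lt (ContinuousLinearMap.opNorm_le_bound _ (M := 1 / 2) (by norm_num)
        fun u => ?_) (by norm_num)
      refine (norm_expWeight_primitive_le hT hl0 (M := ‖β‖ * ‖b‖ * ‖u‖) (by positivity)
        fun t => ?_).trans ?_
      · refine (β.le_opNorm₂ _ _).trans ?_
        have h2 : ‖expWeight T l u t‖ ≤ ‖u‖ * Real.exp (l * t) := by
          rw [expWeight_apply, norm_smul, Real.norm_of_nonneg (Real.exp_nonneg _), mul_comm]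
          exact mul_le_mul_of_nonneg_right (u.norm_coe_le_norm t) (Real.exp_nonneg _)
        have h3 := b.norm_coe_le_norm t
        calc ‖β‖ * ‖b t‖ * ‖expWeight T l u t‖ ≤ ‖β‖ * ‖b‖ * (‖u‖ * Real.exp (l * t)) := by
              gcongr
          _ = _ := by ring
      · rw [div_le_iff₀ hl0, hl]
        have := norm_nonneg u
        nlinarith [mul_nonneg (mul_nonneg (norm_nonneg β) (norm_nonneg b)) this]
    have h1 : (1 - A b : Y →L[ℝ] Y) = ↑M * (1 - ↑M⁻¹ * A b * ↑M) * ↑M⁻¹ := by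
      rw [mul_sub, sub_mul, mul_one, M.mul_inv, mul_assoc (↑M⁻¹ : Y →L[ℝ] Y), ← mul_assoc,
        M.mul_inv, one_mul, mul_assoc, M.mul_inv, mul_one]
    rw [h1]
    exact (M.isUnit.mul (Units.oneSub _ hn).isUnit).mul M⁻¹.isUnit
  refine ⟨fun b => Ring.inverse (1 - A b) (ContinuousMap.const _ c), ?_, fun b => ?_⟩
  · rw [contDiff_iff_contDiffAt]
    intro b
    obtain ⟨x, hx⟩ := hu b
    have h1 : ContDiffAt ℝ ∞ (Ring.inverse : (Y →L[ℝ] Y) → _) (1 - A b) := by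
      rw [← hx]; exact contDiffAt_ringInverse ℝ x
    have h2 : ContDiffAt ℝ ∞ (fun b => Ring.inverse (1 - A b)) b :=
      h1.comp b (contDiff_const.sub A.contDiff).contDiffAt
    exact h2.clm_apply contDiffAt_const
  · have h1 := Ring.mul_inverse_cancel _ (hu b)
    have h2 := congrArg (fun Q : Y →L[ℝ] Y => Q (ContinuousMap.const _ c)) h1
    rw [← hA]
    exact sub_eq_iff_eq_add.1 h2

/-- Gronwall's estimate for a solution of `u' = β(b, u)`. -/
theorem norm_le_of_linear_solution [CompleteSpace E] (hT : 0 ≤ T) {β : F →L[ℝ] E →L[ℝ] E} {c : E}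
    {b : C(Icc (0 : ℝ) T, F)} {u : C(Icc (0 : ℝ) T, E)}
    (h : u = ContinuousMap.const _ c + primitive hT (pointwise _ β b u)) :
    ‖u‖ ≤ ‖c‖ * Real.exp (‖β‖ * ‖b‖ * T) := by
  have h1 : HasPathDeriv hT u (pointwise _ β b u) := by
    conv_lhs => rw [h]
    exact hasPathDeriv_add_primitive hT c _
  have h0 : u ⟨0, left_mem_Icc.2 hT⟩ = c := by
    rw [h]; simp [primitive_apply]
  refine (ContinuousMap.norm_le _ (by positivity)).2 fun t => ?_
  have h2 := norm_le_gronwallBound_of_norm_deriv_right_le (f := IccExtend hT u)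
    (f' := IccExtend hT (pointwise _ β b u)) (δ := ‖c‖) (K := ‖β‖ * ‖b‖) (ε := 0) (a := 0) (b := T)
    (u.continuous.Icc_extend' (h := hT)).continuousOn (fun s hs => ?_) ?_ (fun s hs => ?_) t t.2
  · rw [IccExtend_val, gronwallBound_ε0, sub_zero] at h2
    refine h2.trans (mul_le_mul_of_nonneg_left (Real.exp_le_exp.2 ?_) (norm_nonneg c))
    exact mul_le_mul_of_nonneg_left t.2.2 (by positivity)
  · have hs' : s ∈ Icc 0 T := Ico_subset_Icc_self hs
    rw [IccExtend_of_mem hT (pointwise _ β b u) hs']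
    refine ((h1 ⟨s, hs'⟩).mono_of_mem_nhdsWithin ?_)
    exact mem_of_superset (Icc_mem_nhdsGE hs.2) (Icc_subset_Icc_left hs.1)
  · rw [IccExtend_left, h0]
  · have hs' : s ∈ Icc 0 T := Ico_subset_Icc_self hs
    rw [IccExtend_of_mem hT _ hs', IccExtend_of_mem hT _ hs', add_zero]
    refine (β.le_opNorm₂ _ _).trans ?_
    have := b.norm_coe_le_norm ⟨s, hs'⟩
    gcongr

end Paths

/-! ### Propagators of linear equations in a Banach algebra -/

section Propagator

open Filter Topology

variable {T : ℝ} {𝔸 : Type} [NormedRing 𝔸] [NormedAlgebra ℝ 𝔸]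

theorem HasPathDeriv.mul {hT : 0 ≤ T} {u u' v v' : C(Icc (0 : ℝ) T, 𝔸)}
    (hu : HasPathDeriv hT u u') (hv : HasPathDeriv hT v v') :
    HasPathDeriv hT (u * v) (u' * v + u * v') := by
  intro t
  have h := (hu t).mul (hv t)
  rw [IccExtend_val, IccExtend_val] at h
  exact h

theorem hasPathDeriv_of_eq_add_primitive {E : Type} [NormedAddCommGroup E] [NormedSpace ℝ E]
    [CompleteSpace E] {hT : 0 ≤ T} {c : E} {u u' : C(Icc (0 : ℝ) T, E)}
    (h : u = ContinuousMap.const _ c + primitive hT u') : HasPathDeriv hT u u' := by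
  conv_lhs => rw [h]
  exact hasPathDeriv_add_primitive hT c _

theorem apply_zero_of_eq_add_primitive {E : Type} [NormedAddCommGroup E] [NormedSpace ℝ E]
    {hT : 0 ≤ T} {c : E} {u u' : C(Icc (0 : ℝ) T, E)}
    (h : u = ContinuousMap.const _ c + primitive hT u') : u ⟨0, left_mem_Icc.2 hT⟩ = c := by
  rw [h]; simp [primitive_apply]

/-- `S` solves `S' = S b`, `S(0) = 1`. -/
def IsRightPropagator (hT : 0 ≤ T) (b S : C(Icc (0 : ℝ) T, 𝔸)) : Prop :=
  S = ContinuousMap.const _ 1 + primitive hT (S * b)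

/-- `Q` solves `Q' = -b Q`, `Q(0) = 1`. -/
def IsLeftPropagator (hT : 0 ≤ T) (b Q : C(Icc (0 : ℝ) T, 𝔸)) : Prop :=
  Q = ContinuousMap.const _ 1 + primitive hT (-(b * Q))

theorem exists_contDiff_propagator [CompleteSpace 𝔸] (hT : 0 ≤ T) :
    ∃ S Q : C(Icc (0 : ℝ) T, 𝔸) → C(Icc (0 : ℝ) T, 𝔸), ContDiff ℝ ∞ S ∧ ContDiff ℝ ∞ Q ∧
      ∀ b, IsRightPropagator hT b (S b) ∧ IsLeftPropagator hT b (Q b) := by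
  obtain ⟨S, hS, hS'⟩ := exists_contDiff_linear_solution hT (ContinuousLinearMap.mul ℝ 𝔸).flip 1
  obtain ⟨Q, hQ, hQ'⟩ := exists_contDiff_linear_solution hT (-ContinuousLinearMap.mul ℝ 𝔸) 1
  exact ⟨S, Q, hS, hQ, fun b => ⟨hS' b, hQ' b⟩⟩

theorem IsRightPropagator.norm_le [CompleteSpace 𝔸] {hT : 0 ≤ T} {b S : C(Icc (0 : ℝ) T, 𝔸)}
    (h : IsRightPropagator hT b S) : ‖S‖ ≤ ‖(1 : 𝔸)‖ * Real.exp (‖b‖ * T) := by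
  have h1 : ‖(ContinuousLinearMap.mul ℝ 𝔸).flip‖ ≤ 1 := by
    rw [ContinuousLinearMap.opNorm_flip]
    exact ContinuousLinearMap.opNorm_mul_le ℝ 𝔸
  refine (norm_le_of_linear_solution hT (β := (ContinuousLinearMap.mul ℝ 𝔸).flip)
    (b := b) h).trans ?_
  gcongr
  exact mul_le_of_le_one_left (norm_nonneg b) h1

theorem IsLeftPropagator.norm_le [CompleteSpace 𝔸] {hT : 0 ≤ T} {b Q : C(Icc (0 : ℝ) T, 𝔸)}
    (h : IsLeftPropagator hT b Q) : ‖Q‖ ≤ ‖(1 : 𝔸)‖ * Real.exp (‖b‖ * T) := by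
  have h1 : ‖-ContinuousLinearMap.mul ℝ 𝔸‖ ≤ 1 := by
    rw [norm_neg]
    exact ContinuousLinearMap.opNorm_mul_le ℝ 𝔸
  refine (norm_le_of_linear_solution hT (β := -ContinuousLinearMap.mul ℝ 𝔸)
    (b := b) h).trans ?_
  gcongr
  exact mul_le_of_le_one_left (norm_nonneg b) h1

theorem IsRightPropagator.mul_eq_one [CompleteSpace 𝔸] {hT : 0 ≤ T}
    {b S Q : C(Icc (0 : ℝ) T, 𝔸)} (hS : IsRightPropagator hT b S) (hQ : IsLeftPropagator hT b Q) :
    S * Q = 1 := by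
  have h := (hasPathDeriv_of_eq_add_primitive hS).mul (hasPathDeriv_of_eq_add_primitive hQ)
  have h0 : S * b * Q + S * -(b * Q) = 0 := by noncomm_ring
  rw [h0] at h
  rw [h.eq_add_primitive, ContinuousMap.mul_apply, apply_zero_of_eq_add_primitive hS,
    apply_zero_of_eq_add_primitive hQ, map_zero, add_zero, mul_one]
  rfl

theorem IsRightPropagator.mul_eq_one' [CompleteSpace 𝔸] [IsDedekindFiniteMonoid 𝔸] {hT : 0 ≤ T}
    {b S Q : C(Icc (0 : ℝ) T, 𝔸)} (hS : IsRightPropagator hT b S) (hQ : IsLeftPropagator hT b Q) :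
    Q * S = 1 := by
  ext t
  exact mul_eq_one_symm (congrArg (fun u : C(Icc (0 : ℝ) T, 𝔸) => u t) (hS.mul_eq_one hQ))

/-- If `q = e + J (q · C)` and `C` vanishes at `z`, then the derivatives of `q` at `z` are
controlled by derivatives of `q` of lower order: in the Leibniz formula the term with all
derivatives on `q` drops out. -/
theorem exists_norm_iteratedFDeriv_le_of_eq_add {Y : Type} [NormedAddCommGroup Y] [NormedSpace ℝ Y]
    (τ N : ℝ) (hτ : 0 ≤ τ) (hN : 0 ≤ N) (n : ℕ) :
    ∃ c : ℝ, 0 ≤ c ∧ ∀ {V : Type} [NormedAddCommGroup V] [NormedSpace ℝ V] {q C : V → Y} {e : Y}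
      {J : Y →L[ℝ] Y} {μ : Y →L[ℝ] Y →L[ℝ] Y} {z : V} {β : ℝ},
      ContDiff ℝ ∞ q → ContDiff ℝ ∞ C → ‖J‖ ≤ τ → ‖μ‖ ≤ 1 → ‖e‖ ≤ N →
      (∀ z, q z = e + J (μ (q z) (C z))) → C z = 0 → 1 ≤ β →
      (∀ i, 1 ≤ i → i ≤ n → ‖iteratedFDeriv ℝ i C z‖ ≤ β) →
      ∀ j ≤ n, ‖iteratedFDeriv ℝ j q z‖ ≤ c * β ^ j := by
  induction n with
  | zero =>
    refine ⟨N, hN, ?_⟩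
    intro V _ _ q C e J μ z β hq hC hJ hμ he h hz hβ hCb j hj
    obtain rfl : j = 0 := by omega
    rw [norm_iteratedFDeriv_zero, h, hz, map_zero, map_zero, add_zero, pow_zero, mul_one]
    exact he
  | succ n ih =>
    obtain ⟨c, hc, ih⟩ := ih
    refine ⟨c + τ * (2 ^ (n + 1) * c), by positivity, ?_⟩
    intro V _ _ q C e J μ z β hq hC hJ hμ he h hz hβ hCb j hj
    have ih' := ih hq hC hJ hμ he h hz hβ (fun i hi hi' => hCb i hi (by omega))
    rcases Nat.lt_or_ge j (n + 1) with hjn | hjn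
    · refine (ih' j (by omega)).trans ?_
      have : 0 ≤ τ * (2 ^ (n + 1) * c) := by positivity
      gcongr
      linarith
    obtain rfl : j = n + 1 := by omega
    set B : V → Y := fun z => μ (q z) (C z) with hB
    have hBs : ContDiff ℝ ∞ B := μ.isBoundedBilinearMap.contDiff.comp (hq.prodMk hC)
    have h1 : ‖iteratedFDeriv ℝ (n + 1) q z‖ ≤ τ * ‖iteratedFDeriv ℝ (n + 1) B z‖ := by
      have hqe : q = fun z => e + J (B z) := funext h
      have hfd : fderiv ℝ q = fderiv ℝ (fun z => J (B z)) := by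
        conv_lhs => rw [hqe]
        exact funext fun x => fderiv_const_add e
      rw [← norm_iteratedFDeriv_fderiv, hfd, norm_iteratedFDeriv_fderiv]
      refine (J.norm_iteratedFDeriv_comp_left hBs.contDiffAt
        (mod_cast le_top : ((n + 1 : ℕ) : ℕ∞ω) ≤ (∞ : ℕ∞ω))).trans ?_
      exact mul_le_mul_of_nonneg_right hJ (norm_nonneg _)
    have h2 : ‖iteratedFDeriv ℝ (n + 1) B z‖ ≤ 2 ^ (n + 1) * c * β ^ (n + 1) := by
      refine (μ.norm_iteratedFDeriv_le_of_bilinear_of_le_one hq hC z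
        (mod_cast le_top : ((n + 1 : ℕ) : ℕ∞ω) ≤ (∞ : ℕ∞ω)) hμ).trans ?_
      have hterm : ∀ i ∈ Finset.range (n + 1 + 1),
          ((n + 1).choose i : ℝ) * ‖iteratedFDeriv ℝ i q z‖ *
            ‖iteratedFDeriv ℝ (n + 1 - i) C z‖ ≤ ((n + 1).choose i : ℝ) * (c * β ^ (n + 1)) := by
        intro i hi
        rcases Nat.lt_or_ge i (n + 1) with hin | hin
        · rw [mul_assoc]
          refine mul_le_mul_of_nonneg_left ?_ (by positivity)
          calc ‖iteratedFDeriv ℝ i q z‖ * ‖iteratedFDeriv ℝ (n + 1 - i) C z‖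
              ≤ c * β ^ i * β := mul_le_mul (ih' i (by omega))
                (hCb _ (by omega) (by omega)) (norm_nonneg _) (by positivity)
            _ = c * β ^ (i + 1) := by ring
            _ ≤ c * β ^ (n + 1) :=
                mul_le_mul_of_nonneg_left (pow_le_pow_right₀ hβ (by omega)) hc
        · have : n + 1 - i = 0 := by omega
          rw [this, norm_iteratedFDeriv_zero, hz, norm_zero, mul_zero]
          positivity
      refine (Finset.sum_le_sum hterm).trans_eq ?_
      rw [← Finset.sum_mul, ← Nat.cast_sum, Nat.sum_range_choose]
      push_cast
      ring
    refine h1.trans ?_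
    have h3 : 0 ≤ c * β ^ (n + 1) := by positivity
    nlinarith [mul_le_mul_of_nonneg_left h2 hτ]

/-- The derivatives of a propagator with respect to a parameter. The powers of the norm of the
propagator enter through conjugation of the coefficient by the propagator at the point where the
derivative is taken. -/
theorem exists_norm_iteratedFDeriv_propagator_le [CompleteSpace 𝔸] [IsDedekindFiniteMonoid 𝔸]
    (hT : 0 ≤ T) (n : ℕ) :
    ∃ c : ℝ, 0 ≤ c ∧ ∀ {V : Type} [NormedAddCommGroup V] [NormedSpace ℝ V]
      {b S Q : V → C(Icc (0 : ℝ) T, 𝔸)} {z : V} {κ β : ℝ},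
      ContDiff ℝ ∞ b → ContDiff ℝ ∞ S → ContDiff ℝ ∞ Q →
      (∀ z, IsRightPropagator hT (b z) (S z)) → (∀ z, IsLeftPropagator hT (b z) (Q z)) →
      1 ≤ κ → 1 ≤ β → ‖S z‖ ≤ κ → ‖Q z‖ ≤ κ →
      (∀ i, 1 ≤ i → i ≤ n → ‖iteratedFDeriv ℝ i b z‖ ≤ β) →
      ‖iteratedFDeriv ℝ n S z‖ ≤ c * κ * (κ ^ 2 * β) ^ n ∧
        ‖iteratedFDeriv ℝ n Q z‖ ≤ c * κ * (κ ^ 2 * β) ^ n := by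
  obtain ⟨c, hc, hmain⟩ := exists_norm_iteratedFDeriv_le_of_eq_add (Y := C(Icc (0 : ℝ) T, 𝔸))
    T ‖(1 : C(Icc (0 : ℝ) T, 𝔸))‖ hT (norm_nonneg _) n
  refine ⟨c, hc, ?_⟩
  intro V _ _ b S Q z₀ κ β hb hSs hQs hS hQ hκ hβ hSκ hQκ hbβ
  have hκ0 : 0 ≤ κ := by linarith
  set U : C(Icc (0 : ℝ) T, 𝔸) := S z₀ with hU
  set U' : C(Icc (0 : ℝ) T, 𝔸) := Q z₀ with hU'
  have hUU' : U * U' = 1 := (hS z₀).mul_eq_one (hQ z₀)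
  have hU'U : U' * U = 1 := (hS z₀).mul_eq_one' (hQ z₀)
  let mulL : C(Icc (0 : ℝ) T, 𝔸) → (C(Icc (0 : ℝ) T, 𝔸) →L[ℝ] C(Icc (0 : ℝ) T, 𝔸)) := fun y =>
    ContinuousLinearMap.mul ℝ C(Icc (0 : ℝ) T, 𝔸) y
  let mulR : C(Icc (0 : ℝ) T, 𝔸) → (C(Icc (0 : ℝ) T, 𝔸) →L[ℝ] C(Icc (0 : ℝ) T, 𝔸)) := fun y =>
    (ContinuousLinearMap.mul ℝ C(Icc (0 : ℝ) T, 𝔸)).flip y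
  have hmulL : ∀ y, ‖mulL y‖ ≤ ‖y‖ := fun y =>
    ContinuousLinearMap.opNorm_mul_apply_le ℝ C(Icc (0 : ℝ) T, 𝔸) y
  have hmulR : ∀ y, ‖mulR y‖ ≤ ‖y‖ := fun y =>
    (mulR y).opNorm_le_bound (norm_nonneg y) fun x => by
      rw [mul_comm]; exact norm_mul_le x y
  -- conjugation by the propagator at `z₀`
  let A : C(Icc (0 : ℝ) T, 𝔸) →L[ℝ] C(Icc (0 : ℝ) T, 𝔸) := (mulL U).comp (mulR U')
  have hA : ∀ y, A y = U * (y * U') := fun y => rfl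
  have hAn : ‖A‖ ≤ κ ^ 2 := by
    refine (ContinuousLinearMap.opNorm_comp_le _ _).trans ?_
    rw [pow_two]
    exact mul_le_mul ((hmulL U).trans hSκ) ((hmulR U').trans hQκ) (norm_nonneg _) hκ0
  have hbs : ContDiff ℝ ∞ fun z => b z - b z₀ := hb.sub contDiff_const
  have hder : ∀ A : C(Icc (0 : ℝ) T, 𝔸) →L[ℝ] C(Icc (0 : ℝ) T, 𝔸), ‖A‖ ≤ κ ^ 2 →
      ∀ i, 1 ≤ i → i ≤ n → ‖iteratedFDeriv ℝ i (fun z => A (b z - b z₀)) z₀‖ ≤ κ ^ 2 * β := by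
    intro A hAn i hi hin
    refine (A.norm_iteratedFDeriv_comp_left hbs.contDiffAt
      (mod_cast le_top : (i : ℕ∞ω) ≤ (∞ : ℕ∞ω))).trans ?_
    refine mul_le_mul hAn ?_ (norm_nonneg _) (by positivity)
    obtain ⟨k, rfl⟩ : ∃ k, i = k + 1 := ⟨i - 1, by omega⟩
    have hfd : fderiv ℝ (fun z => b z - b z₀) = fderiv ℝ b := funext fun x =>
      fderiv_sub_const (b z₀)
    rw [← norm_iteratedFDeriv_fderiv, hfd, norm_iteratedFDeriv_fderiv]
    exact hbβ _ hi hin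
  have hκβ : 1 ≤ κ ^ 2 * β := one_le_mul_of_one_le_of_one_le (one_le_pow₀ hκ) hβ
  have hμ : ‖ContinuousLinearMap.mul ℝ C(Icc (0 : ℝ) T, 𝔸)‖ ≤ 1 :=
    ContinuousLinearMap.opNorm_mul_le ℝ C(Icc (0 : ℝ) T, 𝔸)
  have hμ' : ‖(ContinuousLinearMap.mul ℝ C(Icc (0 : ℝ) T, 𝔸)).flip‖ ≤ 1 := by
    rw [ContinuousLinearMap.opNorm_flip]; exact hμ
  have hpow : 0 ≤ c * (κ ^ 2 * β) ^ n := by positivity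
  constructor
  -- `S(z) U⁻¹` is the right propagator of the conjugate `U (b(z) - b(z₀)) U⁻¹`
  · set q : V → C(Icc (0 : ℝ) T, 𝔸) := fun z => mulR U' (S z) with hq
    have hqs : ContDiff ℝ ∞ q := (mulR U').contDiff.comp hSs
    have heq : ∀ z, q z = 1 + primitive hT
        (ContinuousLinearMap.mul ℝ C(Icc (0 : ℝ) T, 𝔸) (q z) (A (b z - b z₀))) := by
      intro z
      have h := (hasPathDeriv_of_eq_add_primitive (hS z)).mul
        (hasPathDeriv_of_eq_add_primitive (hQ z₀))
      have h1 : S z * b z * U' + S z * -(b z₀ * U') = (S z * U') * (U * ((b z - b z₀) * U')) := by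
        rw [← mul_assoc, mul_assoc (S z) U' U, hU'U]; noncomm_ring
      rw [h1] at h
      have h2 := h.eq_add_primitive
      rw [ContinuousMap.mul_apply, apply_zero_of_eq_add_primitive (hS z),
        apply_zero_of_eq_add_primitive (hQ z₀), mul_one] at h2
      exact h2
    have h1 := hmain hqs (A.contDiff.comp hbs) (norm_primitive_le hT) hμ le_rfl heq
      (by simp [hA]) hκβ (hder A hAn) n le_rfl
    have h2 : S = fun z => mulR U (q z) := by
      funext z
      change S z = S z * U' * U
      rw [mul_assoc, hU'U, mul_one]
    rw [h2]
    refine ((mulR U).norm_iteratedFDeriv_comp_left hqs.contDiffAt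
      (mod_cast le_top : (n : ℕ∞ω) ≤ (∞ : ℕ∞ω))).trans ?_
    refine (mul_le_mul ((hmulR U).trans hSκ) h1 (norm_nonneg _) hκ0).trans_eq ?_
    ring
  -- likewise `U Q(z)` is the left propagator of that conjugate
  · set p : V → C(Icc (0 : ℝ) T, 𝔸) := fun z => mulL U (Q z) with hp
    have hps : ContDiff ℝ ∞ p := (mulL U).contDiff.comp hQs
    have heq : ∀ z, p z = 1 + primitive hT
        ((ContinuousLinearMap.mul ℝ C(Icc (0 : ℝ) T, 𝔸)).flip (p z) ((-A) (b z - b z₀))) := by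
      intro z
      have h := (hasPathDeriv_of_eq_add_primitive (hS z₀)).mul
        (hasPathDeriv_of_eq_add_primitive (hQ z))
      have h1 : U * b z₀ * Q z + U * -(b z * Q z) = -(U * ((b z - b z₀) * U')) * (U * Q z) := by
        have : (U * ((b z - b z₀) * U')) * (U * Q z) = U * ((b z - b z₀) * (U' * U) * Q z) := by
          noncomm_ring
        rw [neg_mul, this, hU'U]; noncomm_ring
      rw [h1] at h
      have h2 := h.eq_add_primitive
      rw [ContinuousMap.mul_apply, apply_zero_of_eq_add_primitive (hS z₀),
        apply_zero_of_eq_add_primitive (hQ z), mul_one] at h2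
      exact h2
    have h1 := hmain hps ((-A).contDiff.comp hbs) (norm_primitive_le hT) hμ' le_rfl heq
      (by simp) hκβ (hder (-A) (by rwa [norm_neg])) n le_rfl
    have h2 : Q = fun z => mulL U' (p z) := by
      funext z
      change Q z = U' * (U * Q z)
      rw [← mul_assoc, hU'U, one_mul]
    rw [h2]
    refine ((mulL U').norm_iteratedFDeriv_comp_left hps.contDiffAt
      (mod_cast le_top : (n : ℕ∞ω) ≤ (∞ : ℕ∞ω))).trans ?_
    refine (mul_le_mul ((hmulL U').trans hQκ) h1 (norm_nonneg _) hκ0).trans_eq ?_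
    ring

end Propagator

/-! ### Escaping orbits -/

section Escape

open Filter Topology

theorem eqOn_of_solutions {E : Type} [NormedAddCommGroup E] [NormedSpace ℝ E] {T : ℝ}
    {v : ℝ → E → E} {K : ℝ≥0} (hv : ∀ t, LipschitzWith K (v t)) {f g : ℝ → E}
    (hf : ∀ t ∈ Icc 0 T, HasDerivWithinAt f (v t (f t)) (Icc 0 T) t)
    (hg : ∀ t ∈ Icc 0 T, HasDerivWithinAt g (v t (g t)) (Icc 0 T) t) (h0 : f 0 = g 0) :
    EqOn f g (Icc 0 T) := by
  have hmem : ∀ t ∈ Ico 0 T, Icc 0 T ∈ 𝓝[≥] t := fun t ht =>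
    mem_of_superset (Icc_mem_nhdsGE ht.2) (Icc_subset_Icc_left ht.1)
  exact ODE_solution_unique_of_mem_Icc_right (s := fun _ => univ)
    (fun t _ => (hv t).lipschitzOnWith)
    (fun t ht => (hf t ht).continuousWithinAt)
    (fun t ht => (hf t (Ico_subset_Icc_self ht)).mono_of_mem_nhdsWithin (hmem t ht))
    (fun _ _ => mem_univ _) (fun t ht => (hg t ht).continuousWithinAt)
    (fun t ht => (hg t (Ico_subset_Icc_self ht)).mono_of_mem_nhdsWithin (hmem t ht))
    (fun _ _ => mem_univ _) h0

/-- The orbit of `X` which starts at `z` does not stay in `Z` during the whole of `[0, T]`. -/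
def EscapesBefore {V : Type} [NormedAddCommGroup V] [NormedSpace ℝ V] (X : V → V) (Z : Set V)
    (z : V) (T : ℝ) : Prop :=
  ∀ c : ℝ → V, c 0 = z → (∀ t ∈ Icc 0 T, HasDerivWithinAt c (X (c t)) (Icc 0 T) t) →
    ∃ t ∈ Icc 0 T, c t ∉ Z

variable {V : Type} [NormedAddCommGroup V] [NormedSpace ℝ V]

theorem EscapesBefore.mono {X : V → V} {Z : Set V} {z : V} {T T' : ℝ}
    (h : EscapesBefore X Z z T) (hT : T ≤ T') : EscapesBefore X Z z T' := by
  intro c hc hd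
  obtain ⟨t, ht, htZ⟩ := h c hc fun t ht => (hd t ⟨ht.1, ht.2.trans hT⟩).mono
    (Icc_subset_Icc_right hT)
  exact ⟨t, ⟨ht.1, ht.2.trans hT⟩, htZ⟩

theorem hasDerivWithinAt_of_flow [CompleteSpace V] {T : ℝ} (hT : 0 ≤ T) {X : V → V}
    (hX : Continuous X) {z : V} {u : C(Icc (0 : ℝ) T, V)}
    (h : u = ContinuousMap.const _ z + primitive hT (superposition _ hX u)) :
    IccExtend hT u 0 = z ∧ ∀ t ∈ Icc 0 T,
      HasDerivWithinAt (IccExtend hT u) (X (IccExtend hT u t)) (Icc 0 T) t := by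
  refine ⟨?_, fun t ht => ?_⟩
  · rw [IccExtend_left]
    exact apply_zero_of_eq_add_primitive h
  · have := hasPathDeriv_of_eq_add_primitive h ⟨t, ht⟩
    rwa [superposition_apply, ← IccExtend_of_mem hT u ht] at this

/-- The escape time from a compact set is bounded, as escape is an open condition on the initial
value. -/
theorem exists_uniform_escape [CompleteSpace V] {X : V → V} (hX : ContDiff ℝ ∞ X) {L : ℝ≥0}
    (hL : LipschitzWith L X) {Z : Set V} (hZ : IsCompact Z)
    (h : ∀ z ∈ Z, ∃ T, EscapesBefore X Z z T) :
    ∃ T, 0 < T ∧ ∀ z ∈ Z, EscapesBefore X Z z T := by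
  have hloc : ∀ z ∈ Z, ∃ T : ℝ, ∀ᶠ w in 𝓝 z, EscapesBefore X Z w T := by
    intro z hz
    obtain ⟨T, hT⟩ := h z hz
    have hT' : EscapesBefore X Z z (max T 0) := hT.mono (le_max_left _ _)
    have h0 : 0 ≤ max T 0 := le_max_right _ _
    obtain ⟨Φ, hΦ, hflow⟩ := exists_contDiff_flow h0 hX hL
    obtain ⟨t, ht, htZ⟩ := hT' _ (hasDerivWithinAt_of_flow h0 hX.continuous (hflow z)).1
      (hasDerivWithinAt_of_flow h0 hX.continuous (hflow z)).2
    refine ⟨max T 0, ?_⟩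
    have hc : Continuous fun w => Φ w ⟨t, ht⟩ :=
      (continuous_eval_const _).comp hΦ.continuous
    rw [IccExtend_of_mem h0 _ ht] at htZ
    filter_upwards [hc.continuousAt.preimage_mem_nhds (hZ.isClosed.isOpen_compl.mem_nhds htZ)]
      with w hw c hcw hcd
    have hw' := hasDerivWithinAt_of_flow h0 hX.continuous (hflow w)
    have := eqOn_of_solutions (v := fun _ => X) (fun _ => hL) hcd hw'.2 (hcw.trans hw'.1.symm) ht
    refine ⟨t, ht, ?_⟩
    rw [this, IccExtend_of_mem h0 _ ht]
    exact hw
  choose! T hT using hloc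
  obtain ⟨t, htZ, htc⟩ := hZ.elim_nhds_subcover (fun z => {w | EscapesBefore X Z w (T z)})
    fun z hz => hT z hz
  refine ⟨1 + ∑ z ∈ t, |T z|, by positivity, fun z hz => ?_⟩
  obtain ⟨w, hw, hzw⟩ := mem_iUnion₂.1 (htc hz)
  refine EscapesBefore.mono hzw ?_
  have := Finset.single_le_sum (f := fun z => |T z|) (fun _ _ => abs_nonneg _) hw
  have h2 := le_abs_self (T w)
  linarith

/-- The vector field on `V × ℝ` which moves along `X` and lets the second component (the "memory"
of the orbit) grow at the rate `k`. -/
def withMemory (X : V → V) (k : V → ℝ) (p : V × ℝ) : V × ℝ := (X p.1, k p.1)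

/-- A memory field `k ≥ 0` vanishes on `Z`, but every orbit starting in `Z` has accumulated
memory at least `a` after the time `T`. -/
theorem exists_memory [FiniteDimensional ℝ V] {X : V → V} (hX : ContDiff ℝ ∞ X) {L : ℝ≥0}
    (hL : LipschitzWith L X) {Z : Set V} (hZ : IsCompact Z) {T : ℝ} (hT : 0 < T)
    (hesc : ∀ z ∈ Z, EscapesBefore X Z z T) :
    ∃ k : V → ℝ, ContDiff ℝ ∞ k ∧ (∃ K, LipschitzWith K k) ∧ (∀ z ∈ Z, k z = 0) ∧
      ∃ a : ℝ, 0 < a ∧ ∀ z ∈ Z, ∀ c : ℝ → V × ℝ, c 0 = (z, 0) →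
        (∀ t ∈ Icc 0 (T + 1), HasDerivWithinAt c (withMemory X k (c t)) (Icc 0 (T + 1)) t) →
        ∀ t ∈ Icc T (T + 1), a ≤ (c t).2 := by
  have : CompleteSpace V := FiniteDimensional.complete ℝ V
  have hT1 : 0 ≤ T + 1 := by linarith
  have hTm : T ∈ Icc 0 (T + 1) := ⟨hT.le, by linarith⟩
  obtain ⟨Φ, hΦ, hflow⟩ := exists_contDiff_flow hT1 hX hL
  -- all points reached from `Z` before the time `T + 1`
  have hreach : IsCompact ((fun p : V × Icc (0 : ℝ) (T + 1) => Φ p.1 p.2) '' (Z ×ˢ univ)) := by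
    refine (hZ.prod isCompact_univ).image ?_
    exact (hΦ.continuous.comp continuous_fst).eval continuous_snd
  obtain ⟨r, hr⟩ := hreach.isBounded.subset_closedBall 0
  -- `k₀` is positive exactly off `Z`; the cutoff `χ = 1` on the reached points makes it Lipschitz
  obtain ⟨k₀, hk₀, hk₀s, hk₀r⟩ := hZ.isClosed.isOpen_compl.exists_contDiff_support_eq (n := ⊤)
  let χ : ContDiffBump (0 : V) := ⟨|r| + 1, |r| + 2, by positivity, by linarith⟩
  have hk0nn : ∀ x, 0 ≤ k₀ x := fun x => (hk₀r (mem_range_self x)).1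
  have hks : ContDiff ℝ ∞ fun x => k₀ x * χ x := hk₀s.mul χ.contDiff
  have hkZ : ∀ z ∈ Z, k₀ z * χ z = 0 := fun z hz => by
    have : z ∉ k₀.support := by rw [hk₀]; simpa using hz
    rw [Function.notMem_support.1 this, zero_mul]
  have hknn : ∀ x, 0 ≤ k₀ x * χ x := fun x => mul_nonneg (hk0nn x) χ.nonneg
  refine ⟨fun x => k₀ x * χ x, hks, ContDiff.lipschitzWith_of_hasCompactSupport
    χ.hasCompactSupport.mul_left hks (by simp), hkZ, ?_⟩
  -- the accumulated memory
  set mem : V → ℝ → ℝ := fun z t => ∫ s in (0 : ℝ)..t,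
    k₀ (IccExtend hT1 (Φ z) s) * χ (IccExtend hT1 (Φ z) s) with hmem
  have hint : ∀ z (a b : ℝ), IntervalIntegrable (fun s =>
      k₀ (IccExtend hT1 (Φ z) s) * χ (IccExtend hT1 (Φ z) s)) MeasureTheory.volume a b :=
    fun z a b => (hks.continuous.comp
      ((Φ z).continuous.Icc_extend' (h := hT1))).intervalIntegrable a b
  have hmemc : Continuous fun z => mem z T := by
    have : ∀ z, mem z T = primitive hT1 (superposition _ hks.continuous (Φ z)) ⟨T, hTm⟩ :=
      fun z => rfl
    simp_rw [this]
    exact (continuous_eval_const _).comp ((primitive hT1).continuous.comp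
      ((ContinuousMap.continuous_postcomp _).comp hΦ.continuous))
  have hmempos : ∀ z ∈ Z, 0 < mem z T := by
    intro z hz
    have hz' := hasDerivWithinAt_of_flow hT1 hX.continuous (hflow z)
    obtain ⟨t, ht, htZ⟩ := hesc z hz _ hz'.1 fun t ht =>
      (hz'.2 t ⟨ht.1, ht.2.trans hTm.2⟩).mono (Icc_subset_Icc_right hTm.2)
    refine intervalIntegral.integral_pos hT (hks.continuous.comp
      ((Φ z).continuous.Icc_extend' (h := hT1))).continuousOn (fun s _ => hknn _) ⟨t, ht, ?_⟩
    refine mul_pos (lt_of_le_of_ne (hk0nn _) fun h => ?_) ?_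
    · have : IccExtend hT1 (Φ z) t ∈ k₀.support := by rw [hk₀]; exact htZ
      exact this h.symm
    · rw [χ.one_of_mem_closedBall]
      · exact zero_lt_one
      · refine Metric.closedBall_subset_closedBall ?_ (hr ⟨(z, ⟨t, ht.1, ht.2.trans hTm.2⟩),
          ⟨hz, mem_univ _⟩, ?_⟩)
        · exact (le_abs_self r).trans (by simp [χ])
        · rw [IccExtend_of_mem hT1 _ ⟨ht.1, ht.2.trans hTm.2⟩]
  obtain ⟨a, ha, hamem⟩ : ∃ a : ℝ, 0 < a ∧ ∀ z ∈ Z, a ≤ mem z T := by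
    rcases Z.eq_empty_or_nonempty with rfl | hne
    · exact ⟨1, one_pos, fun z hz => hz.elim⟩
    · obtain ⟨z, hz, hmin⟩ := hZ.exists_isMinOn hne hmemc.continuousOn
      exact ⟨mem z T, hmempos z hz, fun w hw => hmin hw⟩
  refine ⟨a, ha, fun z hz c hc0 hcd t ht => ?_⟩
  have ht' : t ∈ Icc 0 (T + 1) := ⟨hT.le.trans ht.1, ht.2⟩
  have hz' := hasDerivWithinAt_of_flow hT1 hX.continuous (hflow z)
  have hfst : EqOn (fun t => (c t).1) (IccExtend hT1 (Φ z)) (Icc 0 (T + 1)) :=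
    eqOn_of_solutions (v := fun _ => X) (fun _ => hL) (fun t ht => (hcd t ht).fst) hz'.2
      (by simp only [hc0]; exact hz'.1.symm)
  have hcd₂ : ∀ t ∈ Icc 0 (T + 1), HasDerivWithinAt (fun t => (c t).2)
      (k₀ (c t).1 * χ (c t).1) (Icc 0 (T + 1)) t := fun t ht => (hcd t ht).snd
  have hsnd : mem z t = (c t).2 - (c 0).2 := by
    have hsub : Icc 0 t ⊆ Icc 0 (T + 1) := Icc_subset_Icc_right ht'.2
    refine intervalIntegral.integral_eq_sub_of_hasDerivAt_of_le ht'.1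
      (f := fun t => (c t).2) (fun s hs => (hcd₂ s (hsub hs)).continuousWithinAt.mono hsub)
      (fun s hs => ?_) (hint z 0 t)
    have hs' := hsub (Ioo_subset_Icc_self hs)
    have := (hcd₂ s hs').hasDerivAt (Icc_mem_nhds hs.1 (hs.2.trans_le ht'.2))
    rw [← hfst hs']
    exact this
  have hmono : mem z T ≤ mem z t := by
    have h1 : mem z T + ∫ s in T..t, k₀ (IccExtend hT1 (Φ z) s) * χ (IccExtend hT1 (Φ z) s) =
        mem z t := intervalIntegral.integral_add_adjacent_intervals (hint z 0 T) (hint z T t)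
    have h2 := intervalIntegral.integral_nonneg (μ := MeasureTheory.volume) ht.1
      (fun s _ => hknn (IccExtend hT1 (Φ z) s))
    linarith
  have := hamem z hz
  rw [hc0] at hsnd
  simp only [sub_zero] at hsnd
  linarith

end Escape

/-! ### The transport equation along escaping orbits -/

section Transport

open Filter Topology

variable {T : ℝ} {W : Type} [NormedAddCommGroup W] [NormedSpace ℝ W] [CompleteSpace W]
  {𝔸 : Type} [NormedRing 𝔸] [NormedAlgebra ℝ 𝔸] [CompleteSpace 𝔸]

theorem hasDerivWithinAt_comp_const_add {E : Type} [NormedAddCommGroup E] [NormedSpace ℝ E]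
    {T' s : ℝ} (hs : 0 ≤ s) (hsT : T' + s ≤ T) {f f' : ℝ → E}
    (hf : ∀ t ∈ Icc 0 T, HasDerivWithinAt f (f' t) (Icc 0 T) t) :
    ∀ t ∈ Icc 0 T', HasDerivWithinAt (fun t => f (s + t)) (f' (s + t)) (Icc 0 T') t := by
  intro t ht
  have hmaps : MapsTo (fun t => s + t) (Icc 0 T') (Icc 0 T) := fun r hr =>
    ⟨add_nonneg hs hr.1, by linarith [hr.2]⟩
  have h := (hf (s + t) (hmaps ht)).scomp t ((hasDerivWithinAt_id t (Icc 0 T')).const_add s) hmaps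
  rw [one_smul] at h
  exact h

/-- If the coefficient vanishes along the orbit of `p` during the last unit of time, then moving
`p` along its orbit changes the propagator at the time `T` by the factor `Q(s)`. -/
theorem propagator_flow_eq (hT : 0 ≤ T) {X : W → W} (hX : Continuous X) {L : ℝ≥0}
    (hL : LipschitzWith L X) {Φ : W → C(Icc (0 : ℝ) (T + 1), W)}
    (hΦ : ∀ p, Φ p = ContinuousMap.const _ p +
      primitive (add_nonneg hT zero_le_one) (superposition _ hX (Φ p)))
    {A : W → 𝔸} (hA : Continuous A) {S Q : W → C(Icc (0 : ℝ) (T + 1), 𝔸)}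
    (hS : ∀ p, IsRightPropagator (add_nonneg hT zero_le_one) (superposition _ hA (Φ p)) (S p))
    (hQ : ∀ p, IsLeftPropagator (add_nonneg hT zero_le_one) (superposition _ hA (Φ p)) (Q p))
    [IsDedekindFiniteMonoid 𝔸]
    {p : W} (hp : ∀ t : Icc (0 : ℝ) (T + 1), T ≤ t → A (Φ p t) = 0)
    (s : Icc (0 : ℝ) (T + 1)) (hs : (s : ℝ) ≤ 1) :
    S (Φ p s) ⟨T, hT, by linarith⟩ = Q p s * S p ⟨T, hT, by linarith⟩ := by
  have hT1 : 0 ≤ T + 1 := add_nonneg hT zero_le_one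
  set B : W → C(Icc (0 : ℝ) (T + 1), 𝔸) := fun p => superposition _ hA (Φ p) with hB
  have hsT : T + s ≤ T + 1 := by linarith
  have hflow := fun p => hasDerivWithinAt_of_flow hT1 hX (hΦ p)
  -- the orbit of `Φ p s` is the shifted orbit of `p`
  have horb : EqOn (IccExtend hT1 (Φ (Φ p s))) (fun t => IccExtend hT1 (Φ p) (s + t))
      (Icc 0 T) := by
    refine eqOn_of_solutions (v := fun _ => X) (fun _ => hL)
      (fun t ht => ((hflow (Φ p s)).2 t ⟨ht.1, by linarith [ht.2]⟩).mono
        (Icc_subset_Icc_right (by linarith)))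
      (hasDerivWithinAt_comp_const_add s.2.1 hsT (hflow p).2) ?_
    rw [(hflow (Φ p s)).1, add_zero, IccExtend_val]
  have hSd := fun p => hasPathDeriv_of_eq_add_primitive (hS p)
  have hSd' : ∀ p, ∀ t ∈ Icc 0 (T + 1), HasDerivWithinAt (IccExtend hT1 (S p))
      (IccExtend hT1 (S p) t * A (IccExtend hT1 (Φ p) t)) (Icc 0 (T + 1)) t := by
    intro p t ht
    rw [IccExtend_of_mem hT1 _ ht, IccExtend_of_mem hT1 _ ht]
    exact hSd p ⟨t, ht⟩
  -- both sides solve the same equation, with the value `1` at `t = 0` as `Q S = 1`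
  have h1 : EqOn (IccExtend hT1 (S (Φ p s)))
      (fun t => Q p s * IccExtend hT1 (S p) (s + t)) (Icc 0 T) := by
    refine eqOn_of_solutions (K := ‖B (Φ p s)‖₊)
      (v := fun t x => x * IccExtend hT1 (B (Φ p s)) t) (fun t => ?_) (fun t ht => ?_)
      (fun t ht => ?_) ?_
    · refine LipschitzWith.of_dist_le_mul fun x y => ?_
      rw [dist_eq_norm, dist_eq_norm, ← sub_mul, mul_comm]
      exact (norm_mul_le _ _).trans (mul_le_mul_of_nonneg_left
        ((B (Φ p s)).norm_coe_le_norm _) (norm_nonneg _))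
    · exact (hSd' _ t ⟨ht.1, by linarith [ht.2]⟩).mono (Icc_subset_Icc_right (by linarith))
    · have h := (hasDerivWithinAt_comp_const_add s.2.1 hsT (hSd' p) t ht).const_mul (Q p s)
      have hBe : IccExtend hT1 (B (Φ p s)) t = A (IccExtend hT1 (Φ p) (s + t)) :=
        congrArg A (horb ht)
      rw [hBe, mul_assoc]
      exact h
    · have h2 := congrArg (fun u : C(Icc (0 : ℝ) (T + 1), 𝔸) => u s) ((hS p).mul_eq_one' (hQ p))
      rw [IccExtend_left, apply_zero_of_eq_add_primitive (hS _), add_zero, IccExtend_val]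
      exact h2.symm
  have h2 := h1 (right_mem_Icc.2 hT)
  rw [IccExtend_of_mem hT1 _ ⟨hT, by linarith⟩] at h2
  -- after the time `T` the propagator is constant
  have h3 := hasDerivWithinAt_comp_const_add (T' := 1) hT (by linarith) (hSd' p)
  have h4 : EqOn (fun t => IccExtend hT1 (S p) (T + t)) (fun _ => IccExtend hT1 (S p) T)
      (Icc 0 1) := by
    refine eqOn_of_solutions (K := 0) (v := fun _ _ => 0) (fun _ => LipschitzWith.const 0)
      (fun t ht => ?_) (fun t _ => hasDerivWithinAt_const t _ _) (by simp)
    have hmem : T + t ∈ Icc 0 (T + 1) := ⟨by linarith [ht.1], by linarith [ht.2]⟩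
    have h5 := h3 t ht
    rw [IccExtend_of_mem hT1 (Φ p) hmem, hp ⟨T + t, hmem⟩ (by simpa using ht.1), mul_zero] at h5
    exact h5
  have h5 := h4 ⟨s.2.1, hs⟩
  simp only at h5
  rw [h2]
  change Q p s * IccExtend hT1 (S p) (s + T) = _
  rw [add_comm (s : ℝ) T, h5, IccExtend_of_mem hT1 _ ⟨hT, by linarith⟩]

/-- Differentiation of `propagator_flow_eq` at `s = 0`: the transport equation. -/
theorem fderiv_propagator_eq (hT : 0 ≤ T) {X : W → W} (hX : Continuous X) {L : ℝ≥0}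
    (hL : LipschitzWith L X) {Φ : W → C(Icc (0 : ℝ) (T + 1), W)}
    (hΦ : ∀ p, Φ p = ContinuousMap.const _ p +
      primitive (add_nonneg hT zero_le_one) (superposition _ hX (Φ p)))
    {A : W → 𝔸} (hA : Continuous A) {S Q : W → C(Icc (0 : ℝ) (T + 1), 𝔸)}
    (hS : ∀ p, IsRightPropagator (add_nonneg hT zero_le_one) (superposition _ hA (Φ p)) (S p))
    (hQ : ∀ p, IsLeftPropagator (add_nonneg hT zero_le_one) (superposition _ hA (Φ p)) (Q p))
    [IsDedekindFiniteMonoid 𝔸]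
    {p : W} (hp : ∀ t : Icc (0 : ℝ) (T + 1), T ≤ t → A (Φ p t) = 0) {R' : W →L[ℝ] 𝔸}
    (hR : HasFDerivAt (fun p => S p ⟨T, hT, by linarith⟩) R' p) :
    R' (X p) = -(A p * S p ⟨T, hT, by linarith⟩) := by
  have hT1 : 0 ≤ T + 1 := add_nonneg hT zero_le_one
  have h01 : Icc (0 : ℝ) 1 ⊆ Icc 0 (T + 1) := Icc_subset_Icc_right (by linarith)
  have h0 : (0 : ℝ) ∈ Icc 0 (T + 1) := left_mem_Icc.2 hT1
  have hflow := hasDerivWithinAt_of_flow hT1 hX (hΦ p)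
  have hc := (hflow.2 0 h0).mono h01
  rw [hflow.1] at hc
  have h1 : HasDerivWithinAt (fun s => S (IccExtend hT1 (Φ p) s) ⟨T, hT, by linarith⟩)
      (R' (X p)) (Icc 0 1) 0 := by
    rw [← hflow.1] at hR
    exact hR.comp_hasDerivWithinAt (0 : ℝ) hc
  have h2 : HasDerivWithinAt (fun s => IccExtend hT1 (Q p) s * S p ⟨T, hT, by linarith⟩)
      (-(A p * S p ⟨T, hT, by linarith⟩)) (Icc 0 1) 0 := by
    have h := ((hasPathDeriv_of_eq_add_primitive (hQ p) ⟨0, h0⟩).mono h01).mul_const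
      (S p ⟨T, hT, by linarith⟩)
    have h3 : Φ p ⟨0, h0⟩ = p := apply_zero_of_eq_add_primitive (hΦ p)
    simp only [ContinuousMap.neg_apply, ContinuousMap.mul_apply, superposition_apply, h3,
      apply_zero_of_eq_add_primitive (hQ p), mul_one, neg_mul] at h
    exact h
  have h3 : HasDerivWithinAt (fun s => S (IccExtend hT1 (Φ p) s) ⟨T, hT, by linarith⟩)
      (-(A p * S p ⟨T, hT, by linarith⟩)) (Icc 0 1) 0 := by
    refine h2.congr (fun s hs => ?_) ?_
    · rw [IccExtend_of_mem hT1 _ (h01 hs), IccExtend_of_mem hT1 _ (h01 hs)]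
      exact propagator_flow_eq hT hX hL hΦ hA hS hQ hp _ hs.2
    · rw [IccExtend_of_mem hT1 _ h0, IccExtend_of_mem hT1 _ h0]
      exact propagator_flow_eq hT hX hL hΦ hA hS hQ hp _ zero_le_one
  exact ((uniqueDiffOn_Icc zero_lt_one) 0 (left_mem_Icc.2 zero_le_one)).eq_deriv _ h1 h3

/-- Derivatives of a product of functions of two separate variables. -/
theorem exists_norm_iteratedFDeriv_cutoff_le {V : Type} [NormedAddCommGroup V] [NormedSpace ℝ V]
    {ψ : ℝ → ℝ} (hψ : ContDiff ℝ ∞ ψ) (hc : HasCompactSupport ψ) (n : ℕ) :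
    ∃ c : ℝ, 0 ≤ c ∧ ∀ {E : Type} [NormedAddCommGroup E] [NormedSpace ℝ E] {f : V → E} {α : ℝ},
      ContDiff ℝ ∞ f → (∀ j ≤ n, ∀ x, ‖iteratedFDeriv ℝ j f x‖ ≤ α) → ∀ j ≤ n, ∀ p : V × ℝ,
      ‖iteratedFDeriv ℝ j (fun p : V × ℝ => ψ p.2 • f p.1) p‖ ≤ c * α := by
  have hb : ∀ j : ℕ, ∃ C, ∀ x, ‖iteratedFDeriv ℝ j ψ x‖ ≤ C := fun j =>
    (hc.iteratedFDeriv j).exists_bound_of_continuous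
      (hψ.continuous_iteratedFDeriv (mod_cast le_top))
  choose C hC using hb
  have hC0 : ∀ j, 0 ≤ C j := fun j => (norm_nonneg _).trans (hC j 0)
  refine ⟨2 ^ n * ∑ j ∈ Finset.range (n + 1), C j,
    mul_nonneg (by positivity) (Finset.sum_nonneg fun j _ => hC0 j), ?_⟩
  intro E _ _ f α hf hα j hj p
  have hα0 : 0 ≤ α := (norm_nonneg _).trans (hα 0 (Nat.zero_le n) p.1)
  have hfst : ∀ i ≤ n, ‖iteratedFDeriv ℝ i (fun p : V × ℝ => f p.1) p‖ ≤ α := by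
    intro i hi
    have h := (ContinuousLinearMap.fst ℝ V ℝ).iteratedFDeriv_comp_right hf p
      (i := i) (mod_cast le_top)
    have h' : iteratedFDeriv ℝ i (fun p : V × ℝ => f p.1) p = _ := h
    rw [h']
    refine (ContinuousMultilinearMap.norm_compContinuousLinearMap_le _ _).trans ?_
    refine (mul_le_mul (hα i hi _) (Finset.prod_le_one (fun _ _ => norm_nonneg _) fun _ _ =>
      ContinuousLinearMap.norm_fst_le ℝ V ℝ) (Finset.prod_nonneg fun _ _ => norm_nonneg _)
      hα0).trans_eq (mul_one α)
  have hsnd : ∀ i ≤ n, ‖iteratedFDeriv ℝ i (fun p : V × ℝ => ψ p.2) p‖ ≤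
      ∑ j ∈ Finset.range (n + 1), C j := by
    intro i hi
    have h := (ContinuousLinearMap.snd ℝ V ℝ).iteratedFDeriv_comp_right hψ p
      (i := i) (mod_cast le_top)
    have h' : iteratedFDeriv ℝ i (fun p : V × ℝ => ψ p.2) p = _ := h
    rw [h']
    refine (ContinuousMultilinearMap.norm_compContinuousLinearMap_le _ _).trans ?_
    refine (mul_le_mul (hC i _) (Finset.prod_le_one (fun _ _ => norm_nonneg _) fun _ _ =>
      ContinuousLinearMap.norm_snd_le ℝ V ℝ) (Finset.prod_nonneg fun _ _ => norm_nonneg _)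
      (hC0 i)).trans ?_
    rw [mul_one]
    exact Finset.single_le_sum (fun j _ => hC0 j) (Finset.mem_range.2 (by omega))
  refine ((ContinuousLinearMap.lsmul ℝ ℝ : ℝ →L[ℝ] E →L[ℝ] E
    ).norm_iteratedFDeriv_le_of_bilinear_of_le_one (hψ.comp contDiff_snd) (hf.comp contDiff_fst)
    p (n := j) (mod_cast le_top) ContinuousLinearMap.opNorm_lsmul_le).trans ?_
  have hsum0 : 0 ≤ ∑ j ∈ Finset.range (n + 1), C j := Finset.sum_nonneg fun j _ => hC0 j
  calc ∑ i ∈ Finset.range (j + 1), (j.choose i : ℝ) *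
        ‖iteratedFDeriv ℝ i (fun p : V × ℝ => ψ p.2) p‖ *
        ‖iteratedFDeriv ℝ (j - i) (fun p : V × ℝ => f p.1) p‖
      ≤ ∑ i ∈ Finset.range (j + 1), (j.choose i : ℝ) *
        ((∑ j ∈ Finset.range (n + 1), C j) * α) := by
        refine Finset.sum_le_sum fun i hi => ?_
        have hi' : i ≤ j := Nat.lt_succ_iff.1 (Finset.mem_range.1 hi)
        rw [mul_assoc]
        exact mul_le_mul_of_nonneg_left (mul_le_mul (hsnd i (hi'.trans hj))
          (hfst _ ((Nat.sub_le j i).trans hj)) (norm_nonneg _) hsum0) (Nat.cast_nonneg _)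
    _ = 2 ^ j * ((∑ j ∈ Finset.range (n + 1), C j) * α) := by
        rw [← Finset.sum_mul, ← Nat.cast_sum, Nat.sum_range_choose]; push_cast; ring
    _ ≤ 2 ^ n * ((∑ j ∈ Finset.range (n + 1), C j) * α) := by
        gcongr
        norm_num
    _ = _ := by ring

/-- The transport equation `dR (X) = -A R` on a compact set `Z` all of whose orbits escape,
with estimates for the solution which depend on `A` only through bounds for its derivatives and
bounds `κ` for propagators. -/
theorem exists_transport_solution {V : Type} [NormedAddCommGroup V] [NormedSpace ℝ V]
    [FiniteDimensional ℝ V] [IsDedekindFiniteMonoid 𝔸] {X : V → V} (hX : ContDiff ℝ ∞ X)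
    {L : ℝ≥0} (hL : LipschitzWith L X) {Z : Set V} (hZ : IsCompact Z)
    (hesc : ∀ z ∈ Z, ∃ T, EscapesBefore X Z z T) :
    ∃ (T : ℝ) (hT : 0 ≤ T) (c : ℕ → ℝ), (∀ n, 0 ≤ c n) ∧ ∀ A : V → 𝔸, ContDiff ℝ ∞ A →
      ∃ R Q : V → 𝔸, ContDiff ℝ ∞ R ∧ ContDiff ℝ ∞ Q ∧ (∀ x, R x * Q x = 1 ∧ Q x * R x = 1) ∧
        (∀ z ∈ Z, fderiv ℝ R z (X z) = -(A z * R z)) ∧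
        ∀ κ : ℝ, 1 ≤ κ → (∀ b S Q : C(Icc (0 : ℝ) T, 𝔸), (∀ t, ∃ s ∈ Icc (0 : ℝ) 1, ∃ x,
          b t = s • A x) → IsRightPropagator hT b S → IsLeftPropagator hT b Q →
          ‖S‖ ≤ κ ∧ ‖Q‖ ≤ κ) →
        ∀ (n : ℕ) (α : ℝ), 1 ≤ α → (∀ j ≤ n, ∀ x, ‖iteratedFDeriv ℝ j A x‖ ≤ α) → ∀ z ∈ Z,
          ‖iteratedFDeriv ℝ n R z‖ ≤ c n * κ ^ (2 * n + 1) * α ^ n ∧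
          ‖iteratedFDeriv ℝ n Q z‖ ≤ c n * κ ^ (2 * n + 1) * α ^ n := by
  have : CompleteSpace V := FiniteDimensional.complete ℝ V
  obtain ⟨T, hT0, hT⟩ := exists_uniform_escape hX hL hZ hesc
  obtain ⟨k, hk, ⟨K, hK⟩, hkZ, a, ha, hmem⟩ := exists_memory hX hL hZ hT0 hT
  have hT1 : 0 ≤ T + 1 := add_nonneg hT0.le zero_le_one
  have hXk : ContDiff ℝ ∞ (withMemory X k) :=
    (hX.comp contDiff_fst).prodMk (hk.comp contDiff_fst)
  have hLk : LipschitzWith (max (L * 1) (K * 1)) (withMemory X k) :=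
    (hL.comp LipschitzWith.prod_fst).prodMk (hK.comp LipschitzWith.prod_fst)
  obtain ⟨Φ, hΦ, hflow⟩ := exists_contDiff_flow hT1 hXk hLk
  obtain ⟨S, Q, hS, hQ, hSQ⟩ := exists_contDiff_propagator (𝔸 := 𝔸) hT1
  -- `ψ` of the memory switches the coefficient off before the time `T`, and is `1` at the start
  let ψ : ContDiffBump (0 : ℝ) := ⟨a / 2, a, by positivity, by linarith⟩
  have hψ0 : ψ 0 = 1 := ψ.one_of_mem_closedBall (Metric.mem_closedBall_self (half_pos ha).le)
  have hψa : ∀ s, a ≤ s → ψ s = 0 := fun s hs =>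
    ψ.zero_of_le_dist (by simpa [ψ, abs_of_nonneg (ha.le.trans hs)] using hs)
  set ι : V →L[ℝ] V × ℝ := ContinuousLinearMap.inl ℝ V ℝ with hι
  have hΦι : ContDiff ℝ ∞ fun z => Φ (ι z) := hΦ.comp ι.contDiff
  -- bounds for the derivatives of the flow on the compact set `Z`
  have hD : ∀ n : ℕ, ∃ D : ℝ, 1 ≤ D ∧ ∀ i ≤ n, ∀ z ∈ Z,
      ‖iteratedFDeriv ℝ i (fun z => Φ (ι z)) z‖ ≤ D := by
    intro n
    have h : ∀ i : ℕ, ∃ C, ∀ z ∈ Z, ‖iteratedFDeriv ℝ i (fun z => Φ (ι z)) z‖ ≤ C := fun i =>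
      hZ.exists_bound_of_continuousOn
        (hΦι.continuous_iteratedFDeriv (mod_cast le_top)).continuousOn
    choose C hC using h
    refine ⟨1 + ∑ i ∈ Finset.range (n + 1), |C i|, ?_, fun i hi z hz => ?_⟩
    · have : 0 ≤ ∑ i ∈ Finset.range (n + 1), |C i| := Finset.sum_nonneg fun _ _ => abs_nonneg _
      linarith
    · have := Finset.single_le_sum (f := fun i => |C i|) (fun _ _ => abs_nonneg _)
        (Finset.mem_range.2 (Nat.lt_succ_of_le hi))
      have h2 := hC i z hz
      have h3 := le_abs_self (C i)
      linarith
  choose D hD1 hD using hD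
  choose cψ hcψ0 hcψ using exists_norm_iteratedFDeriv_cutoff_le (V := V) ψ.contDiff
    ψ.hasCompactSupport
  choose cS hcS0 hcS using exists_norm_iteratedFDeriv_propagator_le (𝔸 := 𝔸) hT1
  set d : ℕ → ℝ := fun n => 1 + n.factorial * cψ n * D n ^ n with hd
  have hd1 : ∀ n, 1 ≤ d n := fun n => by
    have : 0 ≤ n.factorial * cψ n * D n ^ n :=
      mul_nonneg (mul_nonneg (Nat.cast_nonneg _) (hcψ0 n)) (pow_nonneg (by linarith [hD1 n]) n)
    simp only [hd]
    linarith
  refine ⟨T + 1, hT1, fun n => cS n * d n ^ n,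
    fun n => mul_nonneg (hcS0 n) (pow_nonneg (by linarith [hd1 n]) n), ?_⟩
  intro A hA
  set B : V × ℝ → 𝔸 := fun p => ψ p.2 • A p.1 with hB
  have hBs : ContDiff ℝ ∞ B := (ψ.contDiff.comp contDiff_snd).smul (hA.comp contDiff_fst)
  set b : V × ℝ → C(Icc (0 : ℝ) (T + 1), 𝔸) := fun p => superposition _ hBs.continuous (Φ p)
    with hb
  have hbs : ContDiff ℝ ∞ b := (contDiff_superposition hBs).comp hΦ
  let tT : Icc (0 : ℝ) (T + 1) := ⟨T, hT0.le, by linarith⟩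
  let ev : C(Icc (0 : ℝ) (T + 1), 𝔸) →L[ℝ] 𝔸 := ContinuousMap.evalCLM ℝ tT
  have hev : ∀ u, ev u = u tT := fun u => rfl
  have hevn : ‖ev‖ ≤ 1 := ev.opNorm_le_bound zero_le_one fun u => by
    rw [one_mul]; exact u.norm_coe_le_norm tT
  have hSb : ContDiff ℝ ∞ fun p => S (b p) := hS.comp hbs
  have hQb : ContDiff ℝ ∞ fun p => Q (b p) := hQ.comp hbs
  refine ⟨fun z => ev (S (b (ι z))), fun z => ev (Q (b (ι z))),
    ev.contDiff.comp (hSb.comp ι.contDiff), ev.contDiff.comp (hQb.comp ι.contDiff),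
    fun x => ⟨?_, ?_⟩, fun z hz => ?_, fun κ hκ hprop n α hα1 hα z hz => ?_⟩
  · exact congrArg ev ((hSQ (b (ι x))).1.mul_eq_one (hSQ (b (ι x))).2)
  · exact congrArg ev ((hSQ (b (ι x))).1.mul_eq_one' (hSQ (b (ι x))).2)
  · have hR : HasFDerivAt (fun p => ev (S (b p))) (fderiv ℝ (fun p => ev (S (b p))) (ι z)) (ι z) :=
      ((ev.contDiff.comp hSb).differentiable (by simp) (ι z)).hasFDerivAt
    have hzero : ∀ t : Icc (0 : ℝ) (T + 1), T ≤ t → B (Φ (ι z) t) = 0 := by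
      intro t ht
      have hz' := hasDerivWithinAt_of_flow hT1 hXk.continuous (hflow (ι z))
      have h := hmem z hz _ hz'.1 hz'.2 t ⟨ht, t.2.2⟩
      rw [IccExtend_val] at h
      simp only [hB]
      rw [hψa _ h, zero_smul]
    have h1 := fderiv_propagator_eq hT0.le hXk.continuous hLk hflow hBs.continuous
      (S := fun p => S (b p)) (Q := fun p => Q (b p)) (fun p => (hSQ (b p)).1)
      (fun p => (hSQ (b p)).2) hzero hR
    have h2 : fderiv ℝ (fun z => ev (S (b (ι z)))) z =
        (fderiv ℝ (fun p => ev (S (b p))) (ι z)).comp ι := (hR.comp z ι.hasFDerivAt).fderiv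
    have h3 : withMemory X k (ι z) = ι (X z) := by
      simp [withMemory, hι, hkZ z hz]
    have h4 : B (ι z) = A z := by simp [hB, hι, hψ0]
    rw [h2, ContinuousLinearMap.comp_apply, ← h3, h1, h4]
    rfl
  · have hbz : ∀ t, ∃ s ∈ Icc (0 : ℝ) 1, ∃ x, b (ι z) t = s • A x := fun t =>
      ⟨ψ (Φ (ι z) t).2, ⟨ψ.nonneg, ψ.le_one⟩, (Φ (ι z) t).1, rfl⟩
    obtain ⟨hSκ, hQκ⟩ := hprop _ _ _ hbz (hSQ (b (ι z))).1 (hSQ (b (ι z))).2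
    have hbι : ContDiff ℝ ∞ fun z => b (ι z) := hbs.comp ι.contDiff
    have hα0 : 0 ≤ α := by linarith
    have hDn := hD1 n
    have hder : ∀ i, 1 ≤ i → i ≤ n → ‖iteratedFDeriv ℝ i (fun z => b (ι z)) z‖ ≤ d n * α := by
      intro i hi1 hi
      have h1 : ‖iteratedFDeriv ℝ i (fun z => b (ι z)) z‖ ≤
          i.factorial * (cψ n * α) * D n ^ i := by
        refine norm_iteratedFDeriv_comp_le (contDiff_superposition hBs) hΦι
          (mod_cast le_top : (i : ℕ∞ω) ≤ (∞ : ℕ∞ω)) z (fun j hj => ?_) (fun j hj1 hj => ?_)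
        · exact norm_iteratedFDeriv_superposition_le j hBs _ (mul_nonneg (hcψ0 n) hα0)
            (fun p => hcψ n hA hα j (hj.trans hi) p) _
        · exact (hD n j (hj.trans hi) z hz).trans (le_self_pow₀ hDn (by omega))
      refine h1.trans ?_
      have h2 : (i.factorial : ℝ) ≤ n.factorial := mod_cast Nat.factorial_le hi
      have h3 : D n ^ i ≤ D n ^ n := pow_le_pow_right₀ hDn hi
      have h4 := hcψ0 n
      have h5 : 0 ≤ D n ^ i := pow_nonneg (by linarith) i
      calc (i.factorial : ℝ) * (cψ n * α) * D n ^ i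
          ≤ n.factorial * (cψ n * α) * D n ^ n := by gcongr
        _ = (n.factorial * cψ n * D n ^ n) * α := by ring
        _ ≤ d n * α := by
            refine mul_le_mul_of_nonneg_right ?_ hα0
            simp only [hd]; linarith
    have hmain := hcS n (b := fun z => b (ι z)) (S := fun z => S (b (ι z)))
      (Q := fun z => Q (b (ι z))) (z := z) hbι (hS.comp hbι) (hQ.comp hbι)
      (fun z => (hSQ (b (ι z))).1) (fun z => (hSQ (b (ι z))).2) hκ
      (one_le_mul_of_one_le_of_one_le (hd1 n) hα1) hSκ hQκ hder
    have heq : cS n * κ * (κ ^ 2 * (d n * α)) ^ n =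
        cS n * d n ^ n * κ ^ (2 * n + 1) * α ^ n := by
      rw [mul_pow, mul_pow, ← pow_mul, pow_succ]; ring
    rw [heq] at hmain
    have hred : ∀ {f : V → C(Icc (0 : ℝ) (T + 1), 𝔸)}, ContDiff ℝ ∞ f →
        ‖iteratedFDeriv ℝ n (fun z => ev (f z)) z‖ ≤ ‖iteratedFDeriv ℝ n f z‖ := by
      intro f hf
      refine (ev.norm_iteratedFDeriv_comp_left hf.contDiffAt
        (mod_cast le_top : (n : ℕ∞ω) ≤ (∞ : ℕ∞ω))).trans ?_
      exact mul_le_of_le_one_left (norm_nonneg _) hevn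
    exact ⟨(hred (hS.comp hbι)).trans hmain.1, (hred (hQ.comp hbι)).trans hmain.2⟩

end Transport

/-! ### Charts of the tangent bundle -/

open Filter Topology

section Charts

variable {d : ℕ} [NeZero d]
  {M : Type*} [TopologicalSpace M] [ChartedSpace (EuclideanHalfSpace d) M]
  [IsManifold (𝓡∂ d) ∞ M]

/-- The chart of `TM` induced by the chart of `M` at `c`. -/
abbrev tangentChart (c : M) :
    PartialEquiv (TangentBundle (𝓡∂ d) M) (EuclideanSpace ℝ (Fin d) × EuclideanSpace ℝ (Fin d)) :=
  extChartAt (𝓡∂ d).tangent (⟨c, 0⟩ : TangentBundle (𝓡∂ d) M)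

/-- The change of coordinates on `M` from the chart at `c` to the chart at `c'`. -/
def transition (c c' : M) : EuclideanSpace ℝ (Fin d) → EuclideanSpace ℝ (Fin d) :=
  extChartAt (𝓡∂ d) c' ∘ (extChartAt (𝓡∂ d) c).symm

/-- The derivative of a change of coordinates. -/
def transitionDeriv (c c' : M) : EuclideanSpace ℝ (Fin d) →
    EuclideanSpace ℝ (Fin d) →L[ℝ] EuclideanSpace ℝ (Fin d) :=
  fderivWithin ℝ (transition c c') (range (𝓡∂ d))

theorem transitionDeriv_eq {c c' : M} {y : EuclideanSpace ℝ (Fin d)}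
    (hy : y ∈ (extChartAt (𝓡∂ d) c).target) :
    transitionDeriv c c' y = tangentCoordChange (𝓡∂ d) c c' ((extChartAt (𝓡∂ d) c).symm y) := by
  rw [tangentCoordChange_def, (extChartAt (𝓡∂ d) c).right_inv hy]
  rfl

theorem range_tangent : range (𝓡∂ d).tangent = range (𝓡∂ d) ×ˢ univ := by
  rw [ModelWithCorners.range_prod, modelWithCornersSelf_coe, range_id]

theorem range_model : range (𝓡∂ d) = {y : EuclideanSpace ℝ (Fin d) | 0 ≤ y 0} :=
  range_modelWithCornersEuclideanHalfSpace d

theorem mem_tangentChart_source {c : M} {p : TangentBundle (𝓡∂ d) M} :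
    p ∈ (tangentChart c).source ↔ p.1 ∈ (extChartAt (𝓡∂ d) c).source := by
  rw [extChartAt_source, extChartAt_source, TangentBundle.mem_chart_source_iff]

theorem tangentChart_target (c : M) :
    (tangentChart c).target = (extChartAt (𝓡∂ d) c).target ×ˢ univ := by
  rw [tangentChart, FiberBundle.extChartAt_target]
  congr 1
  refine inter_eq_left.2 fun y hy => ?_
  have := (extChartAt (𝓡∂ d) c).map_target hy
  rwa [extChartAt_source] at this

theorem tangentChart_symm {c : M} {q : EuclideanSpace ℝ (Fin d) × EuclideanSpace ℝ (Fin d)}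
    (hq : q.1 ∈ (extChartAt (𝓡∂ d) c).target) :
    (tangentChart c).symm q = ⟨(extChartAt (𝓡∂ d) c).symm q.1,
      (trivializationAt (EuclideanSpace ℝ (Fin d)) (TangentSpace (𝓡∂ d) : M → Type _) c).symmL ℝ
        ((extChartAt (𝓡∂ d) c).symm q.1) q.2⟩ := by
  have := (extChartAt (𝓡∂ d) c).map_target hq
  rw [extChartAt_source] at this
  rw [tangentChart, FiberBundle.extChartAt]
  change (trivializationAt (EuclideanSpace ℝ (Fin d))
    (TangentSpace (𝓡∂ d) : M → Type _) c).toPartialEquiv.symm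
      ((extChartAt (𝓡∂ d) c).symm q.1, q.2) = _
  rw [Trivialization.symmL_apply _ this]
  exact ((trivializationAt (EuclideanSpace ℝ (Fin d)) (TangentSpace (𝓡∂ d) : M → Type _)
    c).mk_symm this q.2).symm

theorem tangentChart_apply {c : M} {p : TangentBundle (𝓡∂ d) M} :
    tangentChart c p = (extChartAt (𝓡∂ d) c p.1, tangentCoordChange (𝓡∂ d) p.1 c p.1 p.2) := by
  rw [tangentChart, FiberBundle.extChartAt]
  rfl

theorem tangentChart_self (p : TangentBundle (𝓡∂ d) M) :
    tangentChart p.1 p = (extChartAt (𝓡∂ d) p.1 p.1, p.2) := by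
  rw [tangentChart_apply]
  exact congrArg _ (tangentCoordChange_self (mem_extChartAt_source p.1))

theorem symmL_eq_tangentCoordChange {c x : M} (hx : x ∈ (extChartAt (𝓡∂ d) c).source) :
    (trivializationAt (EuclideanSpace ℝ (Fin d)) (TangentSpace (𝓡∂ d) : M → Type _) c).symmL ℝ x =
      tangentCoordChange (𝓡∂ d) c x x := by
  rw [extChartAt_source] at hx
  exact TangentBundle.symmL_trivializationAt_eq_core hx

theorem tangentChart_tangentChart_symm {c c' : M}
    {q : EuclideanSpace ℝ (Fin d) × EuclideanSpace ℝ (Fin d)}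
    (hq : q.1 ∈ ((extChartAt (𝓡∂ d) c).symm ≫ extChartAt (𝓡∂ d) c').source) :
    tangentChart c' ((tangentChart c).symm q) =
      (transition c c' q.1, transitionDeriv c c' q.1 q.2) := by
  obtain ⟨h1, h2⟩ : q.1 ∈ (extChartAt (𝓡∂ d) c).target ∧
      (extChartAt (𝓡∂ d) c).symm q.1 ∈ (extChartAt (𝓡∂ d) c').source := by
    simpa using hq
  have h3 := (extChartAt (𝓡∂ d) c).map_target h1
  rw [tangentChart_symm h1, symmL_eq_tangentCoordChange h3, tangentChart_apply]
  refine congrArg (Prod.mk (transition c c' q.1))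
    ((tangentCoordChange_comp ⟨⟨h3, mem_extChartAt_source _⟩, h2⟩).trans ?_)
  rw [transitionDeriv_eq h1]

/-- The bilinear form `g(dφ⁻¹ u, dφ⁻¹ w)` of the metric in the chart at `c`. -/
def metricForm (g : Metric d M) (c : M) (y : EuclideanSpace ℝ (Fin d)) :
    EuclideanSpace ℝ (Fin d) →L[ℝ] EuclideanSpace ℝ (Fin d) →L[ℝ] ℝ :=
  let x : M := (extChartAt (𝓡∂ d) c).symm y
  let e : EuclideanSpace ℝ (Fin d) →L[ℝ] EuclideanSpace ℝ (Fin d) :=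
    (trivializationAt (EuclideanSpace ℝ (Fin d)) (TangentSpace (𝓡∂ d) : M → Type _) c).symmL ℝ x
  let b : EuclideanSpace ℝ (Fin d) →L[ℝ] EuclideanSpace ℝ (Fin d) →L[ℝ] ℝ := g.inner x
  b.bilinearComp e e

theorem metricForm_apply (g : Metric d M) (c : M) (y u w : EuclideanSpace ℝ (Fin d)) :
    metricForm g c y u w = chartMetric g c y u w := rfl

theorem inner_tangentChart_symm (g : Metric d M) {c : M}
    {q : EuclideanSpace ℝ (Fin d) × EuclideanSpace ℝ (Fin d)}
    (hq : q.1 ∈ (extChartAt (𝓡∂ d) c).target) :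
    g.inner ((tangentChart c).symm q).1 ((tangentChart c).symm q).2 ((tangentChart c).symm q).2 =
      metricForm g c q.1 q.2 q.2 := by
  rw [tangentChart_symm hq]
  rfl

theorem metricForm_symm (g : Metric d M) (c : M) (y u w : EuclideanSpace ℝ (Fin d)) :
    metricForm g c y u w = metricForm g c y w u := g.symm _ _ _

theorem metricForm_pos (g : Metric d M) {c : M} {y w : EuclideanSpace ℝ (Fin d)}
    (hy : y ∈ (extChartAt (𝓡∂ d) c).target) (hw : w ≠ 0) : 0 < metricForm g c y w w := by
  refine g.pos _ _ fun h => hw ?_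
  have hx := (extChartAt (𝓡∂ d) c).map_target hy
  have h1 : tangentCoordChange (𝓡∂ d) c ((extChartAt (𝓡∂ d) c).symm y)
      ((extChartAt (𝓡∂ d) c).symm y) w = 0 := by
    rw [← symmL_eq_tangentCoordChange hx]
    exact h
  rw [← tangentCoordChange_self (I := 𝓡∂ d) hx (v := w),
    ← tangentCoordChange_comp ⟨⟨hx, mem_extChartAt_source _⟩, hx⟩, h1, map_zero]

theorem metricForm_transition (g : Metric d M) {c c' : M} {y : EuclideanSpace ℝ (Fin d)}
    (hy : y ∈ ((extChartAt (𝓡∂ d) c).symm ≫ extChartAt (𝓡∂ d) c').source)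
    (u w : EuclideanSpace ℝ (Fin d)) :
    metricForm g c y u w = metricForm g c' (transition c c' y)
      (transitionDeriv c c' y u)
      (transitionDeriv c c' y w) := by
  obtain ⟨h1, h2⟩ : y ∈ (extChartAt (𝓡∂ d) c).target ∧
      (extChartAt (𝓡∂ d) c).symm y ∈ (extChartAt (𝓡∂ d) c').source := by
    simpa using hy
  have h3 := (extChartAt (𝓡∂ d) c).map_target h1
  have h4 : (extChartAt (𝓡∂ d) c').symm (transition c c' y) = (extChartAt (𝓡∂ d) c).symm y :=
    (extChartAt (𝓡∂ d) c').left_inv h2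
  have key : ∀ x, x = (extChartAt (𝓡∂ d) c).symm y → ∀ u w, g.inner x
      ((trivializationAt (EuclideanSpace ℝ (Fin d)) (TangentSpace (𝓡∂ d) : M → Type _) c').symmL ℝ x
        (tangentCoordChange (𝓡∂ d) c c' x u))
      ((trivializationAt (EuclideanSpace ℝ (Fin d)) (TangentSpace (𝓡∂ d) : M → Type _) c').symmL ℝ x
        (tangentCoordChange (𝓡∂ d) c c' x w)) =
      g.inner x
      ((trivializationAt (EuclideanSpace ℝ (Fin d)) (TangentSpace (𝓡∂ d) : M → Type _) c).symmL ℝ x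
        u)
      ((trivializationAt (EuclideanSpace ℝ (Fin d)) (TangentSpace (𝓡∂ d) : M → Type _) c).symmL ℝ x
        w) := by
    rintro x rfl u w
    have h6 : ∀ u : EuclideanSpace ℝ (Fin d),
        (trivializationAt (EuclideanSpace ℝ (Fin d)) (TangentSpace (𝓡∂ d) : M → Type _) c').symmL ℝ
          ((extChartAt (𝓡∂ d) c).symm y)
          (tangentCoordChange (𝓡∂ d) c c' ((extChartAt (𝓡∂ d) c).symm y) u) =
        (trivializationAt (EuclideanSpace ℝ (Fin d)) (TangentSpace (𝓡∂ d) : M → Type _) c).symmL ℝ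
          ((extChartAt (𝓡∂ d) c).symm y) u := by
      intro u
      rw [symmL_eq_tangentCoordChange h2, symmL_eq_tangentCoordChange h3]
      exact tangentCoordChange_comp (I := 𝓡∂ d) ⟨⟨h3, h2⟩, mem_extChartAt_source _⟩
    exact congrArg₂ (fun a b => g.inner ((extChartAt (𝓡∂ d) c).symm y) a b) (h6 u) (h6 w)
  have h6 := key _ h4 u w
  rw [transitionDeriv_eq h1]
  rw [h4] at h6
  rw [metricForm_apply, metricForm_apply, chartMetric, chartMetric, h4]
  exact h6.symm

theorem contDiffOn_metricForm (g : Metric d M) (c : M) :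
    ContDiffOn ℝ ∞ (metricForm g c) (extChartAt (𝓡∂ d) c).target := by
  refine contDiffOn_clm_apply.2 fun u => contDiffOn_clm_apply.2 fun w => ?_
  have hs : ∀ u : EuclideanSpace ℝ (Fin d), ContMDiffOn (𝓡∂ d) (𝓡∂ d).tangent ∞
      (fun x : M => (⟨x, (trivializationAt (EuclideanSpace ℝ (Fin d))
        (TangentSpace (𝓡∂ d) : M → Type _) c).symmL ℝ x u⟩ : TangentBundle (𝓡∂ d) M))
      (chartAt (EuclideanHalfSpace d) c).source := by
    intro u
    have h1 := Trivialization.contMDiffOn_symm (n := ∞) (IB := 𝓡∂ d)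
      (trivializationAt (EuclideanSpace ℝ (Fin d)) (TangentSpace (𝓡∂ d) : M → Type _) c)
    have h2 : ContMDiffOn (𝓡∂ d) ((𝓡∂ d).prod 𝓘(ℝ, EuclideanSpace ℝ (Fin d))) ∞
        (fun x : M => (x, u)) (chartAt (EuclideanHalfSpace d) c).source :=
      contMDiffOn_id.prodMk contMDiffOn_const
    refine (h1.comp h2 fun x hx => ?_).congr fun x hx => ?_
    · rw [mem_preimage, TangentBundle.trivializationAt_target]
      exact ⟨hx, mem_univ _⟩
    · rw [Trivialization.symmL_apply _ hx]
      exact (trivializationAt (EuclideanSpace ℝ (Fin d)) (TangentSpace (𝓡∂ d) : M → Type _)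
        c).mk_symm hx u
  have h := ContMDiffOn.clm_bundle_apply₂ (F₁ := EuclideanSpace ℝ (Fin d))
    (F₂ := EuclideanSpace ℝ (Fin d)) (F₃ := ℝ) (E₃ := fun _ : M => ℝ)
    (s := (chartAt (EuclideanHalfSpace d) c).source) (g.contMDiff.contMDiffOn) (hs u) (hs w)
  have h2 : ContMDiffOn (𝓡∂ d) 𝓘(ℝ, ℝ) ∞ (fun x : M => g.inner x
      ((trivializationAt (EuclideanSpace ℝ (Fin d)) (TangentSpace (𝓡∂ d) : M → Type _) c).symmL ℝ x
        u)
      ((trivializationAt (EuclideanSpace ℝ (Fin d)) (TangentSpace (𝓡∂ d) : M → Type _) c).symmL ℝ x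
        w)) (chartAt (EuclideanHalfSpace d) c).source := fun x hx =>
    ((Bundle.contMDiffWithinAt_totalSpace).1 (h x hx)).2
  have h3 := h2.comp (contMDiffOn_extChartAt_symm c) fun y hy => by
    have := (extChartAt (𝓡∂ d) c).map_target hy
    rwa [extChartAt_source] at this
  exact h3.contDiffOn

end Charts

/-! ### The geodesic field in charts -/

section Christoffel

variable {d : ℕ} [NeZero d]
  {M : Type*} [TopologicalSpace M] [ChartedSpace (EuclideanHalfSpace d) M]
  [IsManifold (𝓡∂ d) ∞ M]

theorem uniqueDiffOn_range_model (d : ℕ) [NeZero d] :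
    UniqueDiffOn ℝ (range (𝓡∂ d)) := (𝓡∂ d).uniqueDiffOn

theorem contDiffWithinAt_metricForm (g : Metric d M) {c : M} {y : EuclideanSpace ℝ (Fin d)}
    (hy : y ∈ (extChartAt (𝓡∂ d) c).target) :
    ContDiffWithinAt ℝ ∞ (metricForm g c) (range (𝓡∂ d)) y :=
  (contDiffOn_metricForm g c y hy).mono_of_mem_nhdsWithin
    (extChartAt_target_mem_nhdsWithin_of_mem hy)

/-- The derivative of the metric in the chart at `c`. -/
def metricDeriv (g : Metric d M) (c : M) : EuclideanSpace ℝ (Fin d) →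
    EuclideanSpace ℝ (Fin d) →L[ℝ] EuclideanSpace ℝ (Fin d) →L[ℝ]
      EuclideanSpace ℝ (Fin d) →L[ℝ] ℝ :=
  fderivWithin ℝ (metricForm g c) (range (𝓡∂ d))

theorem hasFDerivWithinAt_metricForm (g : Metric d M) {c : M} {y : EuclideanSpace ℝ (Fin d)}
    (hy : y ∈ (extChartAt (𝓡∂ d) c).target) :
    HasFDerivWithinAt (metricForm g c) (metricDeriv g c y) (range (𝓡∂ d)) y :=
  ((contDiffWithinAt_metricForm g hy).differentiableWithinAt (by simp)).hasFDerivWithinAt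

theorem metricDeriv_apply (g : Metric d M) {c : M} {y : EuclideanSpace ℝ (Fin d)}
    (hy : y ∈ (extChartAt (𝓡∂ d) c).target) (z u w : EuclideanSpace ℝ (Fin d)) :
    metricDeriv g c y z u w = dChartMetric g c y z u w := by
  have h := ((hasFDerivWithinAt_metricForm g hy).clm_apply
    (hasFDerivWithinAt_const u y (range (𝓡∂ d)))).clm_apply
    (hasFDerivWithinAt_const w y (range (𝓡∂ d)))
  have h2 := h.fderivWithin ((uniqueDiffOn_range_model d) y (extChartAt_target_subset_range c hy))
  simp only [metricForm_apply] at h2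
  rw [dChartMetric, h2]
  simp

theorem metricForm_nondegenerate (g : Metric d M) {c : M} {y r : EuclideanSpace ℝ (Fin d)}
    (hy : y ∈ (extChartAt (𝓡∂ d) c).target) (h : metricForm g c y r r = 0) : r = 0 := by
  by_contra hr
  exact (metricForm_pos g hy hr).ne' h

theorem christoffelLower_eq (g : Metric d M) {c : M} {y : EuclideanSpace ℝ (Fin d)}
    (hy : y ∈ (extChartAt (𝓡∂ d) c).target) (u w z : EuclideanSpace ℝ (Fin d)) :
    christoffelLower g c y u w z =
      (metricDeriv g c y u w z + metricDeriv g c y w u z - metricDeriv g c y z u w) / 2 := by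
  simp only [christoffelLower, metricDeriv_apply g hy]

theorem sum_smul_single (r : EuclideanSpace ℝ (Fin d)) :
    r = ∑ i, r i • EuclideanSpace.single i (1 : ℝ) := by
  have := (EuclideanSpace.basisFun (Fin d) ℝ).sum_repr r
  simpa using this.symm

theorem isUnit_gramMatrix (g : Metric d M) {c : M} {y : EuclideanSpace ℝ (Fin d)}
    (hy : y ∈ (extChartAt (𝓡∂ d) c).target) : IsUnit (gramMatrix g c y) := by
  rw [← Matrix.mulVec_injective_iff_isUnit]
  refine (injective_iff_map_eq_zero (gramMatrix g c y).mulVecLin).2 fun v hv => ?_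
  have h : metricForm g c y (WithLp.toLp 2 v) (WithLp.toLp 2 v) = 0 := by
    have h1 : metricForm g c y (WithLp.toLp 2 v) (WithLp.toLp 2 v) =
        ∑ i, v i * ((gramMatrix g c y).mulVecLin v) i := by
      conv_lhs => rw [sum_smul_single (WithLp.toLp 2 v)]
      simp only [map_sum, map_smul, sum_apply, smul_apply, smul_eq_mul, Matrix.mulVecLin_apply,
        Matrix.mulVec, dotProduct, gramMatrix, Matrix.of_apply, ← metricForm_apply]
      refine Finset.sum_congr rfl fun i _ => congrArg (v i * ·) ?_
      exact Finset.sum_congr rfl fun j _ => by rw [metricForm_symm, mul_comm]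
    rw [h1, hv]
    simp
  have := metricForm_nondegenerate g hy h
  exact (WithLp.toLp_injective 2) (by simpa using this)

/-- The Christoffel symbols of the second kind are obtained from those of the first kind by
raising an index. -/
theorem metricForm_christoffel (g : Metric d M) {c : M} {y : EuclideanSpace ℝ (Fin d)}
    (hy : y ∈ (extChartAt (𝓡∂ d) c).target) (u w z : EuclideanSpace ℝ (Fin d)) :
    metricForm g c y (christoffel g c y u w) z = christoffelLower g c y u w z := by
  have hk : ∀ k, metricForm g c y (christoffel g c y u w) (EuclideanSpace.single k 1) =
      christoffelLower g c y u w (EuclideanSpace.single k 1) := by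
    intro k
    set v : Fin d → ℝ := fun j => christoffelLower g c y u w (EuclideanSpace.single j 1) with hv
    have h1 : christoffel g c y u w = WithLp.toLp 2 ((gramMatrix g c y)⁻¹.mulVec v) := rfl
    have h2 : (gramMatrix g c y).mulVec ((gramMatrix g c y)⁻¹.mulVec v) = v := by
      rw [Matrix.mulVec_mulVec, Matrix.mul_nonsing_inv _
        ((Matrix.isUnit_iff_isUnit_det _).1 (isUnit_gramMatrix g hy)), Matrix.one_mulVec]
    have h3 := congrFun h2 k
    rw [h1, metricForm_symm]
    generalize (gramMatrix g c y)⁻¹.mulVec v = r at h3 ⊢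
    conv_lhs => rw [sum_smul_single (WithLp.toLp 2 r)]
    rw [← hv] at *
    change _ = v k
    rw [← h3]
    simp [map_sum, Matrix.mulVec, dotProduct, gramMatrix, ← metricForm_apply, mul_comm]
  have h : ∀ z, christoffelLower g c y u w z = ((1 / 2 : ℝ) • (metricDeriv g c y u w +
      metricDeriv g c y w u - ((metricDeriv g c y).flip u).flip w)) z := by
    intro z
    rw [christoffelLower_eq g hy]
    simp
    ring
  rw [sum_smul_single z, h, map_sum, map_sum]
  refine Finset.sum_congr rfl fun k _ => ?_
  rw [map_smul, map_smul, hk, h]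

theorem contDiffWithinAt_transition {c c' : M} {y : EuclideanSpace ℝ (Fin d)}
    (hy : y ∈ ((extChartAt (𝓡∂ d) c).symm ≫ extChartAt (𝓡∂ d) c').source) :
    ContDiffWithinAt ℝ ∞ (transition c c') (range (𝓡∂ d)) y :=
  contDiffWithinAt_ext_coord_change c' c hy

theorem transition_source_mem_nhdsWithin {c c' : M} {y : EuclideanSpace ℝ (Fin d)}
    (hy : y ∈ ((extChartAt (𝓡∂ d) c).symm ≫ extChartAt (𝓡∂ d) c').source) :
    ((extChartAt (𝓡∂ d) c).symm ≫ extChartAt (𝓡∂ d) c').source ∈ 𝓝[range (𝓡∂ d)] y := by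
  rw [ext_coord_change_source] at hy ⊢
  obtain ⟨z, hz, rfl⟩ := hy
  exact (𝓡∂ d).image_mem_nhdsWithin ((OpenPartialHomeomorph.open_source _).mem_nhds hz)

theorem mem_transition_source {c c' : M} {y : EuclideanSpace ℝ (Fin d)} :
    y ∈ ((extChartAt (𝓡∂ d) c).symm ≫ extChartAt (𝓡∂ d) c').source ↔
      y ∈ (extChartAt (𝓡∂ d) c).target ∧
        (extChartAt (𝓡∂ d) c).symm y ∈ (extChartAt (𝓡∂ d) c').source := by
  simp

theorem transition_mem_target {c c' : M} {y : EuclideanSpace ℝ (Fin d)}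
    (hy : y ∈ ((extChartAt (𝓡∂ d) c).symm ≫ extChartAt (𝓡∂ d) c').source) :
    transition c c' y ∈ (extChartAt (𝓡∂ d) c').target :=
  (extChartAt (𝓡∂ d) c').map_source (mem_transition_source.1 hy).2

/-- The second derivative of a change of coordinates. -/
def transitionDeriv₂ (c c' : M) : EuclideanSpace ℝ (Fin d) →
    EuclideanSpace ℝ (Fin d) →L[ℝ] EuclideanSpace ℝ (Fin d) →L[ℝ] EuclideanSpace ℝ (Fin d) :=
  fderivWithin ℝ (transitionDeriv c c') (range (𝓡∂ d))

theorem hasFDerivWithinAt_transition {c c' : M} {y : EuclideanSpace ℝ (Fin d)}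
    (hy : y ∈ ((extChartAt (𝓡∂ d) c).symm ≫ extChartAt (𝓡∂ d) c').source) :
    HasFDerivWithinAt (transition c c') (transitionDeriv c c' y) (range (𝓡∂ d)) y :=
  ((contDiffWithinAt_transition hy).differentiableWithinAt (by simp)).hasFDerivWithinAt

theorem range_of_transition_source {c c' : M} {y : EuclideanSpace ℝ (Fin d)}
    (hy : y ∈ ((extChartAt (𝓡∂ d) c).symm ≫ extChartAt (𝓡∂ d) c').source) :
    y ∈ range (𝓡∂ d) :=
  extChartAt_target_subset_range c (mem_transition_source.1 hy).1

theorem hasFDerivWithinAt_transitionDeriv {c c' : M} {y : EuclideanSpace ℝ (Fin d)}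
    (hy : y ∈ ((extChartAt (𝓡∂ d) c).symm ≫ extChartAt (𝓡∂ d) c').source) :
    HasFDerivWithinAt (transitionDeriv c c') (transitionDeriv₂ c c' y) (range (𝓡∂ d)) y :=
  (((contDiffWithinAt_transition hy).fderivWithin_right (m := ∞) (uniqueDiffOn_range_model d)
    (by simp) (range_of_transition_source hy)).differentiableWithinAt (by simp)).hasFDerivWithinAt

theorem transitionDeriv₂_symm {c c' : M} {y : EuclideanSpace ℝ (Fin d)}
    (hy : y ∈ ((extChartAt (𝓡∂ d) c).symm ≫ extChartAt (𝓡∂ d) c').source)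
    (u w : EuclideanSpace ℝ (Fin d)) :
    transitionDeriv₂ c c' y u w = transitionDeriv₂ c c' y w u :=
  (contDiffWithinAt_transition hy).isSymmSndFDerivWithinAt
    (by rw [minSmoothness_of_isRCLikeNormedField]
        exact WithTop.coe_le_coe.2 (le_top : (2 : ℕ∞) ≤ ⊤)) (uniqueDiffOn_range_model d)
    ((𝓡∂ d).range_subset_closure_interior (range_of_transition_source hy))
    (range_of_transition_source hy) u w

theorem transitionDeriv_surjective {c c' : M} {y : EuclideanSpace ℝ (Fin d)}
    (hy : y ∈ ((extChartAt (𝓡∂ d) c).symm ≫ extChartAt (𝓡∂ d) c').source) :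
    Function.Surjective (transitionDeriv c c' y) := by
  obtain ⟨h1, h2⟩ := mem_transition_source.1 hy
  have h3 := (extChartAt (𝓡∂ d) c).map_target h1
  intro r
  refine ⟨tangentCoordChange (𝓡∂ d) c' c ((extChartAt (𝓡∂ d) c).symm y) r, ?_⟩
  rw [transitionDeriv_eq h1, tangentCoordChange_comp ⟨⟨h2, h3⟩, h2⟩, tangentCoordChange_self h2]

theorem metricDeriv_transition (g : Metric d M) {c c' : M} {y : EuclideanSpace ℝ (Fin d)}
    (hy : y ∈ ((extChartAt (𝓡∂ d) c).symm ≫ extChartAt (𝓡∂ d) c').source)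
    (z u w : EuclideanSpace ℝ (Fin d)) :
    metricDeriv g c y z u w =
      metricDeriv g c' (transition c c' y) (transitionDeriv c c' y z)
        (transitionDeriv c c' y u) (transitionDeriv c c' y w) +
      metricForm g c' (transition c c' y) (transitionDeriv₂ c c' y z u)
        (transitionDeriv c c' y w) +
      metricForm g c' (transition c c' y) (transitionDeriv c c' y u)
        (transitionDeriv₂ c c' y z w) := by
  have h0 := (hasFDerivWithinAt_metricForm g (transition_mem_target hy)).comp y
    (hasFDerivWithinAt_transition hy) fun x _ => mem_range_self _
  have hD := fun v => (hasFDerivWithinAt_transitionDeriv hy).clm_apply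
    (hasFDerivWithinAt_const v y (range (𝓡∂ d)))
  have h1 := (h0.clm_apply (hD u)).clm_apply (hD w)
  have h2 := ((hasFDerivWithinAt_metricForm g (mem_transition_source.1 hy).1).clm_apply
    (hasFDerivWithinAt_const u y (range (𝓡∂ d)))).clm_apply
    (hasFDerivWithinAt_const w y (range (𝓡∂ d)))
  have h3 := h1.congr_of_eventuallyEq (f₁ := fun y => metricForm g c y u w)
    (mem_of_superset (transition_source_mem_nhdsWithin hy)
      fun y hy => metricForm_transition g hy u w) (metricForm_transition g hy u w)
  have h4 := congrArg (fun F : EuclideanSpace ℝ (Fin d) →L[ℝ] ℝ => F z)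
    ((uniqueDiffOn_range_model d _ (range_of_transition_source hy)).eq h2 h3)
  simp only [add_apply, ContinuousLinearMap.comp_apply, ContinuousLinearMap.flip_apply,
    ContinuousLinearMap.comp_zero, zero_add, Function.comp_apply] at h4
  rw [h4]
  ring

/-- The transformation law of the Christoffel symbols. -/
theorem christoffel_transition (g : Metric d M) {c c' : M} {y : EuclideanSpace ℝ (Fin d)}
    (hy : y ∈ ((extChartAt (𝓡∂ d) c).symm ≫ extChartAt (𝓡∂ d) c').source)
    (u w : EuclideanSpace ℝ (Fin d)) :
    transitionDeriv c c' y (christoffel g c y u w) =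
      christoffel g c' (transition c c' y) (transitionDeriv c c' y u) (transitionDeriv c c' y w) +
        transitionDeriv₂ c c' y u w := by
  have hy1 := (mem_transition_source.1 hy).1
  have hy2 := transition_mem_target hy
  obtain ⟨z, hz⟩ := transitionDeriv_surjective hy (transitionDeriv c c' y (christoffel g c y u w) -
    (christoffel g c' (transition c c' y) (transitionDeriv c c' y u) (transitionDeriv c c' y w) +
        transitionDeriv₂ c c' y u w))
  -- Pair the difference of the two sides with itself, written as the image `dT z` of a vector `z`:
  -- both pairings reduce to derivatives of the metric and of the change of charts `T`.
  refine sub_eq_zero.1 (metricForm_nondegenerate g hy2 ?_)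
  rw [← hz]
  nth_rw 1 [hz]
  rw [map_sub, map_add, sub_apply, add_apply,
    metricForm_christoffel g hy2, ← metricForm_transition g hy, metricForm_christoffel g hy1,
    christoffelLower_eq g hy1, christoffelLower_eq g hy2, metricDeriv_transition g hy,
    metricDeriv_transition g hy, metricDeriv_transition g hy, transitionDeriv₂_symm hy w u,
    transitionDeriv₂_symm hy z u, transitionDeriv₂_symm hy z w,
    metricForm_symm g c' _ (transitionDeriv c c' y w),
    metricForm_symm g c' _ (transitionDeriv₂ c c' y u z)]
  ring

/-- The geodesic vector field in the chart of `TM` at `c`. -/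
def spray (g : Metric d M) (c : M) (q : EuclideanSpace ℝ (Fin d) × EuclideanSpace ℝ (Fin d)) :
    EuclideanSpace ℝ (Fin d) × EuclideanSpace ℝ (Fin d) :=
  (q.2, -christoffel g c q.1 q.2 q.2)

theorem geodesicField_eq_spray (g : Metric d M) (p : TangentBundle (𝓡∂ d) M) :
    (geodesicField g p : EuclideanSpace ℝ (Fin d) × EuclideanSpace ℝ (Fin d)) =
      spray g p.1 (tangentChart p.1 p) := by
  rw [tangentChart_self]
  rfl

/-- The geodesic vector field does not depend on the chart: the differential of a change of charts
of `TM` maps its coordinate representations into each other. -/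
theorem exists_hasFDerivWithinAt_spray (g : Metric d M) {c c' : M}
    {q : EuclideanSpace ℝ (Fin d) × EuclideanSpace ℝ (Fin d)}
    (hq : q.1 ∈ ((extChartAt (𝓡∂ d) c).symm ≫ extChartAt (𝓡∂ d) c').source) :
    ∃ D : EuclideanSpace ℝ (Fin d) × EuclideanSpace ℝ (Fin d) →L[ℝ]
        EuclideanSpace ℝ (Fin d) × EuclideanSpace ℝ (Fin d),
      HasFDerivWithinAt (tangentChart c' ∘ (tangentChart c).symm) D (range (𝓡∂ d).tangent) q ∧
      D (spray g c q) = spray g c' (tangentChart c' ((tangentChart c).symm q)) := by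
  have hfst : HasFDerivWithinAt (Prod.fst : EuclideanSpace ℝ (Fin d) × EuclideanSpace ℝ (Fin d) → _)
      (ContinuousLinearMap.fst ℝ _ _) (range (𝓡∂ d).tangent) q :=
    hasFDerivAt_fst.hasFDerivWithinAt
  have hsnd : HasFDerivWithinAt (Prod.snd : EuclideanSpace ℝ (Fin d) × EuclideanSpace ℝ (Fin d) → _)
      (ContinuousLinearMap.snd ℝ _ _) (range (𝓡∂ d).tangent) q :=
    hasFDerivAt_snd.hasFDerivWithinAt
  have hmaps : MapsTo (Prod.fst : EuclideanSpace ℝ (Fin d) × EuclideanSpace ℝ (Fin d) → _)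
      (range (𝓡∂ d).tangent) (range (𝓡∂ d)) := by
    rw [range_tangent]
    exact fun x hx => hx.1
  have h1 := (hasFDerivWithinAt_transition hq).comp q hfst hmaps
  have h2 := ((hasFDerivWithinAt_transitionDeriv hq).comp q hfst hmaps).clm_apply hsnd
  have hev : ∀ᶠ x in 𝓝[range (𝓡∂ d).tangent] q,
      x.1 ∈ ((extChartAt (𝓡∂ d) c).symm ≫ extChartAt (𝓡∂ d) c').source :=
    hfst.continuousWithinAt.tendsto_nhdsWithin hmaps (transition_source_mem_nhdsWithin hq)
  refine ⟨_, (h1.prodMk h2).congr_of_eventuallyEq (hev.mono fun x hx => ?_) ?_, ?_⟩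
  · exact tangentChart_tangentChart_symm hx
  · exact tangentChart_tangentChart_symm hq
  · rw [tangentChart_tangentChart_symm hq]
    refine Prod.ext ?_ ?_
    · rfl
    · simp only [spray, add_apply, ContinuousLinearMap.comp_apply, ContinuousLinearMap.flip_apply,
        ContinuousLinearMap.prod_apply, ContinuousLinearMap.coe_fst', ContinuousLinearMap.coe_snd',
        Function.comp_apply, map_neg, christoffel_transition g hq]
      abel

/-- The geodesic flow preserves the length of tangent vectors. -/
theorem exists_hasFDerivWithinAt_norm_spray (g : Metric d M) {c : M}
    {q : EuclideanSpace ℝ (Fin d) × EuclideanSpace ℝ (Fin d)}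
    (hq : q.1 ∈ (extChartAt (𝓡∂ d) c).target) :
    ∃ D : EuclideanSpace ℝ (Fin d) × EuclideanSpace ℝ (Fin d) →L[ℝ] ℝ,
      HasFDerivWithinAt (fun q => metricForm g c q.1 q.2 q.2) D (range (𝓡∂ d).tangent) q ∧
      D (spray g c q) = 0 := by
  have hfst : HasFDerivWithinAt (Prod.fst : EuclideanSpace ℝ (Fin d) × EuclideanSpace ℝ (Fin d) → _)
      (ContinuousLinearMap.fst ℝ _ _) (range (𝓡∂ d).tangent) q :=
    hasFDerivAt_fst.hasFDerivWithinAt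
  have hsnd : HasFDerivWithinAt (Prod.snd : EuclideanSpace ℝ (Fin d) × EuclideanSpace ℝ (Fin d) → _)
      (ContinuousLinearMap.snd ℝ _ _) (range (𝓡∂ d).tangent) q :=
    hasFDerivAt_snd.hasFDerivWithinAt
  have hmaps : MapsTo (Prod.fst : EuclideanSpace ℝ (Fin d) × EuclideanSpace ℝ (Fin d) → _)
      (range (𝓡∂ d).tangent) (range (𝓡∂ d)) := by
    rw [range_tangent]
    exact fun x hx => hx.1
  have h := (((hasFDerivWithinAt_metricForm g hq).comp q hfst hmaps).clm_apply hsnd).clm_apply hsnd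
  refine ⟨_, h, ?_⟩
  simp [spray, metricForm_christoffel g hq, christoffelLower_eq g hq]
  rw [metricForm_symm, metricForm_christoffel g hq, christoffelLower_eq g hq]
  ring

theorem metricForm_isInvertible (g : Metric d M) {c : M} {y : EuclideanSpace ℝ (Fin d)}
    (hy : y ∈ (extChartAt (𝓡∂ d) c).target) : (metricForm g c y).IsInvertible := by
  have hinj : Function.Injective (metricForm g c y).toLinearMap :=
    (injective_iff_map_eq_zero _).2 fun r hr =>
      metricForm_nondegenerate g hy (congrArg (fun F => F r) hr)
  have hdim : Module.finrank ℝ (EuclideanSpace ℝ (Fin d)) =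
      Module.finrank ℝ (EuclideanSpace ℝ (Fin d) →L[ℝ] ℝ) := by
    rw [← (LinearMap.toContinuousLinearMap (𝕜 := ℝ) (E := EuclideanSpace ℝ (Fin d))
      (F' := ℝ)).finrank_eq]
    exact Subspace.dual_finrank_eq.symm
  exact ⟨((metricForm g c y).toLinearMap.linearEquivOfInjective hinj
    hdim).toContinuousLinearEquiv, by ext; rfl⟩

theorem contDiffOn_spray (g : Metric d M) (c : M) :
    ContDiffOn ℝ ∞ (spray g c) ((extChartAt (𝓡∂ d) c).target ×ˢ univ) := by
  intro q hq
  have hmaps : MapsTo (Prod.fst : EuclideanSpace ℝ (Fin d) × EuclideanSpace ℝ (Fin d) → _)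
      ((extChartAt (𝓡∂ d) c).target ×ˢ univ) (extChartAt (𝓡∂ d) c).target := fun x hx => hx.1
  have hmaps' := hmaps.mono_right (extChartAt_target_subset_range c)
  have hB : ContDiffWithinAt ℝ ∞ (fun q : EuclideanSpace ℝ (Fin d) × EuclideanSpace ℝ (Fin d) =>
      metricForm g c q.1) ((extChartAt (𝓡∂ d) c).target ×ˢ univ) q :=
    (contDiffWithinAt_metricForm g hq.1).comp q contDiffWithinAt_fst hmaps'
  have hD : ContDiffWithinAt ℝ ∞ (fun q : EuclideanSpace ℝ (Fin d) × EuclideanSpace ℝ (Fin d) =>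
      metricDeriv g c q.1) ((extChartAt (𝓡∂ d) c).target ×ˢ univ) q :=
    ((contDiffWithinAt_metricForm g hq.1).fderivWithin_right (m := ∞) (uniqueDiffOn_range_model d)
      (by simp) (extChartAt_target_subset_range c hq.1)).comp q contDiffWithinAt_fst hmaps'
  have hsnd : ContDiffWithinAt ℝ ∞
      (Prod.snd : EuclideanSpace ℝ (Fin d) × EuclideanSpace ℝ (Fin d) → _)
      ((extChartAt (𝓡∂ d) c).target ×ˢ univ) q := contDiffWithinAt_snd
  have hflip : ContDiffWithinAt ℝ ∞
      (fun q : EuclideanSpace ℝ (Fin d) × EuclideanSpace ℝ (Fin d) =>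
        (((metricDeriv g c q.1).flip q.2).flip q.2))
      ((extChartAt (𝓡∂ d) c).target ×ˢ univ) q := by
    have h1 := ((ContinuousLinearMap.flipₗᵢ ℝ (EuclideanSpace ℝ (Fin d))
      (EuclideanSpace ℝ (Fin d)) (EuclideanSpace ℝ (Fin d) →L[ℝ] ℝ)).contDiff.comp_contDiffWithinAt
        hD).clm_apply hsnd
    exact ((ContinuousLinearMap.flipₗᵢ ℝ (EuclideanSpace ℝ (Fin d))
      (EuclideanSpace ℝ (Fin d)) ℝ).contDiff.comp_contDiffWithinAt h1).clm_apply hsnd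
  have hL := (((hD.clm_apply hsnd).clm_apply hsnd).sub (hflip.const_smul (1 / 2 : ℝ)))
  have hinv := ((metricForm_isInvertible g hq.1).contDiffAt_map_inverse
    (n := ∞)).comp_contDiffWithinAt q hB
  -- the spray in terms of the metric as an invertible operator, which is manifestly smooth
  have key : ∀ x ∈ (extChartAt (𝓡∂ d) c).target ×ˢ (univ : Set (EuclideanSpace ℝ (Fin d))),
      spray g c x = (x.2, -ContinuousLinearMap.inverse (metricForm g c x.1)
        (metricDeriv g c x.1 x.2 x.2 -
          (1 / 2 : ℝ) • ((metricDeriv g c x.1).flip x.2).flip x.2)) := by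
    intro x hx
    refine Prod.ext rfl (congrArg Neg.neg (Eq.symm ?_))
    rw [(metricForm_isInvertible g hx.1).inverse_apply_eq]
    ext z
    rw [metricForm_christoffel g hx.1, christoffelLower_eq g hx.1]
    simp
    ring
  exact (hsnd.prodMk (hinv.clm_apply hL).neg).congr key (key q hq)

end Christoffel

/-! ### Functions on the unit sphere bundle -/

open NormedSpace

section Functions

variable {d : ℕ} [NeZero d]
  {M : Type*} [TopologicalSpace M] [ChartedSpace (EuclideanHalfSpace d) M]
  [IsManifold (𝓡∂ d) ∞ M]
  {F : Type*} [NormedAddCommGroup F] [NormedSpace ℝ F]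
  {F' : Type*} [NormedAddCommGroup F'] [NormedSpace ℝ F']

/-- The coordinates `(y, w)`, `w ≠ 0`, of the nonzero tangent vectors over the chart at `c`. -/
def nonzeroDomain (c : M) : Set (EuclideanSpace ℝ (Fin d) × EuclideanSpace ℝ (Fin d)) :=
  {q | q.1 ∈ (extChartAt (𝓡∂ d) c).target ∧ q.2 ≠ 0}

theorem mem_tangentChart_target {c : M}
    {q : EuclideanSpace ℝ (Fin d) × EuclideanSpace ℝ (Fin d)} :
    q ∈ (tangentChart c).target ↔ q.1 ∈ (extChartAt (𝓡∂ d) c).target := by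
  rw [tangentChart_target]
  simp

theorem nonzeroDomain_subset_range (c : M) : nonzeroDomain c ⊆ range (𝓡∂ d).tangent := by
  rw [range_tangent]
  exact fun q hq => ⟨extChartAt_target_subset_range c hq.1, mem_univ _⟩

theorem nonzeroDomain_mem_nhdsWithin {c : M}
    {q : EuclideanSpace ℝ (Fin d) × EuclideanSpace ℝ (Fin d)} (hq : q ∈ nonzeroDomain c) :
    nonzeroDomain c ∈ 𝓝[range (𝓡∂ d).tangent] q := by
  have h1 : (tangentChart c).target ∈ 𝓝[range (𝓡∂ d).tangent] q :=
    extChartAt_target_mem_nhdsWithin_of_mem (mem_tangentChart_target.2 hq.1)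
  have h2 : {q : EuclideanSpace ℝ (Fin d) × EuclideanSpace ℝ (Fin d) | q.2 ≠ 0} ∈ 𝓝 q :=
    (isOpen_ne.preimage continuous_snd).mem_nhds hq.2
  filter_upwards [h1, mem_nhdsWithin_of_mem_nhds h2] with x hx hx'
  exact ⟨mem_tangentChart_target.1 hx, hx'⟩

theorem tangentChart_symm_snd_ne_zero (g : Metric d M) {c : M}
    {q : EuclideanSpace ℝ (Fin d) × EuclideanSpace ℝ (Fin d)} (hq : q ∈ nonzeroDomain c) :
    ((tangentChart c).symm q).2 ≠ 0 := by
  intro h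
  have h1 := inner_tangentChart_symm g (c := c) (q := q) hq.1
  rw [h, map_zero] at h1
  exact (metricForm_pos g hq.1 hq.2).ne h1

theorem tangentChart_mem_nonzeroDomain {c : M} {p : TangentBundle (𝓡∂ d) M}
    (hp : p.1 ∈ (extChartAt (𝓡∂ d) c).source) (hp0 : p.2 ≠ 0) :
    tangentChart c p ∈ nonzeroDomain c := by
  have hp' := mem_tangentChart_source.2 hp
  refine ⟨mem_tangentChart_target.1 ((tangentChart c).map_source hp'), fun h => hp0 ?_⟩
  have h1 : tangentCoordChange (𝓡∂ d) p.1 c p.1 p.2 = 0 := by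
    rw [tangentChart_apply] at h
    exact h
  have h2 : tangentCoordChange (𝓡∂ d) c p.1 p.1 (tangentCoordChange (𝓡∂ d) p.1 c p.1 p.2) = p.2 :=
    (tangentCoordChange_comp ⟨⟨mem_extChartAt_source _, hp⟩, mem_extChartAt_source _⟩).trans
      (tangentCoordChange_self (mem_extChartAt_source _))
  rw [h1, map_zero] at h2
  exact h2.symm

theorem setOf_ne_zero_mem_nhds {p : TangentBundle (𝓡∂ d) M} (hp : p.2 ≠ 0) :
    {p : TangentBundle (𝓡∂ d) M | p.2 ≠ 0} ∈ 𝓝 p := by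
  have h1 : ContinuousAt (tangentChart p.1) p := continuousAt_extChartAt (I := (𝓡∂ d).tangent) p
  have h2 : (tangentChart p.1 p).2 ≠ 0 := by
    rw [tangentChart_self]
    exact hp
  filter_upwards [h1.snd.eventually_ne h2] with x hx h
  refine hx ?_
  rw [tangentChart_apply]
  exact (congrArg (tangentCoordChange (𝓡∂ d) x.1 p.1 x.1) h).trans (map_zero _)

theorem localRep_eq (g : Metric d M) (f : UnitSphereBundle g → F) {c : M}
    {q : EuclideanSpace ℝ (Fin d) × EuclideanSpace ℝ (Fin d)} (hq : q ∈ nonzeroDomain c) :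
    localRep g f c q = f (toUnit g _ (tangentChart_symm_snd_ne_zero g hq)) :=
  dif_pos (tangentChart_symm_snd_ne_zero g hq)

theorem localRep_comp (g : Metric d M) (f : UnitSphereBundle g → F) (Θ : F → F') {c : M}
    {q : EuclideanSpace ℝ (Fin d) × EuclideanSpace ℝ (Fin d)} (hq : q ∈ nonzeroDomain c) :
    localRep g (fun p => Θ (f p)) c q = Θ (localRep g f c q) := by
  rw [localRep_eq g _ hq, localRep_eq g f hq]

theorem ne_zero_of_unit (g : Metric d M) (p : UnitSphereBundle g) : p.1.2 ≠ 0 := by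
  intro h
  have := p.2
  rw [h, map_zero] at this
  exact zero_ne_one this

theorem toUnit_coe (g : Metric d M) (p : UnitSphereBundle g) :
    toUnit g p.1 (ne_zero_of_unit g p) = p := by
  refine Subtype.ext ?_
  obtain ⟨⟨x, v⟩, hp⟩ := p
  simp only [toUnit]
  simp only at hp
  rw [hp]
  simp

theorem homExt_coe (g : Metric d M) (f : UnitSphereBundle g → F) (p : UnitSphereBundle g) :
    homExt g f p.1 = f p := by
  rw [homExt, dif_pos (ne_zero_of_unit g p), toUnit_coe]

theorem localRep_tangentChart_eq_homExt (g : Metric d M) (f : UnitSphereBundle g → F) {c : M}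
    {p : TangentBundle (𝓡∂ d) M} (hp : p.1 ∈ (extChartAt (𝓡∂ d) c).source) :
    localRep g f c (tangentChart c p) = homExt g f p :=
  congrArg (homExt g f) ((tangentChart c).left_inv (mem_tangentChart_source.2 hp))

theorem localRep_tangentChart (g : Metric d M) (f : UnitSphereBundle g → F) {c : M}
    (p : UnitSphereBundle g) (hp : p.1.1 ∈ (extChartAt (𝓡∂ d) c).source) :
    localRep g f c (tangentChart c p.1) = f p := by
  rw [localRep_tangentChart_eq_homExt g f hp, homExt_coe]

theorem SmoothOnSM.contDiffOn {g : Metric d M} {f : UnitSphereBundle g → F} (hf : SmoothOnSM g f)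
    (c : M) : ContDiffOn ℝ ∞ (localRep g f c) (nonzeroDomain c) := by
  refine contMDiffOn_iff_contDiffOn.1 (ContMDiffOn.comp hf
    ((contMDiffOn_extChartAt_symm (I := (𝓡∂ d).tangent) (n := ∞)
      (⟨c, 0⟩ : TangentBundle (𝓡∂ d) M)).mono
        fun q hq => mem_tangentChart_target.2 hq.1) fun q hq => ?_)
  exact tangentChart_symm_snd_ne_zero g hq

theorem SmoothOnSM.of_contDiffOn {g : Metric d M} {f : UnitSphereBundle g → F}
    (hf : ∀ c, ContDiffOn ℝ ∞ (localRep g f c) (nonzeroDomain c)) : SmoothOnSM g f := by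
  intro p hp
  have h1 : ContMDiffAt (𝓡∂ d).tangent 𝓘(ℝ, EuclideanSpace ℝ (Fin d) × EuclideanSpace ℝ (Fin d))
      ∞ (tangentChart p.1) p := contMDiffAt_extChartAt (I := (𝓡∂ d).tangent) (x := p)
  have hsrc : ∀ᶠ x in 𝓝 p, x.1 ∈ (extChartAt (𝓡∂ d) p.1).source := by
    filter_upwards [extChartAt_source_mem_nhds (I := (𝓡∂ d).tangent) p] with x hx
    exact mem_tangentChart_source.1 hx
  have h2 := (contMDiffOn_iff_contDiffOn.2 (hf p.1)) (tangentChart p.1 p)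
    (tangentChart_mem_nonzeroDomain (mem_extChartAt_source _) hp)
  set S := {x : TangentBundle (𝓡∂ d) M | x.1 ∈ (extChartAt (𝓡∂ d) p.1).source ∧ x.2 ≠ 0} with hS
  have hSn : S ∈ 𝓝 p := by
    filter_upwards [hsrc, setOf_ne_zero_mem_nhds hp] with x hx hx' using ⟨hx, hx'⟩
  have h3 := h2.comp p h1.contMDiffWithinAt (s := S)
    fun x hx => tangentChart_mem_nonzeroDomain hx.1 hx.2
  have h4 := (h3.contMDiffAt hSn).congr_of_eventuallyEq (f₁ := homExt g f) (by
    filter_upwards [hsrc] with x hx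
    exact (localRep_tangentChart_eq_homExt g f hx).symm)
  exact h4.contMDiffWithinAt

theorem SmoothOnSM.comp_contDiff {g : Metric d M} {f : UnitSphereBundle g → F}
    (hf : SmoothOnSM g f) {Θ : F → F'} (hΘ : ContDiff ℝ ∞ Θ) :
    SmoothOnSM g fun p => Θ (f p) :=
  .of_contDiffOn fun c => (hΘ.comp_contDiffOn (hf.contDiffOn c)).congr
    fun _ hq => localRep_comp g f Θ hq

theorem uniqueDiffOn_range_tangent (d : ℕ) [NeZero d] :
    UniqueDiffOn ℝ (range (𝓡∂ d).tangent) := (𝓡∂ d).tangent.uniqueDiffOn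

theorem SmoothOnSM.contDiffWithinAt {g : Metric d M} {f : UnitSphereBundle g → F}
    (hf : SmoothOnSM g f) {c : M} {q : EuclideanSpace ℝ (Fin d) × EuclideanSpace ℝ (Fin d)}
    (hq : q ∈ nonzeroDomain c) :
    ContDiffWithinAt ℝ ∞ (localRep g f c) (range (𝓡∂ d).tangent) q :=
  (hf.contDiffOn c q hq).mono_of_mem_nhdsWithin (nonzeroDomain_mem_nhdsWithin hq)

theorem tangentChart_comp_symm_eq {c c' : M}
    {q : EuclideanSpace ℝ (Fin d) × EuclideanSpace ℝ (Fin d)}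
    (hq : q.1 ∈ ((extChartAt (𝓡∂ d) c).symm ≫ extChartAt (𝓡∂ d) c').source) :
    (tangentChart c').symm (tangentChart c' ((tangentChart c).symm q)) =
      (tangentChart c).symm q := by
  refine (tangentChart c').left_inv (mem_tangentChart_source.2 ?_)
  rw [tangentChart_symm (mem_transition_source.1 hq).1]
  exact (mem_transition_source.1 hq).2

theorem localRep_transition (g : Metric d M) (f : UnitSphereBundle g → F) {c c' : M}
    {q : EuclideanSpace ℝ (Fin d) × EuclideanSpace ℝ (Fin d)}
    (hq : q.1 ∈ ((extChartAt (𝓡∂ d) c).symm ≫ extChartAt (𝓡∂ d) c').source) :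
    localRep g f c' (tangentChart c' ((tangentChart c).symm q)) = localRep g f c q :=
  congrArg (homExt g f) (tangentChart_comp_symm_eq hq)

/-- The derivative along the geodesic vector field can be computed in any chart. -/
theorem SmoothOnSM.geodesicDeriv_eq {g : Metric d M} {f : UnitSphereBundle g → F}
    (hf : SmoothOnSM g f) {c : M} (p : UnitSphereBundle g)
    (hp : p.1.1 ∈ (extChartAt (𝓡∂ d) c).source) :
    geodesicDeriv g f p = fderivWithin ℝ (localRep g f c) (range (𝓡∂ d).tangent)
      (tangentChart c p.1) (spray g c (tangentChart c p.1)) := by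
  have hp0 := ne_zero_of_unit g p
  have hmd : MDifferentiableAt (𝓡∂ d).tangent 𝓘(ℝ, F) (homExt g f) p.1 :=
    ((hf p.1 hp0).contMDiffAt (setOf_ne_zero_mem_nhds hp0)).mdifferentiableAt (by simp)
  have h1 : geodesicDeriv g f p = fderivWithin ℝ (localRep g f p.1.1) (range (𝓡∂ d).tangent)
      (tangentChart p.1.1 p.1) (spray g p.1.1 (tangentChart p.1.1 p.1)) := by
    rw [geodesicDeriv, hmd.mfderiv, ← geodesicField_eq_spray]
    rfl
  rw [h1]
  set q := tangentChart p.1.1 p.1 with hq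
  have hsymm : (tangentChart p.1.1).symm q = p.1 :=
    (tangentChart p.1.1).left_inv (mem_tangentChart_source.2 (mem_extChartAt_source _))
  have hq1 : q.1 = extChartAt (𝓡∂ d) p.1.1 p.1.1 := by rw [hq, tangentChart_self]
  have hq2 : q.1 ∈ ((extChartAt (𝓡∂ d) p.1.1).symm ≫ extChartAt (𝓡∂ d) c).source := by
    rw [mem_transition_source, hq1]
    exact ⟨mem_extChartAt_target _, by rwa [extChartAt_to_inv]⟩
  obtain ⟨D, hD, hDX⟩ := exists_hasFDerivWithinAt_spray g hq2
  have hqc : (tangentChart c ∘ (tangentChart p.1.1).symm) q = tangentChart c p.1 :=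
    congrArg (tangentChart c) hsymm
  have h2 : HasFDerivWithinAt (localRep g f c)
      (fderivWithin ℝ (localRep g f c) (range (𝓡∂ d).tangent) (tangentChart c p.1))
      (range (𝓡∂ d).tangent) ((tangentChart c ∘ (tangentChart p.1.1).symm) q) := by
    rw [hqc]
    exact ((hf.contDiffWithinAt
      (tangentChart_mem_nonzeroDomain hp hp0)).differentiableWithinAt
        (by simp)).hasFDerivWithinAt
  have hmaps : MapsTo (tangentChart c ∘ (tangentChart p.1.1).symm) (range (𝓡∂ d).tangent)
      (range (𝓡∂ d).tangent) := fun x _ => mem_range_self _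
  have hev : ∀ᶠ x in 𝓝[range (𝓡∂ d).tangent] q,
      x.1 ∈ ((extChartAt (𝓡∂ d) p.1.1).symm ≫ extChartAt (𝓡∂ d) c).source := by
    refine (continuousWithinAt_fst (s := range (𝓡∂ d).tangent)).tendsto_nhdsWithin ?_
      (transition_source_mem_nhdsWithin hq2)
    rw [range_tangent]
    exact fun x hx => hx.1
  have h3 := (h2.comp q hD hmaps).congr_of_eventuallyEq (f₁ := localRep g f p.1.1)
    (hev.mono fun x hx => (localRep_transition g f hx).symm) (localRep_transition g f hq2).symm
  rw [h3.fderivWithin (uniqueDiffOn_range_tangent d _ (mem_range_self _)),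
    ContinuousLinearMap.comp_apply, hDX, hsymm]

/-- Division of a tangent vector by its length, in the chart at `c`. -/
def unitRetraction (g : Metric d M) (c : M)
    (q : EuclideanSpace ℝ (Fin d) × EuclideanSpace ℝ (Fin d)) :
    EuclideanSpace ℝ (Fin d) × EuclideanSpace ℝ (Fin d) :=
  (q.1, (√(metricForm g c q.1 q.2 q.2))⁻¹ • q.2)

theorem tangentChart_toUnit (g : Metric d M) {c : M}
    {q : EuclideanSpace ℝ (Fin d) × EuclideanSpace ℝ (Fin d)} (hq : q ∈ nonzeroDomain c) :
    tangentChart c (toUnit g _ (tangentChart_symm_snd_ne_zero g hq)).1 = unitRetraction g c q := by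
  have h1 : (tangentChart c).symm (unitRetraction g c q) =
      (toUnit g _ (tangentChart_symm_snd_ne_zero g hq)).1 := by
    have h2 := inner_tangentChart_symm g (c := c) (q := q) hq.1
    rw [toUnit]
    simp only
    rw [h2, tangentChart_symm (c := c) (q := q) hq.1,
      tangentChart_symm (c := c) (q := unitRetraction g c q) hq.1, unitRetraction]
    exact congrArg (TotalSpace.mk _) (map_smul _ _ _)
  rw [← h1]
  exact (tangentChart c).right_inv (x := unitRetraction g c q) (mem_tangentChart_target.2 hq.1)

theorem unitRetraction_mem (g : Metric d M) {c : M}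
    {q : EuclideanSpace ℝ (Fin d) × EuclideanSpace ℝ (Fin d)} (hq : q ∈ nonzeroDomain c) :
    unitRetraction g c q ∈ nonzeroDomain c :=
  ⟨hq.1, smul_ne_zero (inv_ne_zero (Real.sqrt_pos.2 (metricForm_pos g hq.1 hq.2)).ne') hq.2⟩

theorem contDiffOn_unitRetraction (g : Metric d M) (c : M) :
    ContDiffOn ℝ ∞ (unitRetraction g c) (nonzeroDomain c) := by
  have hB : ContDiffOn ℝ ∞ (fun q : EuclideanSpace ℝ (Fin d) × EuclideanSpace ℝ (Fin d) =>
      metricForm g c q.1) (nonzeroDomain c) :=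
    (contDiffOn_metricForm g c).comp contDiffOn_fst fun q hq => hq.1
  have hG := (hB.clm_apply contDiffOn_snd).clm_apply contDiffOn_snd
  exact contDiffOn_fst.prodMk (((hG.sqrt fun q hq => (metricForm_pos g hq.1 hq.2).ne').inv
    fun q hq => (Real.sqrt_pos.2 (metricForm_pos g hq.1 hq.2)).ne').smul contDiffOn_snd)

/-- The geodesic vector field is tangent to the unit sphere bundle, as the retraction onto that
bundle fixes it. -/
theorem exists_hasFDerivWithinAt_unitRetraction (g : Metric d M) {c : M}
    {q : EuclideanSpace ℝ (Fin d) × EuclideanSpace ℝ (Fin d)}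
    (hq : q.1 ∈ (extChartAt (𝓡∂ d) c).target) (h1 : metricForm g c q.1 q.2 q.2 = 1) :
    ∃ D : EuclideanSpace ℝ (Fin d) × EuclideanSpace ℝ (Fin d) →L[ℝ]
        EuclideanSpace ℝ (Fin d) × EuclideanSpace ℝ (Fin d),
      HasFDerivWithinAt (unitRetraction g c) D (range (𝓡∂ d).tangent) q ∧
      D (spray g c q) = spray g c q := by
  obtain ⟨D, hD, hD0⟩ := exists_hasFDerivWithinAt_norm_spray g hq
  have h2 : HasFDerivWithinAt (fun q : EuclideanSpace ℝ (Fin d) × EuclideanSpace ℝ (Fin d) =>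
      (√(metricForm g c q.1 q.2 q.2))⁻¹) _ (range (𝓡∂ d).tangent) q :=
    ((hasDerivAt_inv (by rw [h1]; simp)).comp_hasFDerivWithinAt q (hD.sqrt (by rw [h1]; simp)))
  have hfst : HasFDerivWithinAt (Prod.fst : EuclideanSpace ℝ (Fin d) × EuclideanSpace ℝ (Fin d) → _)
      (ContinuousLinearMap.fst ℝ _ _) (range (𝓡∂ d).tangent) q :=
    hasFDerivAt_fst.hasFDerivWithinAt
  have hsnd : HasFDerivWithinAt (Prod.snd : EuclideanSpace ℝ (Fin d) × EuclideanSpace ℝ (Fin d) → _)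
      (ContinuousLinearMap.snd ℝ _ _) (range (𝓡∂ d).tangent) q :=
    hasFDerivAt_snd.hasFDerivWithinAt
  refine ⟨_, hfst.prodMk (h2.smul hsnd), ?_⟩
  refine Prod.ext (by simp) ?_
  simp [hD0, h1]

/-- The derivative of a smooth function along the geodesic vector field is smooth. -/
theorem SmoothOnSM.geodesicDeriv {g : Metric d M} {f : UnitSphereBundle g → F}
    (hf : SmoothOnSM g f) : SmoothOnSM g (geodesicDeriv g f) := by
  refine .of_contDiffOn fun c => ?_
  have h1 : ContDiffOn ℝ ∞ (fun q => fderivWithin ℝ (localRep g f c) (range (𝓡∂ d).tangent) q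
      (spray g c q)) (nonzeroDomain c) := by
    intro q hq
    have h2 : ContDiffWithinAt ℝ ∞
        (fderivWithin ℝ (localRep g f c) (range (𝓡∂ d).tangent)) (nonzeroDomain c) q :=
      ((hf.contDiffWithinAt hq).fderivWithin_right (m := ∞) (uniqueDiffOn_range_tangent d)
        (by simp) (nonzeroDomain_subset_range c hq)).mono (nonzeroDomain_subset_range c)
    exact h2.clm_apply ((contDiffOn_spray g c q ⟨hq.1, mem_univ _⟩).mono
      fun x hx => ⟨hx.1, mem_univ _⟩)
  refine (h1.comp (contDiffOn_unitRetraction g c)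
    fun q hq => unitRetraction_mem g hq).congr fun q hq => ?_
  have hsrc : (toUnit g _ (tangentChart_symm_snd_ne_zero g hq)).1.1 ∈
      (extChartAt (𝓡∂ d) c).source := by
    change ((tangentChart c).symm q).1 ∈ _
    rw [tangentChart_symm hq.1]
    exact (extChartAt (𝓡∂ d) c).map_target hq.1
  rw [localRep_eq g _ hq, hf.geodesicDeriv_eq _ hsrc, tangentChart_toUnit g hq]
  rfl

end Functions

/-! ### Relatively open sets and norms on the unit sphere bundle -/

section RelativelyOpen

variable {E E' F : Type*} [NormedAddCommGroup E] [NormedSpace ℝ E]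
  [NormedAddCommGroup E'] [NormedSpace ℝ E'] [NormedAddCommGroup F] [NormedSpace ℝ F]
  {S U : Set E} {S' V : Set E'}

/-- `U` is a relatively open subset of `S`. -/
def IsRelOpen (S U : Set E) : Prop := U ⊆ S ∧ ∀ x ∈ U, U ∈ 𝓝[S] x

theorem IsRelOpen.uniqueDiffOn (hU : IsRelOpen S U) (hS : UniqueDiffOn ℝ S) :
    UniqueDiffOn ℝ U := fun x hx =>
  (hS x (hU.1 hx)).mono_nhds (nhdsWithin_le_of_mem (hU.2 x hx))

theorem IsRelOpen.iteratedFDerivWithin_eq (hU : IsRelOpen S U) {x : E} (hx : x ∈ U) (f : E → F)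
    (n : ℕ) : iteratedFDerivWithin ℝ n f U x = iteratedFDerivWithin ℝ n f S x :=
  iteratedFDerivWithin_congr_set (nhdsWithin_eq_iff_eventuallyEq.1
    (le_antisymm (nhdsWithin_mono x hU.1) (nhdsWithin_le_of_mem (hU.2 x hx)))) n

theorem IsRelOpen.refl (S : Set E) : IsRelOpen S S := ⟨subset_rfl, fun _ _ => self_mem_nhdsWithin⟩

theorem IsRelOpen.exists_norm_iteratedFDerivWithin_le (hU : IsRelOpen S U)
    (hS : UniqueDiffOn ℝ S) {f : E → F} (hf : ContDiffOn ℝ ∞ f U) {Q : Set E} (hQ : IsCompact Q)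
    (hQU : Q ⊆ U) (k : ℕ) :
    ∃ C : ℝ, 1 ≤ C ∧ ∀ j ≤ k, ∀ q ∈ Q, ‖iteratedFDerivWithin ℝ j f S q‖ ≤ C := by
  have h : ∀ j : ℕ, ∃ C : ℝ, ∀ q ∈ Q, ‖iteratedFDerivWithin ℝ j f U q‖ ≤ C := fun j =>
    hQ.exists_bound_of_continuousOn ((hf.continuousOn_iteratedFDerivWithin
      (mod_cast le_top) (hU.uniqueDiffOn hS)).mono hQU)
  choose C hC using h
  refine ⟨1 + ∑ j ∈ Finset.range (k + 1), |C j|,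
    le_add_of_nonneg_right (Finset.sum_nonneg fun _ _ => abs_nonneg _), fun j hj q hq => ?_⟩
  rw [← hU.iteratedFDerivWithin_eq (hQU hq)]
  have h1 := Finset.single_le_sum (f := fun j => |C j|) (fun i _ => abs_nonneg (C i))
    (Finset.mem_range.2 (Nat.lt_succ_of_le hj))
  linarith [hC j q hq, le_abs_self (C j)]

/-- On a compact set, composition with a fixed smooth map changes bounds for derivatives by at most
a constant factor. -/
theorem IsRelOpen.exists_norm_iteratedFDerivWithin_comp_le (hU : IsRelOpen S U)
    (hS : UniqueDiffOn ℝ S) (hV : IsRelOpen S' V) (hS' : UniqueDiffOn ℝ S') {f : E → E'}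
    (hf : ContDiffOn ℝ ∞ f U) (hfU : MapsTo f U V) {Q : Set E} (hQ : IsCompact Q)
    (hQU : Q ⊆ U) (k : ℕ) :
    ∃ C : ℝ, 1 ≤ C ∧ ∀ h : E' → F, ContDiffOn ℝ ∞ h V → ∀ q ∈ Q, ∀ B : ℝ,
      (∀ j ≤ k, ‖iteratedFDerivWithin ℝ j h S' (f q)‖ ≤ B) →
      ∀ j ≤ k, ‖iteratedFDerivWithin ℝ j (h ∘ f) S q‖ ≤ C * B := by
  obtain ⟨D, hD1, hD⟩ := hU.exists_norm_iteratedFDerivWithin_le hS hf hQ hQU k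
  have hfac : (1 : ℝ) ≤ k.factorial := mod_cast k.factorial_pos
  refine ⟨k.factorial * D ^ k, one_le_mul_of_one_le_of_one_le hfac (one_le_pow₀ hD1),
    fun h hh q hq B hB j hj => ?_⟩
  have hB0 : 0 ≤ B := (norm_nonneg _).trans (hB 0 (Nat.zero_le _))
  have key := norm_iteratedFDerivWithin_comp_le hh hf (n := j) (mod_cast le_top)
    (hV.uniqueDiffOn hS') (hU.uniqueDiffOn hS) hfU (hQU hq) (C := B) (D := D)
    (fun i hi => by
      rw [hV.iteratedFDerivWithin_eq (hfU (hQU hq))]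
      exact hB i (hi.trans hj))
    (fun i hi hij => by
      rw [hU.iteratedFDerivWithin_eq (hQU hq)]
      exact (hD i (hij.trans hj) q hq).trans (le_self_pow₀ hD1 (by omega)))
  rw [hU.iteratedFDerivWithin_eq (hQU hq)] at key
  refine key.trans ?_
  have h1 : (j.factorial : ℝ) ≤ k.factorial := mod_cast Nat.factorial_le hj
  have h2 : D ^ j ≤ D ^ k := pow_le_pow_right₀ hD1 hj
  calc (j.factorial : ℝ) * B * D ^ j ≤ k.factorial * B * D ^ k := by gcongr
    _ = _ := by ring

theorem IsRelOpen.exists_norm_iteratedFDerivWithin_smul_le (hU : IsRelOpen S U)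
    (hS : UniqueDiffOn ℝ S) {ρ : E → ℝ} (hρ : ContDiffOn ℝ ∞ ρ U) {Q : Set E} (hQ : IsCompact Q)
    (hQU : Q ⊆ U) (k : ℕ) :
    ∃ C : ℝ, 1 ≤ C ∧ ∀ h : E → F, ContDiffOn ℝ ∞ h U → ∀ q ∈ Q, ∀ B : ℝ,
      (∀ j ≤ k, ‖iteratedFDerivWithin ℝ j h S q‖ ≤ B) →
      ∀ j ≤ k, ‖iteratedFDerivWithin ℝ j (fun x => ρ x • h x) S q‖ ≤ C * B := by
  obtain ⟨D, hD1, hD⟩ := hU.exists_norm_iteratedFDerivWithin_le hS hρ hQ hQU k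
  refine ⟨2 ^ k * D, one_le_mul_of_one_le_of_one_le (one_le_pow₀ one_le_two) hD1,
    fun h hh q hq B hB j hj => ?_⟩
  have hB0 : 0 ≤ B := (norm_nonneg _).trans (hB 0 (Nat.zero_le _))
  rw [← hU.iteratedFDerivWithin_eq (hQU hq)]
  refine (norm_iteratedFDerivWithin_smul_le hρ hh (hU.uniqueDiffOn hS) (hQU hq) (n := j)
    (mod_cast le_top)).trans ?_
  calc _ ≤ ∑ i ∈ Finset.range (j + 1), (j.choose i : ℝ) * D * B := by
        refine Finset.sum_le_sum fun i hi => ?_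
        have hi' := Nat.le_of_lt_succ (Finset.mem_range.1 hi)
        rw [hU.iteratedFDerivWithin_eq (hQU hq), hU.iteratedFDerivWithin_eq (hQU hq)]
        exact mul_le_mul (mul_le_mul_of_nonneg_left (hD i (hi'.trans hj) q hq) (by positivity))
          (hB _ ((Nat.sub_le _ _).trans hj)) (norm_nonneg _) (by positivity)
    _ = 2 ^ j * D * B := by
        rw [← Finset.sum_mul, ← Finset.sum_mul, ← Nat.cast_sum, Nat.sum_range_choose]
        push_cast
        ring
    _ ≤ _ := by
        have : (2 : ℝ) ^ j ≤ 2 ^ k := pow_le_pow_right₀ one_le_two hj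
        gcongr

end RelativelyOpen

section Norms

variable {d : ℕ} [NeZero d]
  {M : Type*} [TopologicalSpace M] [ChartedSpace (EuclideanHalfSpace d) M]
  [IsManifold (𝓡∂ d) ∞ M]
  {F : Type*} [NormedAddCommGroup F] [NormedSpace ℝ F]

theorem isRelOpen_nonzeroDomain (c : M) :
    IsRelOpen (range (𝓡∂ d).tangent) (nonzeroDomain c) :=
  ⟨nonzeroDomain_subset_range c, fun _ hq => nonzeroDomain_mem_nhdsWithin hq⟩

theorem homExt_smul (g : Metric d M) (f : UnitSphereBundle g → F) {t : ℝ} (ht : 0 < t) (x : M)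
    (v : TangentSpace (𝓡∂ d) x) :
    homExt g f ⟨x, t • v⟩ = homExt g f ⟨x, v⟩ := by
  by_cases hv : v = 0
  · rw [hv, smul_zero]
  · have htv : t • v ≠ 0 := smul_ne_zero ht.ne' hv
    rw [homExt, homExt, dif_pos htv, dif_pos hv]
    refine congrArg f (Subtype.ext (congrArg (TotalSpace.mk x) ?_))
    have h1 : g.inner x (t • v) (t • v) = t ^ 2 * g.inner x v v := by
      simp
      ring
    simp only
    rw [h1, Real.sqrt_mul (sq_nonneg t), Real.sqrt_sq ht.le, mul_inv, mul_smul, smul_comm,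
      inv_smul_smul₀ ht.ne']

theorem localRep_smul (g : Metric d M) (f : UnitSphereBundle g → F) {c : M}
    {y : EuclideanSpace ℝ (Fin d)} (hy : y ∈ (extChartAt (𝓡∂ d) c).target) {t : ℝ} (ht : 0 < t)
    (w : EuclideanSpace ℝ (Fin d)) : localRep g f c (y, t • w) = localRep g f c (y, w) := by
  rw [localRep, Function.comp_apply, Function.comp_apply]
  change homExt g f ((tangentChart c).symm (y, t • w)) = homExt g f ((tangentChart c).symm (y, w))
  rw [tangentChart_symm (c := c) (q := (y, t • w)) hy, tangentChart_symm (c := c) (q := (y, w)) hy]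
  refine Eq.trans ?_ (homExt_smul g f ht _ _)
  exact congrArg (homExt g f) (congrArg (TotalSpace.mk _) (map_smul _ _ _))

theorem localRep_normalize (g : Metric d M) (f : UnitSphereBundle g → F) {c : M}
    {q : EuclideanSpace ℝ (Fin d) × EuclideanSpace ℝ (Fin d)} (hq : q ∈ nonzeroDomain c) :
    localRep g f c (q.1, normalize q.2) = localRep g f c q :=
  localRep_smul g f hq.1 (inv_pos.2 (norm_pos_iff.2 hq.2)) _

/-- The coordinates, over the compact set `K i` of the atlas, of the directions in which the
`C^k`-norm is evaluated. -/
def atlasSet (𝒜 : FiniteAtlas d M) (i : Fin 𝒜.N) :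
    Set (EuclideanSpace ℝ (Fin d) × EuclideanSpace ℝ (Fin d)) :=
  {q | q.1 ∈ extChartAt (𝓡∂ d) (𝒜.center i) '' 𝒜.K i ∧ ‖q.2‖ = 1}

theorem FiniteAtlas.K_subset_source (𝒜 : FiniteAtlas d M) (i : Fin 𝒜.N) :
    𝒜.K i ⊆ (extChartAt (𝓡∂ d) (𝒜.center i)).source := by
  rw [extChartAt_source]
  exact 𝒜.K_subset i

theorem isCompact_atlasSet (𝒜 : FiniteAtlas d M) (i : Fin 𝒜.N) : IsCompact (atlasSet 𝒜 i) := by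
  have h1 : IsCompact (extChartAt (𝓡∂ d) (𝒜.center i) '' 𝒜.K i) :=
    (𝒜.isCompact_K i).image_of_continuousOn
      ((continuousOn_extChartAt (𝒜.center i)).mono (𝒜.K_subset_source i))
  have h2 := h1.prod (isCompact_sphere (0 : EuclideanSpace ℝ (Fin d)) 1)
  convert h2 using 1
  ext q
  simp [atlasSet]

theorem atlasSet_subset (𝒜 : FiniteAtlas d M) (i : Fin 𝒜.N) :
    atlasSet 𝒜 i ⊆ nonzeroDomain (𝒜.center i) := by
  rintro q ⟨⟨x, hx, hxq⟩, h1⟩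
  refine ⟨?_, fun h => by simp [h] at h1⟩
  rw [← hxq]
  exact (extChartAt (𝓡∂ d) (𝒜.center i)).map_source (𝒜.K_subset_source i hx)

theorem exists_mem_atlasSet (g : Metric d M) (𝒜 : FiniteAtlas d M) (p : UnitSphereBundle g) :
    ∃ i, ∃ q ∈ atlasSet 𝒜 i, ∀ {F : Type} (f : UnitSphereBundle g → F)
      [NormedAddCommGroup F] [NormedSpace ℝ F], localRep g f (𝒜.center i) q = f p := by
  have h := 𝒜.cover.ge (mem_univ p.1.1)
  obtain ⟨i, hi⟩ := mem_iUnion.1 h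
  have hsrc := 𝒜.K_subset_source i hi
  have hmem := tangentChart_mem_nonzeroDomain hsrc (ne_zero_of_unit g p)
  refine ⟨i, ((tangentChart (𝒜.center i) p.1).1, normalize (tangentChart (𝒜.center i) p.1).2),
    ⟨⟨p.1.1, hi, by rw [tangentChart_apply]⟩, norm_normalize_eq_one_iff.2 hmem.2⟩, ?_⟩
  intro F f _ _
  rw [localRep_normalize g f hmem, localRep_tangentChart g f p hsrc]

theorem localRep_mem_range (g : Metric d M) (f : UnitSphereBundle g → F) {c : M}
    {q : EuclideanSpace ℝ (Fin d) × EuclideanSpace ℝ (Fin d)} (hq : q ∈ nonzeroDomain c) :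
    localRep g f c q ∈ range f := by
  rw [localRep_eq g f hq]
  exact mem_range_self _

theorem isCompact_range_of_smoothOnSM {F : Type} [NormedAddCommGroup F] [NormedSpace ℝ F]
    {g : Metric d M} (𝒜 : FiniteAtlas d M)
    {f : UnitSphereBundle g → F} (hf : SmoothOnSM g f) : IsCompact (range f) := by
  have h : range f = ⋃ i, localRep g f (𝒜.center i) '' atlasSet 𝒜 i := by
    refine subset_antisymm ?_ (iUnion_subset fun i => ?_)
    · rintro _ ⟨p, rfl⟩
      obtain ⟨i, q, hq, hqf⟩ := exists_mem_atlasSet g 𝒜 p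
      exact mem_iUnion.2 ⟨i, q, hq, hqf f⟩
    · rintro _ ⟨q, hq, rfl⟩
      exact localRep_mem_range g f (atlasSet_subset 𝒜 i hq)
  rw [h]
  exact isCompact_iUnion fun i => (isCompact_atlasSet 𝒜 i).image_of_continuousOn
    ((hf.contDiffOn _).continuousOn.mono (atlasSet_subset 𝒜 i))

theorem enorm_le_ckNorm (g : Metric d M) (𝒜 : FiniteAtlas d M) {k j : ℕ} (hj : j ≤ k)
    (f : UnitSphereBundle g → F) (i : Fin 𝒜.N)
    {q : EuclideanSpace ℝ (Fin d) × EuclideanSpace ℝ (Fin d)} (hq : q ∈ atlasSet 𝒜 i) :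
    ‖iteratedFDerivWithin ℝ j (localRep g f (𝒜.center i)) (range (𝓡∂ d).tangent) q‖ₑ ≤
      ckNorm g 𝒜 k f :=
  le_iSup_of_le i <| le_iSup_of_le j <| le_iSup_of_le hj <| le_iSup_of_le q <|
    le_iSup_of_le hq le_rfl

theorem ckNorm_le (g : Metric d M) (𝒜 : FiniteAtlas d M) {k : ℕ} {f : UnitSphereBundle g → F}
    {B : ℝ} (hB : ∀ i, ∀ j ≤ k, ∀ q ∈ atlasSet 𝒜 i,
      ‖iteratedFDerivWithin ℝ j (localRep g f (𝒜.center i)) (range (𝓡∂ d).tangent) q‖ ≤ B) :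
    ckNorm g 𝒜 k f ≤ ENNReal.ofReal B := by
  refine iSup_le fun i => iSup_le fun j => iSup_le fun hj => iSup_le fun q => iSup_le fun hq => ?_
  rw [← ofReal_norm]
  exact ENNReal.ofReal_le_ofReal (hB i j hj q hq)

theorem SmoothOnSM.ckNorm_ne_top {g : Metric d M} (𝒜 : FiniteAtlas d M) (k : ℕ)
    {f : UnitSphereBundle g → F} (hf : SmoothOnSM g f) : ckNorm g 𝒜 k f ≠ ⊤ := by
  choose C hC1 hC using fun i => (isRelOpen_nonzeroDomain
    (𝒜.center i)).exists_norm_iteratedFDerivWithin_le (uniqueDiffOn_range_tangent d)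
      (hf.contDiffOn _) (isCompact_atlasSet 𝒜 i) (atlasSet_subset 𝒜 i) k
  refine ((ckNorm_le g 𝒜 (B := ∑ i, C i) fun i j hj q hq => ?_).trans_lt
    ENNReal.ofReal_lt_top).ne
  exact (hC i j hj q hq).trans (Finset.single_le_sum (f := C)
    (fun i _ => zero_le_one.trans (hC1 i)) (Finset.mem_univ i))

theorem SmoothOnSM.norm_le_ckNorm {g : Metric d M} (𝒜 : FiniteAtlas d M) {k j : ℕ} (hj : j ≤ k)
    {f : UnitSphereBundle g → F} (hf : SmoothOnSM g f) (i : Fin 𝒜.N)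
    {q : EuclideanSpace ℝ (Fin d) × EuclideanSpace ℝ (Fin d)} (hq : q ∈ atlasSet 𝒜 i) :
    ‖iteratedFDerivWithin ℝ j (localRep g f (𝒜.center i)) (range (𝓡∂ d).tangent) q‖ ≤
      (ckNorm g 𝒜 k f).toReal := by
  have h := ENNReal.toReal_mono (hf.ckNorm_ne_top 𝒜 k) (enorm_le_ckNorm g 𝒜 hj f i hq)
  rwa [toReal_enorm] at h

theorem SmoothOnSM.norm_le_supNorm {F : Type} [NormedAddCommGroup F] [NormedSpace ℝ F]
    {g : Metric d M} (𝒜 : FiniteAtlas d M)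
    {f : UnitSphereBundle g → F} (hf : SmoothOnSM g f) (p : UnitSphereBundle g) :
    ‖f p‖ ≤ (supNorm g f).toReal := by
  obtain ⟨C, hC⟩ := (isCompact_range_of_smoothOnSM 𝒜 hf).isBounded.exists_norm_le
  have hfin : supNorm g f ≠ ⊤ := by
    refine ((iSup_le fun p => ?_).trans_lt (ENNReal.ofReal_lt_top (r := C))).ne
    rw [← ofReal_norm]
    exact ENNReal.ofReal_le_ofReal (hC _ (mem_range_self p))
  have h := ENNReal.toReal_mono hfin (le_iSup (fun p => ‖f p‖ₑ) p)
  rwa [toReal_enorm] at h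

theorem contDiffOn_normalize {E : Type*} [NormedAddCommGroup E] [InnerProductSpace ℝ E] :
    ContDiffOn ℝ ∞ (normalize : E → E) {0}ᶜ := fun _ hx =>
  (((contDiffAt_norm ℝ hx).inv (norm_ne_zero_iff.2 hx)).smul contDiffAt_id).contDiffWithinAt

/-- All finite atlases define equivalent norms: the derivatives of the coordinate representation
in any chart, over a compact set, are controlled by the `C^k`-norm. -/
theorem exists_norm_localRep_le [T2Space M] [CompactSpace M] (g : Metric d M)
    (𝒜 : FiniteAtlas d M) (c : M) {Q : Set (EuclideanSpace ℝ (Fin d) × EuclideanSpace ℝ (Fin d))}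
    (hQ : IsCompact Q) (hQc : Q ⊆ nonzeroDomain c) (k : ℕ) :
    ∃ C : ℝ, 1 ≤ C ∧ ∀ f : UnitSphereBundle g → F, SmoothOnSM g f → ∀ q ∈ Q, ∀ j ≤ k,
      ‖iteratedFDerivWithin ℝ j (localRep g f c) (range (𝓡∂ d).tangent) q‖ ≤
        C * (ckNorm g 𝒜 k f).toReal := by
  set S := range (𝓡∂ d).tangent with hS
  have hSu : UniqueDiffOn ℝ S := uniqueDiffOn_range_tangent d
  -- for each chart of the atlas, the part of `Q` over the compact set of that chart
  have key : ∀ i : Fin 𝒜.N, ∃ C : ℝ, 1 ≤ C ∧ ∀ f : UnitSphereBundle g → F, SmoothOnSM g f →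
      ∀ q ∈ Q, (extChartAt (𝓡∂ d) c).symm q.1 ∈ 𝒜.K i → ∀ j ≤ k,
      ‖iteratedFDerivWithin ℝ j (localRep g f c) S q‖ ≤ C * (ckNorm g 𝒜 k f).toReal := by
    intro i
    set c' := 𝒜.center i with hc'
    set O := ((extChartAt (𝓡∂ d) c).symm ≫ extChartAt (𝓡∂ d) c').source with hO
    set U : Set (EuclideanSpace ℝ (Fin d) × EuclideanSpace ℝ (Fin d)) :=
      {q | q.1 ∈ O ∧ q.2 ≠ 0} with hU
    have hUc : U ⊆ nonzeroDomain c := fun q hq => ⟨(mem_transition_source.1 hq.1).1, hq.2⟩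
    have hUrel : IsRelOpen S U := by
      refine ⟨hUc.trans (nonzeroDomain_subset_range c), fun q hq => ?_⟩
      have h1 : {x : EuclideanSpace ℝ (Fin d) × EuclideanSpace ℝ (Fin d) | x.1 ∈ O} ∈ 𝓝[S] q := by
        refine (continuousWithinAt_fst (s := S)).tendsto_nhdsWithin ?_
          (transition_source_mem_nhdsWithin hq.1)
        rw [hS, range_tangent]
        exact fun x hx => hx.1
      filter_upwards [h1, (isRelOpen_nonzeroDomain c).2 q (hUc hq)] with x hx hx'
      exact ⟨hx, hx'.2⟩
    set T := fun q : EuclideanSpace ℝ (Fin d) × EuclideanSpace ℝ (Fin d) =>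
      tangentChart c' ((tangentChart c).symm q) with hT
    have hTeq : ∀ q ∈ U, T q = (transition c c' q.1, transitionDeriv c c' q.1 q.2) :=
      fun q hq => tangentChart_tangentChart_symm hq.1
    have hTmem : ∀ q ∈ U, T q ∈ nonzeroDomain c' := by
      intro q hq
      refine tangentChart_mem_nonzeroDomain ?_ (tangentChart_symm_snd_ne_zero g (hUc hq))
      rw [tangentChart_symm (hUc hq).1]
      exact (mem_transition_source.1 hq.1).2
    have hTsmooth : ContDiffOn ℝ ∞ T U := by
      have hfst : ContDiffOn ℝ ∞
        (Prod.fst : EuclideanSpace ℝ (Fin d) × EuclideanSpace ℝ (Fin d) → _) U := contDiffOn_fst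
      have hsnd : ContDiffOn ℝ ∞
        (Prod.snd : EuclideanSpace ℝ (Fin d) × EuclideanSpace ℝ (Fin d) → _) U := contDiffOn_snd
      have hmaps : MapsTo Prod.fst U (range (𝓡∂ d)) := fun q hq =>
        range_of_transition_source hq.1
      refine ContDiffOn.congr (fun q hq => ?_) hTeq
      refine ((contDiffWithinAt_transition hq.1).comp q (hfst q hq) hmaps).prodMk
        (ContDiffWithinAt.clm_apply ?_ (hsnd q hq))
      exact ((contDiffWithinAt_transition hq.1).fderivWithin_right (m := ∞)
        (uniqueDiffOn_range_model d) (by simp) (hmaps hq)).comp q (hfst q hq) hmaps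
    -- the change of charts, followed by the normalization of the direction
    set T' := fun q => ((T q).1, normalize (T q).2) with hT'
    have hT'smooth : ContDiffOn ℝ ∞ T' U :=
      hTsmooth.fst.prodMk (contDiffOn_normalize.comp hTsmooth.snd fun q hq => (hTmem q hq).2)
    have hT'mem : MapsTo T' U (nonzeroDomain c') := fun q hq =>
      ⟨(hTmem q hq).1, fun h => (hTmem q hq).2 ((normalize_eq_zero_iff _).1 h)⟩
    set Q' := {q ∈ Q | (extChartAt (𝓡∂ d) c).symm q.1 ∈ 𝒜.K i} with hQ'
    have hQ'U : Q' ⊆ U := fun q hq =>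
      ⟨mem_transition_source.2 ⟨(hQc hq.1).1, 𝒜.K_subset_source i hq.2⟩, (hQc hq.1).2⟩
    have hQ'c : IsCompact Q' := by
      have h1 : ContinuousOn (fun q : EuclideanSpace ℝ (Fin d) × EuclideanSpace ℝ (Fin d) =>
          (extChartAt (𝓡∂ d) c).symm q.1) Q :=
        (continuousOn_extChartAt_symm c).comp continuousOn_fst fun q hq => (hQc hq).1
      exact hQ.of_isClosed_subset
        (h1.preimage_isClosed_of_isClosed hQ.isClosed (𝒜.isCompact_K i).isClosed)
        fun q hq => hq.1
    obtain ⟨C, hC1, hC⟩ := hUrel.exists_norm_iteratedFDerivWithin_comp_le (F := F) hSu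
      (isRelOpen_nonzeroDomain c') hSu hT'smooth hT'mem hQ'c hQ'U k
    refine ⟨C, hC1, fun f hf q hq hqK j hj => ?_⟩
    have hqU := hQ'U ⟨hq, hqK⟩
    have h1 := hC (localRep g f c') (hf.contDiffOn c') q ⟨hq, hqK⟩ (ckNorm g 𝒜 k f).toReal
      (fun l hl => hf.norm_le_ckNorm 𝒜 hl i (q := T' q) ?_) j hj
    · rw [← hUrel.iteratedFDerivWithin_eq hqU] at h1 ⊢
      refine le_of_eq_of_le ?_ h1
      congr 1
      refine iteratedFDerivWithin_congr (fun x hx => ?_) hqU j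
      exact ((localRep_normalize g f (hTmem x hx)).trans (localRep_transition g f hx.1)).symm
    · refine ⟨⟨_, hqK, ?_⟩, norm_normalize_eq_one_iff.2 (hTmem q hqU).2⟩
      change _ = (T q).1
      rw [hTeq q hqU]
      rfl
  choose C hC1 hC using key
  refine ⟨1 + ∑ i, C i, le_add_of_nonneg_right (Finset.sum_nonneg fun i _ =>
    zero_le_one.trans (hC1 i)), fun f hf q hq j hj => ?_⟩
  obtain ⟨i, hi⟩ := mem_iUnion.1 (𝒜.cover.ge (mem_univ ((extChartAt (𝓡∂ d) c).symm q.1)))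
  refine (hC i f hf q hq hi j hj).trans (mul_le_mul_of_nonneg_right ?_ ENNReal.toReal_nonneg)
  have := Finset.single_le_sum (f := C) (fun i _ => zero_le_one.trans (hC1 i)) (Finset.mem_univ i)
  linarith

end Norms

/-! ### An embedding of the unit sphere bundle in a vector space -/

section Embedding

/-- A finite family of charts of `M` with bump functions, the sets where these are equal to one
covering `M`. -/
structure BumpCover (d : ℕ) [NeZero d] (M : Type*) [TopologicalSpace M]
    [ChartedSpace (EuclideanHalfSpace d) M] where
  /-- the number of charts -/
  N : ℕ
  /-- the point at which the chart is centred -/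
  center : Fin N → M
  /-- the bump function in the chart -/
  bump : ∀ i, SmoothBumpFunction (𝓡∂ d) (center i)
  cover : ∀ x, ∃ i, bump i x = 1

variable {d : ℕ} [NeZero d]
  {M : Type*} [TopologicalSpace M] [ChartedSpace (EuclideanHalfSpace d) M]

theorem BumpCover.nonempty (d : ℕ) [NeZero d] (M : Type*) [TopologicalSpace M]
    [ChartedSpace (EuclideanHalfSpace d) M] [CompactSpace M] : Nonempty (BumpCover d M) := by
  let u : ∀ x : M, SmoothBumpFunction (𝓡∂ d) x := fun x => Classical.choice inferInstance
  have hu : ∀ x : M, {y | u x y = 1} ∈ 𝓝 x := fun x => (u x).eventuallyEq_one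
  obtain ⟨t, -, ht⟩ := isCompact_univ.elim_nhds_subcover (fun x => {y | u x y = 1}) fun x _ => hu x
  refine ⟨⟨t.card, fun i => (t.equivFin.symm i : M), fun i => u _, fun x => ?_⟩⟩
  obtain ⟨y, hy, hx⟩ := mem_iUnion₂.1 (ht (mem_univ x))
  refine ⟨t.equivFin ⟨y, hy⟩, ?_⟩
  rw [Equiv.symm_apply_apply]
  exact hx

/-- The cutoff function `σ(3 u_i - k)`, for a smooth step function `σ` which increases from `0` to
`1` on `[0, 1]`. For `k = 2, 1, 0` the supports of these functions increase, and each of them is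
equal to one on the support of the preceding one. -/
def BumpCover.cutoff (𝓑 : BumpCover d M) (k : ℕ) (i : Fin 𝓑.N) (x : M) : ℝ :=
  Real.smoothTransition (3 * 𝓑.bump i x - k)

theorem BumpCover.cutoff_eq_one (𝓑 : BumpCover d M) {k l : ℕ} (hkl : k < l) {i : Fin 𝓑.N} {x : M}
    (h : 𝓑.cutoff l i x ≠ 0) : 𝓑.cutoff k i x = 1 := by
  refine Real.smoothTransition.one_of_one_le ?_
  by_contra! hlt
  have hkl' : (k : ℝ) + 1 ≤ l := mod_cast hkl
  exact h (Real.smoothTransition.zero_of_nonpos (by linarith))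

theorem BumpCover.cutoff_eq_zero (𝓑 : BumpCover d M) (k : ℕ) {i : Fin 𝓑.N} {x : M}
    (hx : 𝓑.bump i x = 0) : 𝓑.cutoff k i x = 0 := by
  refine Real.smoothTransition.zero_of_nonpos ?_
  rw [hx, mul_zero, zero_sub]
  exact neg_nonpos.2 (Nat.cast_nonneg k)

theorem BumpCover.mem_source (𝓑 : BumpCover d M) {k : ℕ} {i : Fin 𝓑.N} {x : M}
    (h : 𝓑.cutoff k i x ≠ 0) : x ∈ (extChartAt (𝓡∂ d) (𝓑.center i)).source := by
  rw [extChartAt_source]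
  exact (𝓑.bump i).support_subset_source fun h0 => h (𝓑.cutoff_eq_zero k h0)

theorem BumpCover.exists_cutoff_eq_one (𝓑 : BumpCover d M) (x : M) :
    ∃ i, 𝓑.cutoff 2 i x = 1 := by
  obtain ⟨i, hi⟩ := 𝓑.cover x
  refine ⟨i, Real.smoothTransition.one_of_one_le ?_⟩
  rw [hi]
  norm_num

theorem BumpCover.cutoff_nonneg (𝓑 : BumpCover d M) (k : ℕ) (i : Fin 𝓑.N) (x : M) :
    0 ≤ 𝓑.cutoff k i x := Real.smoothTransition.nonneg _

theorem BumpCover.sum_cutoff_pos (𝓑 : BumpCover d M) (x : M) : 0 < ∑ i, 𝓑.cutoff 2 i x := by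
  obtain ⟨i, hi⟩ := 𝓑.exists_cutoff_eq_one x
  exact Finset.sum_pos' (fun i _ => 𝓑.cutoff_nonneg 2 i x)
    ⟨i, Finset.mem_univ i, by rw [hi]; exact zero_lt_one⟩

/-- A partition of unity subordinate to the charts of the cover. -/
def BumpCover.weight (𝓑 : BumpCover d M) (i : Fin 𝓑.N) (x : M) : ℝ :=
  𝓑.cutoff 2 i x / ∑ j, 𝓑.cutoff 2 j x

theorem BumpCover.sum_weight (𝓑 : BumpCover d M) (x : M) : ∑ i, 𝓑.weight i x = 1 := by
  simp only [BumpCover.weight, ← Finset.sum_div]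
  exact div_self (𝓑.sum_cutoff_pos x).ne'

theorem BumpCover.weight_nonneg (𝓑 : BumpCover d M) (i : Fin 𝓑.N) (x : M) : 0 ≤ 𝓑.weight i x :=
  div_nonneg (𝓑.cutoff_nonneg 2 i x) (𝓑.sum_cutoff_pos x).le

theorem BumpCover.weight_le_one (𝓑 : BumpCover d M) (i : Fin 𝓑.N) (x : M) : 𝓑.weight i x ≤ 1 := by
  rw [← 𝓑.sum_weight x]
  exact Finset.single_le_sum (f := fun i => 𝓑.weight i x) (fun i _ => 𝓑.weight_nonneg i x)
    (Finset.mem_univ i)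

theorem BumpCover.cutoff_ne_zero_of_weight (𝓑 : BumpCover d M) {i : Fin 𝓑.N} {x : M}
    (h : 𝓑.weight i x ≠ 0) : 𝓑.cutoff 2 i x ≠ 0 := fun h0 => h (by simp [BumpCover.weight, h0])

variable [IsManifold (𝓡∂ d) ∞ M] [T2Space M]

theorem BumpCover.contMDiff_cutoff (𝓑 : BumpCover d M) (k : ℕ) (i : Fin 𝓑.N) :
    ContMDiff (𝓡∂ d) 𝓘(ℝ, ℝ) ∞ (𝓑.cutoff k i) := by
  have h : ContDiff ℝ ∞ fun t : ℝ => Real.smoothTransition (3 * t - k) :=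
    Real.smoothTransition.contDiff.comp ((contDiff_const.mul contDiff_id).sub contDiff_const)
  exact h.contMDiff.comp (𝓑.bump i).contMDiff

theorem BumpCover.contMDiff_weight (𝓑 : BumpCover d M) (i : Fin 𝓑.N) :
    ContMDiff (𝓡∂ d) 𝓘(ℝ, ℝ) ∞ (𝓑.weight i) :=
  (𝓑.contMDiff_cutoff 2 i).div₀ (ContMDiff.sum fun j _ => 𝓑.contMDiff_cutoff 2 j)
    fun x => (𝓑.sum_cutoff_pos x).ne'

theorem BumpCover.eventually_cutoff_eq_zero (𝓑 : BumpCover d M) (k : ℕ) {i : Fin 𝓑.N} {x : M}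
    (hx : x ∉ tsupport (𝓑.bump i)) : ∀ᶠ y in 𝓝 x, 𝓑.cutoff k i y = 0 :=
  (notMem_tsupport_iff_eventuallyEq.1 hx).mono fun _ hy => 𝓑.cutoff_eq_zero k hy

theorem BumpCover.tsupport_subset (𝓑 : BumpCover d M) (i : Fin 𝓑.N) :
    tsupport (𝓑.bump i) ⊆ (extChartAt (𝓡∂ d) (𝓑.center i)).source :=
  (𝓑.bump i).tsupport_subset_extChartAt_source

/-- The space in which the unit sphere bundle is embedded. -/
abbrev BumpCover.ambient (𝓑 : BumpCover d M) : Type :=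
  Fin 𝓑.N → EuclideanSpace ℝ (Fin d) × EuclideanSpace ℝ (Fin d)

/-- The embedding of the unit sphere bundle in a vector space: the cut-off coordinates, in all
charts, of the base point and of the direction of the vector. The cutoff for the direction is
stronger than that for the base point; hence the base point can be recovered from a component
whose direction is not zero. -/
def BumpCover.embed (𝓑 : BumpCover d M) (g : Metric d M) (p : UnitSphereBundle g) : 𝓑.ambient :=
  fun i => (𝓑.cutoff 0 i p.1.1 • (tangentChart (𝓑.center i) p.1).1,
    𝓑.cutoff 1 i p.1.1 • normalize (tangentChart (𝓑.center i) p.1).2)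

theorem homExt_embed (𝓑 : BumpCover d M) (g : Metric d M) {p : TangentBundle (𝓡∂ d) M}
    (hp : p.2 ≠ 0) :
    homExt g (𝓑.embed g) p = fun i => (𝓑.cutoff 0 i p.1 • (tangentChart (𝓑.center i) p).1,
      𝓑.cutoff 1 i p.1 • normalize (tangentChart (𝓑.center i) p).2) := by
  rw [homExt, dif_pos hp]
  funext i
  have h1 : (tangentChart (𝓑.center i) (toUnit g p hp).1).1 = (tangentChart (𝓑.center i) p).1 := by
    rw [tangentChart_apply, tangentChart_apply]
    rfl
  have h2 : (tangentChart (𝓑.center i) (toUnit g p hp).1).2 =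
      (√(g.inner p.1 p.2 p.2))⁻¹ • (tangentChart (𝓑.center i) p).2 := by
    rw [tangentChart_apply, tangentChart_apply]
    exact map_smul (tangentCoordChange (𝓡∂ d) p.1 (𝓑.center i) p.1) _ _
  rw [BumpCover.embed, h1, h2,
    normalize_smul_of_pos (inv_pos.2 (Real.sqrt_pos.2 (g.pos p.1 p.2 hp)))]
  rfl

theorem smoothOnSM_embed (𝓑 : BumpCover d M) (g : Metric d M) : SmoothOnSM g (𝓑.embed g) := by
  intro p hp
  refine ContMDiffWithinAt.congr ?_ (fun x hx => homExt_embed 𝓑 g hx) (homExt_embed 𝓑 g hp)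
  refine contMDiffWithinAt_pi_space.2 fun i => ContMDiffAt.contMDiffWithinAt ?_
  have hproj : ContMDiffAt (𝓡∂ d).tangent (𝓡∂ d) ∞
      (fun p : TangentBundle (𝓡∂ d) M => p.1) p := (contMDiff_proj _).contMDiffAt
  have hcut : ∀ k, ContMDiffAt (𝓡∂ d).tangent 𝓘(ℝ, ℝ) ∞
      (fun p : TangentBundle (𝓡∂ d) M => 𝓑.cutoff k i p.1) p := fun k =>
    (𝓑.contMDiff_cutoff k i).contMDiffAt.comp p hproj
  by_cases hs : p.1 ∈ (extChartAt (𝓡∂ d) (𝓑.center i)).source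
  · have hT : ContMDiffAt (𝓡∂ d).tangent
        𝓘(ℝ, EuclideanSpace ℝ (Fin d) × EuclideanSpace ℝ (Fin d)) ∞ (tangentChart (𝓑.center i)) p :=
      contMDiffAt_extChartAt' (by
        rw [← extChartAt_source (𝓡∂ d).tangent]
        exact mem_tangentChart_source.2 hs)
    have hT1 := contDiff_fst.contMDiff.contMDiffAt.comp p hT
    have hT2 := contDiff_snd.contMDiff.contMDiffAt.comp p hT
    have hn : ContMDiffAt 𝓘(ℝ, EuclideanSpace ℝ (Fin d)) 𝓘(ℝ, EuclideanSpace ℝ (Fin d)) ∞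
        NormedSpace.normalize (tangentChart (𝓑.center i) p).2 :=
      (contDiffOn_normalize.contDiffAt (isOpen_compl_singleton.mem_nhds
        (tangentChart_mem_nonzeroDomain hs hp).2)).contMDiffAt
    have hn' := ContMDiffAt.comp p (f := fun x => (tangentChart (𝓑.center i) x).2) hn hT2
    exact ((hcut 0).smul hT1).prodMk_space ((hcut 1).smul hn')
  · have h0 : p.1 ∉ tsupport (𝓑.bump i) := fun h => hs (𝓑.tsupport_subset i h)
    refine (contMDiffAt_const (c := (0 : EuclideanSpace ℝ (Fin d) × EuclideanSpace ℝ (Fin d)))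
      ).congr_of_eventuallyEq ?_
    have hc := hproj.continuousAt
    filter_upwards [hc.eventually (𝓑.eventually_cutoff_eq_zero 0 h0),
      hc.eventually (𝓑.eventually_cutoff_eq_zero 1 h0)] with x hx hx'
    rw [hx, hx', zero_smul, zero_smul]
    rfl

end Embedding

/-! ### Extension of functions from the embedded unit sphere bundle -/

section Extension

/-- The coordinate on `TM`, in charts, which vanishes over the boundary and is positive inside. -/
def boundaryCoord (d : ℕ) [NeZero d] :
    EuclideanSpace ℝ (Fin d) × EuclideanSpace ℝ (Fin d) →L[ℝ] ℝ :=
  (EuclideanSpace.proj (0 : Fin d)).comp (ContinuousLinearMap.fst ℝ _ _)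

/-- A vector transversal to the boundary. -/
def inwardVector (d : ℕ) [NeZero d] : EuclideanSpace ℝ (Fin d) × EuclideanSpace ℝ (Fin d) :=
  (EuclideanSpace.single 0 1, 0)

theorem boundaryCoord_apply (d : ℕ) [NeZero d]
    (q : EuclideanSpace ℝ (Fin d) × EuclideanSpace ℝ (Fin d)) : boundaryCoord d q = q.1 0 := rfl

theorem boundaryCoord_inwardVector (d : ℕ) [NeZero d] :
    boundaryCoord d (inwardVector d) = 1 := by
  simp [boundaryCoord_apply, inwardVector]

theorem range_tangent_eq (d : ℕ) [NeZero d] :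
    range (𝓡∂ d).tangent = {q | 0 ≤ boundaryCoord d q} := by
  rw [range_tangent, range_model]
  ext q
  simp [boundaryCoord_apply]

/-- A smooth cutoff function on the space of directions which is equal to one on the unit sphere
and vanishes near the origin and near infinity. -/
def directionCutoff {d : ℕ} (w : EuclideanSpace ℝ (Fin d)) : ℝ :=
  (⟨1 / 4, 1 / 2, by norm_num, by norm_num⟩ : ContDiffBump (1 : ℝ)) (‖w‖ ^ 2)

theorem contDiff_directionCutoff {d : ℕ} : ContDiff ℝ ∞ (directionCutoff (d := d)) :=
  (ContDiffBump.contDiff _).comp (contDiff_norm_sq ℝ)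

theorem directionCutoff_of_norm_eq_one {d : ℕ} {w : EuclideanSpace ℝ (Fin d)} (hw : ‖w‖ = 1) :
    directionCutoff w = 1 := by
  refine ContDiffBump.one_of_mem_closedBall _ ?_
  rw [hw, one_pow]
  exact Metric.mem_closedBall_self (by norm_num)

theorem directionCutoff_of_notMem {d : ℕ} {w : EuclideanSpace ℝ (Fin d)}
    (hw : ‖w‖ ^ 2 ∉ Icc (1 / 2 : ℝ) (3 / 2)) : directionCutoff w = 0 := by
  refine ContDiffBump.zero_of_le_dist _ ?_
  change 1 / 2 ≤ dist _ _
  by_contra! h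
  rw [Real.dist_eq, abs_lt] at h
  exact hw ⟨by linarith [h.1], by linarith [h.2]⟩

theorem directionCutoff_mem_Icc {d : ℕ} (w : EuclideanSpace ℝ (Fin d)) :
    directionCutoff w ∈ Icc (0 : ℝ) 1 :=
  ⟨ContDiffBump.nonneg _, ContDiffBump.le_one _⟩

variable {d : ℕ} [NeZero d]
  {M : Type*} [TopologicalSpace M] [ChartedSpace (EuclideanHalfSpace d) M]
  [IsManifold (𝓡∂ d) ∞ M]
  {F : Type} [NormedAddCommGroup F] [NormedSpace ℝ F]
  {F' : Type} [NormedAddCommGroup F'] [NormedSpace ℝ F']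

open Classical in
/-- The part of `f` over the `i`-th chart, in coordinates. -/
def BumpCover.piece (𝓑 : BumpCover d M) (g : Metric d M) (f : UnitSphereBundle g → F)
    (i : Fin 𝓑.N) (q : EuclideanSpace ℝ (Fin d) × EuclideanSpace ℝ (Fin d)) : F :=
  if q.1 ∈ (extChartAt (𝓡∂ d) (𝓑.center i)).target then
    (𝓑.weight i ((extChartAt (𝓡∂ d) (𝓑.center i)).symm q.1) * directionCutoff q.2) •
      localRep g f (𝓑.center i) q
  else 0

/-- The extension of functions from the unit sphere bundle to the ambient space: the sum, over the
charts, of the Seeley extensions of the parts of the function. -/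
def BumpCover.extension (𝓑 : BumpCover d M) (g : Metric d M) (a : ℕ → ℝ)
    (f : UnitSphereBundle g → F) (z : 𝓑.ambient) : F :=
  ∑ i, halfSpaceExt (boundaryCoord d) (inwardVector d) a (𝓑.piece g f i) (z i)

/-- The component of a unit vector in the `i`-th factor is its coordinate vector wherever the weight
does not vanish; elsewhere the cutoffs make both sides zero. -/
theorem BumpCover.piece_embed (𝓑 : BumpCover d M) (g : Metric d M) (f : UnitSphereBundle g → F)
    (i : Fin 𝓑.N) (p : UnitSphereBundle g) :
    𝓑.piece g f i (𝓑.embed g p i) = 𝓑.weight i p.1.1 • f p := by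
  have hp0 := ne_zero_of_unit g p
  by_cases h1 : 𝓑.cutoff 1 i p.1.1 = 0
  · have hw : 𝓑.weight i p.1.1 = 0 := by
      by_contra hw
      have := 𝓑.cutoff_eq_one one_lt_two (𝓑.cutoff_ne_zero_of_weight hw)
      exact one_ne_zero (this.symm.trans h1)
    have hd : directionCutoff (𝓑.embed g p i).2 = 0 := by
      refine directionCutoff_of_notMem ?_
      rw [BumpCover.embed, h1, zero_smul, norm_zero]
      norm_num
    rw [BumpCover.piece, hd, hw, mul_zero, zero_smul, zero_smul, ite_self]
  · have h0 := 𝓑.cutoff_eq_one zero_lt_one h1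
    have hsrc := 𝓑.mem_source h1
    have hfst : (𝓑.embed g p i).1 = extChartAt (𝓡∂ d) (𝓑.center i) p.1.1 := by
      rw [BumpCover.embed, h0, one_smul, tangentChart_apply]
    have htar : (𝓑.embed g p i).1 ∈ (extChartAt (𝓡∂ d) (𝓑.center i)).target := by
      rw [hfst]
      exact (extChartAt (𝓡∂ d) (𝓑.center i)).map_source hsrc
    rw [BumpCover.piece, if_pos htar]
    rw [show (extChartAt (𝓡∂ d) (𝓑.center i)).symm (𝓑.embed g p i).1 = p.1.1 by
      rw [hfst, (extChartAt (𝓡∂ d) (𝓑.center i)).left_inv hsrc]]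
    by_cases hw : 𝓑.weight i p.1.1 = 0
    · rw [hw, zero_mul, zero_smul, zero_smul]
    · have h1' := 𝓑.cutoff_eq_one one_lt_two (𝓑.cutoff_ne_zero_of_weight hw)
      have hmem := tangentChart_mem_nonzeroDomain hsrc hp0
      have hq : 𝓑.embed g p i = ((tangentChart (𝓑.center i) p.1).1,
          normalize (tangentChart (𝓑.center i) p.1).2) := by
        rw [BumpCover.embed, h0, h1', one_smul, one_smul]
      rw [hq, localRep_normalize g f hmem, localRep_tangentChart g f p hsrc,
        directionCutoff_of_norm_eq_one (norm_normalize_eq_one_iff.2 hmem.2), mul_one]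

theorem BumpCover.boundaryCoord_embed_nonneg (𝓑 : BumpCover d M) (g : Metric d M)
    (p : UnitSphereBundle g) (i : Fin 𝓑.N) : 0 ≤ boundaryCoord d (𝓑.embed g p i) := by
  have h : (tangentChart (𝓑.center i) p.1).1 ∈ range (𝓡∂ d) := by
    rw [tangentChart_apply]
    exact mem_range_self _
  rw [range_model] at h
  exact mul_nonneg (𝓑.cutoff_nonneg 0 i _) h

theorem BumpCover.extension_embed (𝓑 : BumpCover d M) (g : Metric d M) (a : ℕ → ℝ)
    (f : UnitSphereBundle g → F) (p : UnitSphereBundle g) :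
    𝓑.extension g a f (𝓑.embed g p) = f p := by
  rw [BumpCover.extension]
  simp_rw [halfSpaceExt_of_nonneg a _ (𝓑.boundaryCoord_embed_nonneg g p _), 𝓑.piece_embed g f,
    ← Finset.sum_smul, 𝓑.sum_weight, one_smul]

/-- A compact set which carries the parts of functions over the `i`-th chart. -/
def BumpCover.support (𝓑 : BumpCover d M) (i : Fin 𝓑.N) :
    Set (EuclideanSpace ℝ (Fin d) × EuclideanSpace ℝ (Fin d)) :=
  (extChartAt (𝓡∂ d) (𝓑.center i) '' tsupport (𝓑.bump i)) ×ˢ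
    {w | ‖w‖ ^ 2 ∈ Icc (1 / 2 : ℝ) (3 / 2)}

theorem norm_piece_le (𝓑 : BumpCover d M) (g : Metric d M) {f : UnitSphereBundle g → F} {B : ℝ}
    (hB0 : 0 ≤ B) (hB : ∀ p, ‖f p‖ ≤ B) (i : Fin 𝓑.N)
    (q : EuclideanSpace ℝ (Fin d) × EuclideanSpace ℝ (Fin d)) : ‖𝓑.piece g f i q‖ ≤ B := by
  rw [BumpCover.piece]
  split_ifs with hq
  · by_cases hw : q.2 = 0
    · rw [directionCutoff_of_notMem (by rw [hw]; norm_num), mul_zero, zero_smul, norm_zero]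
      exact hB0
    · obtain ⟨p, hp⟩ := localRep_mem_range g f (c := 𝓑.center i) (q := q) ⟨hq, hw⟩
      have hd := directionCutoff_mem_Icc q.2
      have h1 := 𝓑.weight_nonneg i ((extChartAt (𝓡∂ d) (𝓑.center i)).symm q.1)
      have h2 := 𝓑.weight_le_one i ((extChartAt (𝓡∂ d) (𝓑.center i)).symm q.1)
      rw [norm_smul, ← hp, Real.norm_eq_abs, abs_of_nonneg (mul_nonneg h1 hd.1)]
      exact (mul_le_mul (mul_le_one₀ h2 hd.1 hd.2) (hB p) (norm_nonneg _) zero_le_one).trans_eq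
        (one_mul B)
  · rw [norm_zero]
    exact hB0

theorem piece_comp_left (𝓑 : BumpCover d M) (g : Metric d M) (f : UnitSphereBundle g → F)
    (Θ : F →L[ℝ] F') (i : Fin 𝓑.N)
    (q : EuclideanSpace ℝ (Fin d) × EuclideanSpace ℝ (Fin d)) :
    𝓑.piece g (fun p => Θ (f p)) i q = Θ (𝓑.piece g f i q) := by
  rw [BumpCover.piece, BumpCover.piece]
  split_ifs with hq
  · by_cases hw : q.2 = 0
    · rw [directionCutoff_of_notMem (by rw [hw]; norm_num), mul_zero, zero_smul, zero_smul,
        map_zero]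
    · rw [localRep_comp g f Θ (c := 𝓑.center i) (q := q) ⟨hq, hw⟩, map_smul]
  · rw [map_zero]

theorem extension_comp_left (𝓑 : BumpCover d M) (g : Metric d M) {a : ℕ → ℝ}
    (ha : IsSeeleySequence a) [CompleteSpace F] {f : UnitSphereBundle g → F} {B : ℝ} (hB0 : 0 ≤ B)
    (hB : ∀ p, ‖f p‖ ≤ B) (Θ : F →L[ℝ] F') (z : 𝓑.ambient) :
    𝓑.extension g a (fun p => Θ (f p)) z = Θ (𝓑.extension g a f z) := by
  rw [BumpCover.extension, BumpCover.extension, map_sum]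
  refine Finset.sum_congr rfl fun i _ => ?_
  rw [← ha.halfSpaceExt_comp_left (boundaryCoord_inwardVector d)
    (fun q _ => norm_piece_le 𝓑 g hB0 hB i q)]
  exact congrArg (fun h => halfSpaceExt _ _ a h (z i)) (funext (piece_comp_left 𝓑 g f Θ i))

variable [T2Space M]

theorem isCompact_support (𝓑 : BumpCover d M) (i : Fin 𝓑.N) : IsCompact (𝓑.support i) := by
  refine ((𝓑.bump i).hasCompactSupport.isCompact.image_of_continuousOn
    ((continuousOn_extChartAt _).mono (𝓑.tsupport_subset i))).prod ?_
  refine Metric.isCompact_of_isClosed_isBounded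
    (isClosed_Icc.preimage (continuous_norm.pow 2)) ?_
  refine (Metric.isBounded_closedBall (x := (0 : EuclideanSpace ℝ (Fin d))) (r := 2)).subset ?_
  intro w hw
  rw [mem_closedBall_zero_iff]
  have : ‖w‖ ^ 2 ≤ 3 / 2 := hw.2
  nlinarith [norm_nonneg w]

theorem support_subset_nonzeroDomain (𝓑 : BumpCover d M) (i : Fin 𝓑.N) :
    𝓑.support i ⊆ nonzeroDomain (𝓑.center i) := by
  rintro q ⟨⟨x, hx, hxq⟩, hw⟩
  refine ⟨?_, fun h => ?_⟩
  · rw [← hxq]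
    exact (extChartAt (𝓡∂ d) (𝓑.center i)).map_source (𝓑.tsupport_subset i hx)
  · rw [h] at hw
    norm_num at hw

theorem piece_eventuallyEq_zero (𝓑 : BumpCover d M) (g : Metric d M) (f : UnitSphereBundle g → F)
    {i : Fin 𝓑.N} {q : EuclideanSpace ℝ (Fin d) × EuclideanSpace ℝ (Fin d)}
    (hq : q ∉ 𝓑.support i) : 𝓑.piece g f i =ᶠ[𝓝 q] fun _ => 0 := by
  filter_upwards [(isCompact_support 𝓑 i).isClosed.isOpen_compl.mem_nhds hq] with x hx
  rw [BumpCover.piece]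
  split_ifs with htar
  · by_cases hw : ‖x.2‖ ^ 2 ∈ Icc (1 / 2 : ℝ) (3 / 2)
    · have h0 : 𝓑.weight i ((extChartAt (𝓡∂ d) (𝓑.center i)).symm x.1) = 0 := by
        by_contra h
        refine hx ⟨⟨(extChartAt (𝓡∂ d) (𝓑.center i)).symm x.1, subset_tsupport _ fun h' => ?_,
          (extChartAt (𝓡∂ d) (𝓑.center i)).right_inv htar⟩, hw⟩
        exact 𝓑.cutoff_ne_zero_of_weight h (𝓑.cutoff_eq_zero 2 h')
      rw [h0, zero_mul, zero_smul]
    · rw [directionCutoff_of_notMem hw, mul_zero, zero_smul]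
  · rfl

theorem contDiffOn_weight (𝓑 : BumpCover d M) (i : Fin 𝓑.N) :
    ContDiffOn ℝ ∞ (fun q : EuclideanSpace ℝ (Fin d) × EuclideanSpace ℝ (Fin d) =>
      𝓑.weight i ((extChartAt (𝓡∂ d) (𝓑.center i)).symm q.1) * directionCutoff q.2)
      (nonzeroDomain (𝓑.center i)) := by
  have h1 : ContDiffOn ℝ ∞ (fun y => 𝓑.weight i ((extChartAt (𝓡∂ d) (𝓑.center i)).symm y))
      (extChartAt (𝓡∂ d) (𝓑.center i)).target :=
    contMDiffOn_iff_contDiffOn.1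
      ((𝓑.contMDiff_weight i).comp_contMDiffOn (contMDiffOn_extChartAt_symm (𝓑.center i)))
  exact (h1.comp contDiffOn_fst fun q hq => hq.1).mul
    (contDiff_directionCutoff.comp_contDiffOn contDiffOn_snd)

theorem contDiffOn_piece (𝓑 : BumpCover d M) {g : Metric d M} {f : UnitSphereBundle g → F}
    (hf : SmoothOnSM g f) (i : Fin 𝓑.N) :
    ContDiffOn ℝ ∞ (𝓑.piece g f i) (range (𝓡∂ d).tangent) := by
  intro q hq
  by_cases hs : q ∈ 𝓑.support i
  · have hD := support_subset_nonzeroDomain 𝓑 i hs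
    have h1 := ((contDiffOn_weight 𝓑 i).smul (hf.contDiffOn (𝓑.center i))) q hD
    refine ContDiffWithinAt.mono_of_mem_nhdsWithin (h1.congr (fun x hx => ?_) ?_)
      (nonzeroDomain_mem_nhdsWithin hD)
    · exact if_pos hx.1
    · exact if_pos hD.1
  · exact (contDiffAt_const.congr_of_eventuallyEq
      (piece_eventuallyEq_zero 𝓑 g f hs)).contDiffWithinAt

variable [CompactSpace M]

theorem exists_norm_iteratedFDerivWithin_piece_le (𝓑 : BumpCover d M) (g : Metric d M)
    (𝒜 : FiniteAtlas d M) (i : Fin 𝓑.N) (k : ℕ) :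
    ∃ C : ℝ, 1 ≤ C ∧ ∀ f : UnitSphereBundle g → F, SmoothOnSM g f →
      ∀ q ∈ range (𝓡∂ d).tangent, ∀ j ≤ k,
      ‖iteratedFDerivWithin ℝ j (𝓑.piece g f i) (range (𝓡∂ d).tangent) q‖ ≤
        C * (ckNorm g 𝒜 k f).toReal := by
  obtain ⟨C₁, hC₁, h₁⟩ := exists_norm_localRep_le (F := F) g 𝒜 (𝓑.center i)
    (isCompact_support 𝓑 i) (support_subset_nonzeroDomain 𝓑 i) k
  obtain ⟨C₂, hC₂, h₂⟩ := (isRelOpen_nonzeroDomain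
    (𝓑.center i)).exists_norm_iteratedFDerivWithin_smul_le (F := F) (uniqueDiffOn_range_tangent d)
      (contDiffOn_weight 𝓑 i) (isCompact_support 𝓑 i) (support_subset_nonzeroDomain 𝓑 i) k
  refine ⟨C₂ * C₁, one_le_mul_of_one_le_of_one_le hC₂ hC₁, fun f hf q hq j hj => ?_⟩
  by_cases hs : q ∈ 𝓑.support i
  · have hD := support_subset_nonzeroDomain 𝓑 i hs
    have h := h₂ _ (hf.contDiffOn _) q hs _ (h₁ f hf q hs) j hj
    rw [← mul_assoc] at h
    refine le_of_eq_of_le ?_ h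
    rw [← (isRelOpen_nonzeroDomain _).iteratedFDerivWithin_eq hD,
      ← (isRelOpen_nonzeroDomain _).iteratedFDerivWithin_eq hD]
    exact congrArg _ (iteratedFDerivWithin_congr (fun x hx => if_pos hx.1) hD j)
  · have h0 := piece_eventuallyEq_zero 𝓑 g f hs
    rw [(h0.filter_mono nhdsWithin_le_nhds).iteratedFDerivWithin_eq h0.self_of_nhds j,
      iteratedFDerivWithin_fun_zero, Pi.zero_apply, norm_zero]
    exact mul_nonneg (zero_le_one.trans (one_le_mul_of_one_le_of_one_le hC₂ hC₁))
      ENNReal.toReal_nonneg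

theorem boundedSmooth_piece (𝓑 : BumpCover d M) {g : Metric d M}
    {f : UnitSphereBundle g → F} (hf : SmoothOnSM g f) (i : Fin 𝓑.N) :
    BoundedSmooth (boundaryCoord d) (𝓑.piece g f i) := by
  obtain ⟨𝒜⟩ := FiniteAtlas.nonempty d M
  refine ⟨?_, fun j => ?_⟩
  · rw [← range_tangent_eq]
    exact contDiffOn_piece 𝓑 hf i
  · obtain ⟨C, -, hC⟩ := exists_norm_iteratedFDerivWithin_piece_le (F := F) 𝓑 g 𝒜 i j
    refine ⟨C * (ckNorm g 𝒜 j f).toReal, fun x hx => ?_⟩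
    have hx' : x ∈ range (𝓡∂ d).tangent := by
      rw [range_tangent_eq]
      exact hx
    have h := hC f hf x hx' j le_rfl
    rwa [range_tangent_eq] at h

variable [CompleteSpace F]

theorem contDiff_extension (𝓑 : BumpCover d M) {g : Metric d M} {a : ℕ → ℝ}
    (ha : IsSeeleySequence a) {f : UnitSphereBundle g → F} (hf : SmoothOnSM g f) :
    ContDiff ℝ ∞ (𝓑.extension g a f) :=
  ContDiff.sum fun i _ => (ha.contDiff (boundaryCoord_inwardVector d)
    (boundedSmooth_piece 𝓑 hf i)).comp (contDiff_apply ℝ _ i)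

theorem exists_norm_extension_le (𝓑 : BumpCover d M) (g : Metric d M) {a : ℕ → ℝ}
    (ha : IsSeeleySequence a) :
    ∃ C : ℝ, 1 ≤ C ∧ ∀ f : UnitSphereBundle g → F, ∀ B : ℝ, 0 ≤ B → (∀ p, ‖f p‖ ≤ B) →
      ∀ z, ‖𝓑.extension g a f z‖ ≤ C * B := by
  have h0 : Summable fun k => |a k| := by simpa using ha.summable 0
  set C := 1 + ∑' k, |a k| with hC
  have hC1 : 1 ≤ C := le_add_of_nonneg_right (tsum_nonneg fun _ => abs_nonneg _)
  refine ⟨1 + 𝓑.N * C, le_add_of_nonneg_right (by positivity), fun f B hB0 hB z => ?_⟩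
  have h1 : ‖𝓑.extension g a f z‖ ≤ ∑ _i : Fin 𝓑.N, C * B :=
    norm_sum_le_of_le _ fun i _ => norm_halfSpaceExt_le (boundaryCoord_inwardVector d) h0
      (fun q _ => norm_piece_le 𝓑 g hB0 hB i q) (z i)
  rw [Finset.sum_const, Finset.card_univ, Fintype.card_fin, nsmul_eq_mul] at h1
  linarith

theorem norm_iteratedFDeriv_comp_apply_le {ι : Type} [Fintype ι] {G : Type} [NormedAddCommGroup G]
    [NormedSpace ℝ G] {h : G → F} (hh : ContDiff ℝ ∞ h) (i : ι) (j : ℕ) (z : ι → G) :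
    ‖iteratedFDeriv ℝ j (fun z : ι → G => h (z i)) z‖ ≤ ‖iteratedFDeriv ℝ j h (z i)‖ := by
  have h1 := (ContinuousLinearMap.proj (R := ℝ) (φ := fun _ : ι => G) i).iteratedFDeriv_comp_right
    hh z (i := j) (mod_cast le_top)
  change ‖iteratedFDeriv ℝ j (h ∘ ContinuousLinearMap.proj (R := ℝ) (φ := fun _ : ι => G) i) z‖ ≤ _
  rw [h1]
  refine (ContinuousMultilinearMap.norm_compContinuousLinearMap_le _ _).trans ?_
  refine mul_le_of_le_one_right (norm_nonneg _) (Finset.prod_le_one (fun _ _ => norm_nonneg _)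
    fun _ _ => ?_)
  exact ContinuousLinearMap.opNorm_le_bound _ zero_le_one fun x => by
    rw [one_mul]
    exact norm_le_pi_norm x i

/-- The extension operator is bounded in all `C^k`-norms. -/
theorem exists_norm_iteratedFDeriv_extension_le (𝓑 : BumpCover d M) (g : Metric d M)
    (𝒜 : FiniteAtlas d M) {a : ℕ → ℝ} (ha : IsSeeleySequence a) (k : ℕ) :
    ∃ C : ℝ, 1 ≤ C ∧ ∀ f : UnitSphereBundle g → F, SmoothOnSM g f → ∀ j ≤ k, ∀ z,
      ‖iteratedFDeriv ℝ j (𝓑.extension g a f) z‖ ≤ C * (ckNorm g 𝒜 k f).toReal := by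
  choose C₁ hC₁ h₁ using fun i =>
    exists_norm_iteratedFDerivWithin_piece_le (F := F) 𝓑 g 𝒜 i k
  choose C₂ hC₂ h₂ using fun j =>
    ha.norm_iteratedFDeriv_halfSpaceExt_le (boundaryCoord_inwardVector d) j
  set D := ∑ j ∈ Finset.range (k + 1), C₂ j with hD
  have hD0 : 0 ≤ D := Finset.sum_nonneg fun j _ => hC₂ j
  refine ⟨1 + ∑ i, D * C₁ i, le_add_of_nonneg_right (Finset.sum_nonneg fun i _ =>
    mul_nonneg hD0 (zero_le_one.trans (hC₁ i))), fun f hf j hj z => ?_⟩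
  set K := (ckNorm g 𝒜 k f).toReal with hK
  have hK0 : 0 ≤ K := ENNReal.toReal_nonneg
  have hsm : ∀ i : Fin 𝓑.N, ContDiff ℝ ∞
      (halfSpaceExt (boundaryCoord d) (inwardVector d) a (𝓑.piece g f i)) := fun i =>
    ha.contDiff (boundaryCoord_inwardVector d) (boundedSmooth_piece 𝓑 hf i)
  have hsum : iteratedFDeriv ℝ j (𝓑.extension g a f) z = ∑ i, iteratedFDeriv ℝ j
      (fun z : 𝓑.ambient => halfSpaceExt (boundaryCoord d) (inwardVector d) a
        (𝓑.piece g f i) (z i)) z := by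
    exact iteratedFDeriv_fun_sum_apply fun i _ =>
      (((hsm i).comp (contDiff_apply ℝ _ i)).of_le (mod_cast le_top)).contDiffAt
  rw [hsum]
  have h3 : ∀ i : Fin 𝓑.N, ‖iteratedFDeriv ℝ j (fun z : 𝓑.ambient =>
      halfSpaceExt (boundaryCoord d) (inwardVector d) a (𝓑.piece g f i) (z i)) z‖ ≤
      D * C₁ i * K := by
    intro i
    refine (norm_iteratedFDeriv_comp_apply_le (hsm i) i j z).trans ?_
    have h4 := h₂ j (boundedSmooth_piece 𝓑 hf i) (C₁ i * K) (fun x hx => by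
      have hx' : x ∈ range (𝓡∂ d).tangent := by
        rw [range_tangent_eq]
        exact hx
      have h := h₁ i f hf x hx' j hj
      rwa [range_tangent_eq] at h) (z i)
    refine h4.trans ?_
    rw [mul_assoc]
    exact mul_le_mul_of_nonneg_right (Finset.single_le_sum (fun j _ => hC₂ j)
      (Finset.mem_range.2 (Nat.lt_succ_of_le hj)))
      (mul_nonneg (zero_le_one.trans (hC₁ i)) hK0)
  refine (norm_sum_le_of_le _ fun i _ => h3 i).trans ?_
  rw [← Finset.sum_mul]
  exact mul_le_mul_of_nonneg_right (by linarith) hK0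

end Extension

/-! ### Geodesics leave the embedded unit sphere bundle -/

section Escape

variable {d : ℕ} [NeZero d]
  {M : Type*} [TopologicalSpace M] [ChartedSpace (EuclideanHalfSpace d) M]
  [IsManifold (𝓡∂ d) ∞ M]

theorem metricForm_tangentChart (g : Metric d M) {c : M} (p : UnitSphereBundle g)
    (hp : p.1.1 ∈ (extChartAt (𝓡∂ d) c).source) :
    metricForm g c (tangentChart c p.1).1 (tangentChart c p.1).2 (tangentChart c p.1).2 = 1 := by
  have hmem := tangentChart_mem_nonzeroDomain hp (ne_zero_of_unit g p)
  rw [← inner_tangentChart_symm g hmem.1, (tangentChart c).left_inv (mem_tangentChart_source.2 hp)]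
  exact p.2

theorem unitRetraction_smul (g : Metric d M) {c : M}
    {q : EuclideanSpace ℝ (Fin d) × EuclideanSpace ℝ (Fin d)}
    (h1 : metricForm g c q.1 q.2 q.2 = 1) {s : ℝ} (hs : 0 < s) :
    unitRetraction g c (q.1, s • q.2) = q := by
  have h2 : metricForm g c q.1 (s • q.2) (s • q.2) = s ^ 2 := by
    simp [h1]
    ring
  rw [unitRetraction]
  simp only
  rw [h2, Real.sqrt_sq hs.le, inv_smul_smul₀ hs.ne']

/-- A component of the embedding whose direction is not zero determines the unit vector. -/
theorem unitRetraction_embed (𝓑 : BumpCover d M) (g : Metric d M) (p : UnitSphereBundle g)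
    {i : Fin 𝓑.N} (h : (𝓑.embed g p i).2 ≠ 0) :
    p.1.1 ∈ (extChartAt (𝓡∂ d) (𝓑.center i)).source ∧
      𝓑.embed g p i ∈ nonzeroDomain (𝓑.center i) ∧
      unitRetraction g (𝓑.center i) (𝓑.embed g p i) = tangentChart (𝓑.center i) p.1 := by
  have h1 : 𝓑.cutoff 1 i p.1.1 ≠ 0 := fun h0 => h (by rw [BumpCover.embed, h0, zero_smul])
  have h0 := 𝓑.cutoff_eq_one zero_lt_one h1
  have hsrc := 𝓑.mem_source h1
  have hmem := tangentChart_mem_nonzeroDomain hsrc (ne_zero_of_unit g p)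
  have heq : 𝓑.embed g p i = ((tangentChart (𝓑.center i) p.1).1,
      (𝓑.cutoff 1 i p.1.1 * ‖(tangentChart (𝓑.center i) p.1).2‖⁻¹) •
        (tangentChart (𝓑.center i) p.1).2) := by
    rw [BumpCover.embed, h0, one_smul, mul_smul]
    rfl
  refine ⟨hsrc, ⟨?_, h⟩, ?_⟩
  · rw [heq]
    exact hmem.1
  · rw [heq]
    exact unitRetraction_smul g (metricForm_tangentChart g p hsrc)
      (mul_pos ((𝓑.cutoff_nonneg 1 i _).lt_of_ne' h1) (inv_pos.2 (norm_pos_iff.2 hmem.2)))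

theorem boundaryCoord_localRep_embed_nonneg (𝓑 : BumpCover d M) (g : Metric d M) (c : M)
    (q : EuclideanSpace ℝ (Fin d) × EuclideanSpace ℝ (Fin d)) (i : Fin 𝓑.N) :
    0 ≤ boundaryCoord d (localRep g (𝓑.embed g) c q i) := by
  rw [localRep, Function.comp_apply, homExt]
  split_ifs with h
  · exact 𝓑.boundaryCoord_embed_nonneg g _ i
  · exact (map_zero (boundaryCoord d)).ge

variable [T2Space M]

/-- In the coordinates recovered from the `i`-th component of the embedding, the image of the
geodesic vector field under the embedding becomes the geodesic vector field again. -/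
theorem exists_hasFDerivWithinAt_unitRetraction_embed (𝓑 : BumpCover d M) (g : Metric d M)
    (p : UnitSphereBundle g) {i : Fin 𝓑.N} (h : (𝓑.embed g p i).2 ≠ 0) :
    ∃ D : EuclideanSpace ℝ (Fin d) × EuclideanSpace ℝ (Fin d) →L[ℝ]
        EuclideanSpace ℝ (Fin d) × EuclideanSpace ℝ (Fin d),
      HasFDerivWithinAt (unitRetraction g (𝓑.center i)) D (range (𝓡∂ d).tangent)
        (𝓑.embed g p i) ∧
      D (geodesicDeriv g (𝓑.embed g) p i) =
        spray g (𝓑.center i) (tangentChart (𝓑.center i) p.1) := by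
  set c := 𝓑.center i with hc
  set S := range (𝓡∂ d).tangent with hS
  obtain ⟨hsrc, hmem, hret⟩ := unitRetraction_embed 𝓑 g p h
  have hsm := smoothOnSM_embed 𝓑 g
  set q := tangentChart c p.1 with hq
  have hqD : q ∈ nonzeroDomain c := tangentChart_mem_nonzeroDomain hsrc (ne_zero_of_unit g p)
  have hqe : localRep g (𝓑.embed g) c q = 𝓑.embed g p := localRep_tangentChart g _ p hsrc
  have hD : HasFDerivWithinAt (unitRetraction g c) (fderivWithin ℝ (unitRetraction g c) S
      (𝓑.embed g p i)) S (𝓑.embed g p i) :=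
    (((contDiffOn_unitRetraction g c _ hmem).mono_of_mem_nhdsWithin
      (nonzeroDomain_mem_nhdsWithin hmem)).differentiableWithinAt (by simp)).hasFDerivWithinAt
  refine ⟨_, hD, ?_⟩
  have hL : HasFDerivWithinAt (localRep g (𝓑.embed g) c)
      (fderivWithin ℝ (localRep g (𝓑.embed g) c) S q) S q :=
    ((hsm.contDiffWithinAt hqD).differentiableWithinAt (by simp)).hasFDerivWithinAt
  have hLi := (hasFDerivWithinAt_pi'.1 hL) i
  have hmaps : MapsTo (fun q => localRep g (𝓑.embed g) c q i) S S := by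
    intro x _
    rw [hS, range_tangent_eq]
    exact boundaryCoord_localRep_embed_nonneg 𝓑 g c x i
  rw [← hqe] at hD
  have h1 := hD.comp q hLi hmaps
  obtain ⟨D', hD', hDs⟩ := exists_hasFDerivWithinAt_unitRetraction g hqD.1
    (metricForm_tangentChart g p hsrc)
  have hev : ∀ᶠ x in 𝓝[S] q, (localRep g (𝓑.embed g) c x i).2 ≠ 0 :=
    (hLi.continuousWithinAt.snd).eventually_ne
      (by change (localRep g (𝓑.embed g) c q i).2 ≠ 0; rwa [hqe])
  have hpt : ∀ x ∈ nonzeroDomain c, (localRep g (𝓑.embed g) c x i).2 ≠ 0 →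
      unitRetraction g c x = unitRetraction g c (localRep g (𝓑.embed g) c x i) := by
    intro x hx hx2
    rw [localRep_eq g _ hx] at hx2 ⊢
    rw [(unitRetraction_embed 𝓑 g _ hx2).2.2, tangentChart_toUnit g hx]
  have h2 := h1.congr_of_eventuallyEq (f₁ := unitRetraction g c)
    (by filter_upwards [hev, nonzeroDomain_mem_nhdsWithin hqD] with x hx hx'
        exact hpt x hx' hx) (hpt q hqD (by rwa [hqe]))
  have h3 := congrArg (fun L : EuclideanSpace ℝ (Fin d) × EuclideanSpace ℝ (Fin d) →L[ℝ]
    EuclideanSpace ℝ (Fin d) × EuclideanSpace ℝ (Fin d) => L (spray g c q))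
    ((uniqueDiffOn_range_tangent d _ (hqD |> nonzeroDomain_subset_range c)).eq h2 hD')
  rw [hsm.geodesicDeriv_eq p hsrc]
  simp only [hDs] at h3
  rw [hqe] at h3
  exact h3

/-- An orbit of the transported vector field inside the image of the unit sphere bundle comes from
an integral curve of the geodesic vector field. -/
theorem hasMFDerivWithinAt_of_embed (𝓑 : BumpCover d M) (g : Metric d M) {s : Set ℝ}
    {c : ℝ → 𝓑.ambient} {p : ℝ → UnitSphereBundle g} (hp : ∀ t ∈ s, 𝓑.embed g (p t) = c t)
    {t₀ : ℝ} (ht₀ : t₀ ∈ s)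
    (hc : HasDerivWithinAt c (geodesicDeriv g (𝓑.embed g) (p t₀)) s t₀) :
    HasMFDerivWithinAt 𝓘(ℝ, ℝ) (𝓡∂ d).tangent (fun t => (p t).1) s t₀
      ((1 : ℝ →L[ℝ] ℝ).smulRight (geodesicField g (p t₀).1)) := by
  set S := range (𝓡∂ d).tangent with hS
  obtain ⟨i, hi⟩ := 𝓑.exists_cutoff_eq_one (p t₀).1.1
  have hi1 := 𝓑.cutoff_eq_one one_lt_two (by rw [hi]; exact one_ne_zero)
  have hsrc := 𝓑.mem_source (k := 1) (i := i) (x := (p t₀).1.1) (by rw [hi1]; exact one_ne_zero)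
  have hmem := tangentChart_mem_nonzeroDomain hsrc (ne_zero_of_unit g (p t₀))
  have hne : (𝓑.embed g (p t₀) i).2 ≠ 0 := by
    rw [BumpCover.embed, hi1, one_smul]
    exact fun h => hmem.2 ((normalize_eq_zero_iff _).1 h)
  have hci := (hasDerivWithinAt_pi.1 hc) i
  have hev : ∀ᶠ t in 𝓝[s] t₀, (𝓑.embed g (p t) i).2 ≠ 0 := by
    have h1 : ∀ᶠ t in 𝓝[s] t₀, (c t i).2 ≠ 0 :=
      hci.continuousWithinAt.snd.eventually_ne
        (by change (c t₀ i).2 ≠ 0; rwa [← hp t₀ ht₀])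
    filter_upwards [h1, self_mem_nhdsWithin] with t ht hts
    rwa [hp t hts]
  obtain ⟨D, hD, hDX⟩ := exists_hasFDerivWithinAt_unitRetraction_embed 𝓑 g (p t₀) hne
  rw [hp t₀ ht₀] at hD
  have hmaps : MapsTo (fun t => c t i) s S := by
    intro t ht
    rw [hS, range_tangent_eq]
    change 0 ≤ boundaryCoord d (c t i)
    rw [← hp t ht]
    exact 𝓑.boundaryCoord_embed_nonneg g _ i
  have h1 := hD.comp_hasDerivWithinAt t₀ hci hmaps
  rw [hDX] at h1
  set q : ℝ → EuclideanSpace ℝ (Fin d) × EuclideanSpace ℝ (Fin d) :=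
    fun t => tangentChart (𝓑.center i) (p t).1 with hq
  have h2 : HasDerivWithinAt q (spray g (𝓑.center i) (q t₀)) s t₀ := by
    refine h1.congr_of_eventuallyEq ?_ ?_
    · filter_upwards [hev, self_mem_nhdsWithin] with t ht hts
      rw [hq, Function.comp_apply, ← hp t hts]
      exact (unitRetraction_embed 𝓑 g _ ht).2.2.symm
    · rw [hq, Function.comp_apply, ← hp t₀ ht₀]
      exact (unitRetraction_embed 𝓑 g _ hne).2.2.symm
  have hsymm : ∀ t, (p t).1.1 ∈ (extChartAt (𝓡∂ d) (𝓑.center i)).source →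
      (p t).1 = (tangentChart (𝓑.center i)).symm (q t) := fun t ht =>
    ((tangentChart (𝓑.center i)).left_inv (mem_tangentChart_source.2 ht)).symm
  have hevs : ∀ᶠ t in 𝓝[s] t₀, (p t).1 = (tangentChart (𝓑.center i)).symm (q t) :=
    hev.mono fun t ht => hsymm t (unitRetraction_embed 𝓑 g _ ht).1
  refine ⟨?_, ?_⟩
  · have h3 : ContinuousAt (tangentChart (𝓑.center i)).symm (q t₀) :=
      continuousAt_extChartAt_symm'' (mem_tangentChart_target.2 hmem.1)
    exact (h3.comp_continuousWithinAt h2.continuousWithinAt).congr_of_eventuallyEq hevs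
      (hsymm t₀ hsrc)
  · have hq2 : (q t₀).1 ∈ ((extChartAt (𝓡∂ d) (𝓑.center i)).symm ≫
        extChartAt (𝓡∂ d) (p t₀).1.1).source := by
      rw [mem_transition_source]
      refine ⟨hmem.1, ?_⟩
      have h4 : (q t₀).1 = extChartAt (𝓡∂ d) (𝓑.center i) (p t₀).1.1 := by
        rw [hq]
        simp only
        rw [tangentChart_apply]
      rw [h4, (extChartAt (𝓡∂ d) (𝓑.center i)).left_inv hsrc]
      exact mem_extChartAt_source _
    obtain ⟨D₂, hD₂, hD₂X⟩ := exists_hasFDerivWithinAt_spray g hq2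
    have h5 := hD₂.comp_hasDerivWithinAt t₀ h2 (fun t _ => mem_range_self _)
    rw [hD₂X, ← hsymm t₀ hsrc, ← geodesicField_eq_spray] at h5
    have h6 : HasDerivWithinAt (fun t => tangentChart (p t₀).1.1 (p t).1)
        (geodesicField g (p t₀).1 : EuclideanSpace ℝ (Fin d) × EuclideanSpace ℝ (Fin d)) s t₀ := by
      refine h5.congr_of_eventuallyEq (hevs.mono fun t ht => ?_) ?_
      · exact congrArg (tangentChart (p t₀).1.1) ht
      · exact congrArg (tangentChart (p t₀).1.1) (hsymm t₀ hsrc)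
    have h7 : HasFDerivWithinAt (fun t => tangentChart (p t₀).1.1 (p t).1)
        ((1 : ℝ →L[ℝ] ℝ).smulRight
          (geodesicField g (p t₀).1 : EuclideanSpace ℝ (Fin d) × EuclideanSpace ℝ (Fin d))) s t₀ :=
      h6
    simp only [writtenInExtChartAt, extChartAt_model_space_eq_id, PartialEquiv.refl_symm,
      PartialEquiv.refl_coe, Function.comp_id, preimage_id, modelWithCornersSelf_coe, range_id,
      inter_univ, id]
    exact h7

/-- On a non-trapping manifold the orbits of the transported vector field leave the image of the
unit sphere bundle. -/
theorem exists_escapesBefore (𝓑 : BumpCover d M) {g : Metric d M} (hnt : NonTrapping g)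
    {X : 𝓑.ambient → 𝓑.ambient}
    (hX : ∀ p, X (𝓑.embed g p) = geodesicDeriv g (𝓑.embed g) p) :
    ∀ z ∈ range (𝓑.embed g), ∃ T, EscapesBefore X (range (𝓑.embed g)) z T := by
  rintro z ⟨p₁, hp₁⟩
  have : Nonempty (UnitSphereBundle g) := ⟨p₁⟩
  set σ := Function.invFun (𝓑.embed g) with hσ
  have hσ' : ∀ z ∈ range (𝓑.embed g), 𝓑.embed g (σ z) = z := fun z hz =>
    Function.invFun_eq hz
  set τ := (exitTime g (σ z)).toNNReal with hτ
  refine ⟨(τ + 1 : NNReal), fun c hc0 hc => ?_⟩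
  by_contra! hcZ
  -- otherwise there would be a geodesic which is longer than the exit time
  have hle : ((τ + 1 : NNReal) : ℝ≥0∞) ≤ exitTime g (σ z) := by
    refine le_iSup₂_of_le (τ + 1) ⟨fun t => (σ (c t)).1, congrArg (fun z => (σ z).1) hc0,
      fun t ht => ?_⟩ le_rfl
    refine hasMFDerivWithinAt_of_embed 𝓑 g (p := fun t => σ (c t))
      (fun t ht => hσ' _ (hcZ t ht)) ht ?_
    have hXc : X (c t) = geodesicDeriv g (𝓑.embed g) (σ (c t)) := by
      rw [← hX, hσ' _ (hcZ t ht)]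
    have h := hc t ht
    rw [hXc] at h
    exact h
  rw [← ENNReal.coe_toNNReal (hnt (σ z)).ne, ENNReal.coe_le_coe, ← hτ] at hle
  exact absurd hle (by simp)

end Escape

/-! ### Propagators of skew-adjoint coefficients -/

section Unitary

variable {T : ℝ} {𝔸 : Type} [NormedRing 𝔸] [NormedAlgebra ℝ 𝔸] [StarRing 𝔸] [NormedStarGroup 𝔸]
  [StarModule ℝ 𝔸]

theorem HasPathDeriv.star {hT : 0 ≤ T} {u u' : C(Icc (0 : ℝ) T, 𝔸)} (hu : HasPathDeriv hT u u') :
    HasPathDeriv hT (star u) (star u') := fun t =>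
  ((starL' ℝ : 𝔸 ≃L[ℝ] 𝔸) : 𝔸 →L[ℝ] 𝔸).hasFDerivAt.comp_hasDerivWithinAt _ (hu t)

/-- The adjoint of the right propagator is the left propagator, if the coefficient is
skew-adjoint. -/
theorem IsRightPropagator.star [CompleteSpace 𝔸] {hT : 0 ≤ T} {b S : C(Icc (0 : ℝ) T, 𝔸)}
    (h : IsRightPropagator hT b S) (hb : star b = -b) : IsLeftPropagator hT b (star S) := by
  have h1 := (hasPathDeriv_of_eq_add_primitive h).star.eq_add_primitive
  have h0 := apply_zero_of_eq_add_primitive h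
  rw [star_mul, hb, neg_mul, ContinuousMap.star_apply, h0, star_one] at h1
  exact h1

theorem IsLeftPropagator.star [CompleteSpace 𝔸] {hT : 0 ≤ T} {b Q : C(Icc (0 : ℝ) T, 𝔸)}
    (h : IsLeftPropagator hT b Q) (hb : star b = -b) : IsRightPropagator hT b (star Q) := by
  have h1 := (hasPathDeriv_of_eq_add_primitive h).star.eq_add_primitive
  have h0 := apply_zero_of_eq_add_primitive h
  rw [star_neg, star_mul, hb, mul_neg, neg_neg, ContinuousMap.star_apply, h0, star_one] at h1
  exact h1

/-- Propagators of skew-adjoint coefficients are unitary. -/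
theorem norm_propagator_le_of_skewAdjoint [CompleteSpace 𝔸] [IsDedekindFiniteMonoid 𝔸]
    {hT : 0 ≤ T} {b S Q : C(Icc (0 : ℝ) T, 𝔸)} {ν : ℝ} (hν0 : 0 ≤ ν)
    (hν : ∀ x : 𝔸, star x * x = 1 → ‖x‖ ≤ ν) (hb : ∀ t, star (b t) = -b t)
    (hS : IsRightPropagator hT b S) (hQ : IsLeftPropagator hT b Q) : ‖S‖ ≤ ν ∧ ‖Q‖ ≤ ν := by
  have hb' : star b = -b := ContinuousMap.ext hb
  have h1 := hS.mul_eq_one' (hS.star hb')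
  have h2 := (hQ.star hb').mul_eq_one hQ
  exact ⟨(ContinuousMap.norm_le S hν0).2 fun t =>
      hν _ (congrArg (fun u : C(Icc (0 : ℝ) T, 𝔸) => u t) h1),
    (ContinuousMap.norm_le Q hν0).2 fun t =>
      hν _ (congrArg (fun u : C(Icc (0 : ℝ) T, 𝔸) => u t) h2)⟩

end Unitary

/-! ### Integrating factors on the unit sphere bundle -/

section IntegratingFactor

variable {d : ℕ} [NeZero d]
  {M : Type*} [TopologicalSpace M] [ChartedSpace (EuclideanHalfSpace d) M]
  [IsManifold (𝓡∂ d) ∞ M]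

/-- The chain rule along the geodesic vector field. -/
theorem SmoothOnSM.geodesicDeriv_comp {F F' : Type*} [NormedAddCommGroup F] [NormedSpace ℝ F]
    [NormedAddCommGroup F'] [NormedSpace ℝ F'] {g : Metric d M} {f : UnitSphereBundle g → F}
    (hf : SmoothOnSM g f) {h : F → F'} (hh : ContDiff ℝ ∞ h) (p : UnitSphereBundle g) :
    XRay.geodesicDeriv g (fun p => h (f p)) p = fderiv ℝ h (f p) (XRay.geodesicDeriv g f p) := by
  have hp : p.1.1 ∈ (extChartAt (𝓡∂ d) p.1.1).source := mem_extChartAt_source _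
  have hmem := tangentChart_mem_nonzeroDomain hp (ne_zero_of_unit g p)
  rw [(hf.comp_contDiff hh).geodesicDeriv_eq p hp, hf.geodesicDeriv_eq p hp,
    ← localRep_tangentChart g f p hp]
  have h1 : HasFDerivWithinAt (localRep g f p.1.1) _ (range (𝓡∂ d).tangent) _ :=
    ((hf.contDiffWithinAt hmem).differentiableWithinAt (by simp)).hasFDerivWithinAt
  have h2 := ((hh.differentiable (by simp)) _).hasFDerivAt.comp_hasFDerivWithinAt _ h1
  have h3 : HasFDerivWithinAt (localRep g (fun p => h (f p)) p.1.1) _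
      (range (𝓡∂ d).tangent) (tangentChart p.1.1 p.1) := h2.congr_of_eventuallyEq
    (by filter_upwards [nonzeroDomain_mem_nhdsWithin hmem] with q hq
        exact localRep_comp g f h hq) (localRep_comp g f h hmem)
  rw [h3.fderivWithin (uniqueDiffOn_range_tangent d _ (nonzeroDomain_subset_range _ hmem))]
  rfl

variable [T2Space M]

/-- The image of the geodesic vector field under the embedding extends to a Lipschitz vector
field. -/
theorem exists_extension_geodesicField (𝓑 : BumpCover d M) (g : Metric d M)
    (𝒜 : FiniteAtlas d M) [CompactSpace M] :
    ∃ X : 𝓑.ambient → 𝓑.ambient, ContDiff ℝ ∞ X ∧ (∃ L, LipschitzWith L X) ∧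
      ∀ p, X (𝓑.embed g p) = XRay.geodesicDeriv g (𝓑.embed g) p := by
  obtain ⟨a, ha⟩ := exists_isSeeleySequence
  have hsm := smoothOnSM_embed 𝓑 g
  obtain ⟨r, hr0, hr⟩ :=
    (isCompact_range_of_smoothOnSM 𝒜 hsm).isBounded.subset_ball_lt 0 (0 : 𝓑.ambient)
  -- a cutoff function turns the smooth extension into a Lipschitz one
  let ψ : ContDiffBump (0 : 𝓑.ambient) := ⟨r, r + 1, hr0, lt_add_one r⟩
  have hX : ContDiff ℝ ∞ fun z => ψ z • 𝓑.extension g a (XRay.geodesicDeriv g (𝓑.embed g)) z :=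
    ψ.contDiff.smul (contDiff_extension 𝓑 ha hsm.geodesicDeriv)
  refine ⟨_, hX, ⟨_, (hX.lipschitzWith_of_hasCompactSupport
    ψ.hasCompactSupport.smul_right (by simp)).choose_spec⟩, fun p => ?_⟩
  have h1 : ψ (𝓑.embed g p) = 1 :=
    ψ.one_of_mem_closedBall (Metric.ball_subset_closedBall (hr (mem_range_self p)))
  rw [h1, one_smul, 𝓑.extension_embed g]

variable [CompactSpace M]

/-- Restriction to the embedded unit sphere bundle is bounded in `C^k`. -/
theorem exists_ckNorm_comp_embed_le {F : Type} [NormedAddCommGroup F] [NormedSpace ℝ F]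
    (𝓑 : BumpCover d M) (g : Metric d M) (𝒜 : FiniteAtlas d M) (k : ℕ) :
    ∃ C : ℝ, 1 ≤ C ∧ ∀ h : 𝓑.ambient → F, ContDiff ℝ ∞ h → ∀ B : ℝ, 0 ≤ B →
      (∀ j ≤ k, ∀ z ∈ range (𝓑.embed g), ‖iteratedFDeriv ℝ j h z‖ ≤ B) →
      ckNorm g 𝒜 k (fun p => h (𝓑.embed g p)) ≤ ENNReal.ofReal (C * B) := by
  have hsm := smoothOnSM_embed 𝓑 g
  have h1 := fun i : Fin 𝒜.N => (isRelOpen_nonzeroDomain (M := M)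
    (𝒜.center i)).exists_norm_iteratedFDerivWithin_comp_le (F := F)
      (uniqueDiffOn_range_tangent d) (IsRelOpen.refl (univ : Set 𝓑.ambient)) uniqueDiffOn_univ
      (hsm.contDiffOn (𝒜.center i)) (mapsTo_univ _ _) (isCompact_atlasSet 𝒜 i)
      (atlasSet_subset 𝒜 i) k
  choose C hC1 hC using h1
  have hC0 : ∀ i, 0 ≤ C i := fun i => zero_le_one.trans (hC1 i)
  refine ⟨1 + ∑ i, C i, le_add_of_nonneg_right (Finset.sum_nonneg fun i _ => hC0 i),
    fun h hh B hB0 hB => ckNorm_le g 𝒜 fun i j hj q hq => ?_⟩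
  have hmem := atlasSet_subset 𝒜 i hq
  have h2 := hC i h hh.contDiffOn q hq B (fun j hj => by
    rw [iteratedFDerivWithin_univ]
    exact hB j hj _ (localRep_mem_range g (𝓑.embed g) hmem)) j hj
  have h3 : iteratedFDerivWithin ℝ j (localRep g (fun p => h (𝓑.embed g p)) (𝒜.center i))
      (range (𝓡∂ d).tangent) q = iteratedFDerivWithin ℝ j (h ∘ localRep g (𝓑.embed g)
        (𝒜.center i)) (range (𝓡∂ d).tangent) q := by
    have hr := isRelOpen_nonzeroDomain (d := d) (M := M) (𝒜.center i)
    rw [← hr.iteratedFDerivWithin_eq hmem, ← hr.iteratedFDerivWithin_eq hmem]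
    exact iteratedFDerivWithin_congr (fun q hq => localRep_comp g _ h hq) hmem j
  rw [h3]
  refine h2.trans (mul_le_mul_of_nonneg_right ?_ hB0)
  have := Finset.single_le_sum (f := C) (fun i _ => hC0 i) (Finset.mem_univ i)
  linarith

/-- Integrating factors with values in a Banach algebra, with estimates in terms of a bound `κ`
for propagators along orbits. The coefficients of these propagators are bounded by the sup norm
of `A` and satisfy all homogeneous linear equations satisfied by `A`. -/
theorem exists_integratingFactor {𝔸 : Type} [NormedRing 𝔸] [NormedAlgebra ℝ 𝔸] [CompleteSpace 𝔸]
    [IsDedekindFiniteMonoid 𝔸] {g : Metric d M} (hnt : NonTrapping g) (𝒜 : FiniteAtlas d M) :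
    ∃ (T : ℝ) (hT : 0 ≤ T) (C₀ : ℝ) (c : ℕ → ℝ), 0 ≤ C₀ ∧ (∀ k, 1 ≤ c k) ∧
      ∀ A : UnitSphereBundle g → 𝔸, SmoothOnSM g A →
      ∃ R Q : UnitSphereBundle g → 𝔸, SmoothOnSM g R ∧ (∀ p, R p * Q p = 1 ∧ Q p * R p = 1) ∧
        (∀ p, XRay.geodesicDeriv g R p + A p * R p = 0) ∧
        ∀ κ : ℝ, 1 ≤ κ → (∀ b S Q : C(Icc (0 : ℝ) T, 𝔸), ‖b‖ ≤ C₀ * (supNorm g A).toReal →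
          (∀ Θ : 𝔸 →L[ℝ] 𝔸, (∀ p, Θ (A p) = 0) → ∀ t, Θ (b t) = 0) →
          IsRightPropagator hT b S → IsLeftPropagator hT b Q → ‖S‖ ≤ κ ∧ ‖Q‖ ≤ κ) →
        ∀ k, ckNorm g 𝒜 k R ≤
            ENNReal.ofReal (c k * κ ^ (2 * k + 1)) * (1 + ckNorm g 𝒜 k A) ^ k ∧
          ckNorm g 𝒜 k Q ≤
            ENNReal.ofReal (c k * κ ^ (2 * k + 1)) * (1 + ckNorm g 𝒜 k A) ^ k := by
  obtain ⟨𝓑⟩ := BumpCover.nonempty d M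
  obtain ⟨a, ha⟩ := exists_isSeeleySequence
  have hsm := smoothOnSM_embed 𝓑 g
  obtain ⟨X, hX, ⟨L, hL⟩, hXe⟩ := exists_extension_geodesicField 𝓑 g 𝒜
  obtain ⟨T, hT, c, hc, hsol⟩ := exists_transport_solution (𝔸 := 𝔸) hX hL
    (isCompact_range_of_smoothOnSM 𝒜 hsm) (exists_escapesBefore 𝓑 hnt hXe)
  obtain ⟨C₀, hC₀, hC₀A⟩ := exists_norm_extension_le (F := 𝔸) 𝓑 g ha
  choose C₁ hC₁ hC₁A using exists_norm_iteratedFDeriv_extension_le (F := 𝔸) 𝓑 g 𝒜 ha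
  choose C₂ hC₂ hC₂A using exists_ckNorm_comp_embed_le (F := 𝔸) 𝓑 g 𝒜
  set e : ℕ → ℝ := fun k => 1 + ∑ j ∈ Finset.range (k + 1), c j with he
  have he1 : ∀ k, 1 ≤ e k := fun k => le_add_of_nonneg_right (Finset.sum_nonneg fun j _ => hc j)
  refine ⟨T, hT, C₀, fun k => C₂ k * (e k * C₁ k ^ k), zero_le_one.trans hC₀, fun k =>
    one_le_mul_of_one_le_of_one_le (hC₂ k)
      (one_le_mul_of_one_le_of_one_le (he1 k) (one_le_pow₀ (hC₁ k))), fun A hA => ?_⟩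
  have hA0 := hA.norm_le_supNorm 𝒜
  obtain ⟨R, Q, hR, hQ, hRQ, hRX, hest⟩ := hsol _ (contDiff_extension 𝓑 ha hA)
  refine ⟨fun p => R (𝓑.embed g p), fun p => Q (𝓑.embed g p), hsm.comp_contDiff hR,
    fun p => hRQ _, fun p => ?_, fun κ hκ1 hκ k => ?_⟩
  · rw [hsm.geodesicDeriv_comp hR, ← hXe, hRX _ (mem_range_self p), 𝓑.extension_embed g,
      neg_add_cancel]
  · have hκ' : ∀ b S Q : C(Icc (0 : ℝ) T, 𝔸), (∀ t, ∃ s ∈ Icc (0 : ℝ) 1, ∃ x,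
        b t = s • 𝓑.extension g a A x) → IsRightPropagator hT b S → IsLeftPropagator hT b Q →
        ‖S‖ ≤ κ ∧ ‖Q‖ ≤ κ := by
      intro b S Q hb
      refine hκ b S Q ?_ fun Θ hΘ t => ?_
      · refine (ContinuousMap.norm_le b (by positivity)).2 fun t => ?_
        obtain ⟨s, hs, x, hx⟩ := hb t
        rw [hx, norm_smul, Real.norm_of_nonneg hs.1]
        exact (mul_le_of_le_one_left (norm_nonneg _) hs.2).trans
          (hC₀A A _ ENNReal.toReal_nonneg hA0 x)
      · obtain ⟨s, hs, x, hx⟩ := hb t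
        rw [hx, map_smul, ← extension_comp_left 𝓑 g ha ENNReal.toReal_nonneg hA0 Θ x]
        have h0 := hC₀A (fun p => Θ (A p)) 0 le_rfl (fun p => by rw [hΘ p, norm_zero]) x
        rw [mul_zero, norm_le_zero_iff] at h0
        rw [h0, smul_zero]
    set N := (ckNorm g 𝒜 k A).toReal with hN
    have hN0 : 0 ≤ N := ENNReal.toReal_nonneg
    have hα : 1 ≤ C₁ k * (1 + N) :=
      one_le_mul_of_one_le_of_one_le (hC₁ k) (le_add_of_nonneg_right hN0)
    have hαA : ∀ j ≤ k, ∀ x, ‖iteratedFDeriv ℝ j (𝓑.extension g a A) x‖ ≤ C₁ k * (1 + N) :=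
      fun j hj x => (hC₁A k A hA j hj x).trans
        (mul_le_mul_of_nonneg_left (by linarith) (zero_le_one.trans (hC₁ k)))
    have hce : ∀ j ≤ k, c j * κ ^ (2 * j + 1) * (C₁ k * (1 + N)) ^ j ≤
        e k * κ ^ (2 * k + 1) * (C₁ k * (1 + N)) ^ k := by
      intro j hj
      have h1 : c j ≤ e k := (Finset.single_le_sum (f := c) (fun j _ => hc j)
        (Finset.mem_range.2 (Nat.lt_succ_of_le hj))).trans (le_add_of_nonneg_left zero_le_one)
      have h0 : 0 ≤ e k := zero_le_one.trans (he1 k)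
      gcongr
    have hB0 : 0 ≤ e k * κ ^ (2 * k + 1) * (C₁ k * (1 + N)) ^ k := by
      have h0 : 0 ≤ e k := zero_le_one.trans (he1 k)
      have h1 : 0 ≤ C₁ k * (1 + N) := zero_le_one.trans hα
      positivity
    have hfinal : ENNReal.ofReal (C₂ k * (e k * κ ^ (2 * k + 1) * (C₁ k * (1 + N)) ^ k)) =
        ENNReal.ofReal (C₂ k * (e k * C₁ k ^ k) * κ ^ (2 * k + 1)) *
          (1 + ckNorm g 𝒜 k A) ^ k := by
      have h1 : 1 + ckNorm g 𝒜 k A = ENNReal.ofReal (1 + N) := by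
        rw [ENNReal.ofReal_add zero_le_one hN0, ENNReal.ofReal_one,
          ENNReal.ofReal_toReal (hA.ckNorm_ne_top 𝒜 k)]
      rw [h1, ← ENNReal.ofReal_pow (by linarith), ← ENNReal.ofReal_mul' (by positivity), mul_pow]
      congr 1
      ring
    rw [← hfinal]
    exact ⟨hC₂A k R hR _ hB0 fun j hj z hz =>
        ((hest κ hκ1 hκ' j _ hα (fun i hi => hαA i (hi.trans hj)) z hz).1).trans (hce j hj),
      hC₂A k Q hQ _ hB0 fun j hj z hz =>
        ((hest κ hκ1 hκ' j _ hα (fun i hi => hαA i (hi.trans hj)) z hz).2).trans (hce j hj)⟩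

end IntegratingFactor

/-! ### Matrices with the Frobenius norm -/

section Matrix

attribute [local instance] Matrix.frobeniusNormedRing Matrix.frobeniusNormedAlgebra
  Matrix.frobenius_normedStarGroup

variable {m : ℕ}

theorem frobenius_norm_sq (A : Matrix (Fin m) (Fin m) ℂ) :
    ((‖A‖ ^ 2 : ℝ) : ℂ) = (star A * A).trace := by
  rw [Matrix.frobenius_norm_def, ← Real.sqrt_eq_rpow, Real.sq_sqrt (by positivity),
    Matrix.star_eq_conjTranspose, Matrix.trace, Finset.sum_comm]
  push_cast
  refine Finset.sum_congr rfl fun i _ => ?_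
  rw [Matrix.diag_apply, Matrix.mul_apply]
  refine Finset.sum_congr rfl fun j _ => ?_
  rw [Matrix.conjTranspose_apply, Complex.star_def, ← Complex.normSq_eq_conj_mul_self,
    Complex.normSq_eq_norm_sq]
  norm_cast

theorem frobenius_norm_of_star_mul_self {A : Matrix (Fin m) (Fin m) ℂ} (h : star A * A = 1) :
    ‖A‖ = ‖(1 : Matrix (Fin m) (Fin m) ℂ)‖ := by
  have h1 := frobenius_norm_sq A
  have h2 := frobenius_norm_sq (1 : Matrix (Fin m) (Fin m) ℂ)
  rw [star_one, one_mul] at h2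
  rw [h, ← h2] at h1
  exact (sq_eq_sq₀ (norm_nonneg _) (norm_nonneg _)).1 (mod_cast h1)

variable {d : ℕ} [NeZero d]
  {M : Type*} [TopologicalSpace M] [ChartedSpace (EuclideanHalfSpace d) M]
  [IsManifold (𝓡∂ d) ∞ M] [T2Space M] [CompactSpace M]

/-- Both estimates for matrices: Gronwall's inequality bounds the propagators in general, unitarity
bounds them by the norm of the identity matrix when `A` is skew-adjoint. -/
theorem exists_matrix_integratingFactor {g : Metric d M} (hnt : NonTrapping g)
    (𝒜 : FiniteAtlas d M) (m : ℕ) :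
    ∃ c₁ c₂ : ℕ → ℝ, (∀ k, 0 < c₁ k) ∧ (∀ k, 0 < c₂ k) ∧
      ∀ A : UnitSphereBundle g → Matrix (Fin m) (Fin m) ℂ, SmoothOnSM g A →
      ∃ R Q : UnitSphereBundle g → Matrix (Fin m) (Fin m) ℂ, SmoothOnSM g R ∧
        (∀ p, R p * Q p = 1 ∧ Q p * R p = 1) ∧
        (∀ p, XRay.geodesicDeriv g R p + A p * R p = 0) ∧
        (∀ k, ckNorm g 𝒜 k R ≤
            ENNReal.ofReal (c₁ k * Real.exp (c₂ k * (supNorm g A).toReal)) *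
              (1 + ckNorm g 𝒜 k A) ^ k ∧
          ckNorm g 𝒜 k Q ≤
            ENNReal.ofReal (c₁ k * Real.exp (c₂ k * (supNorm g A).toReal)) *
              (1 + ckNorm g 𝒜 k A) ^ k) ∧
        ((∀ p, A p ∈ skewAdjoint (Matrix (Fin m) (Fin m) ℂ)) → ∀ k,
          ckNorm g 𝒜 k R ≤ ENNReal.ofReal (c₁ k) * (1 + ckNorm g 𝒜 k A) ^ k ∧
          ckNorm g 𝒜 k Q ≤ ENNReal.ofReal (c₁ k) * (1 + ckNorm g 𝒜 k A) ^ k) := by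
  obtain ⟨T, hT, C₀, c, hC₀, hc, hsol⟩ :=
    exists_integratingFactor (𝔸 := Matrix (Fin m) (Fin m) ℂ) hnt 𝒜
  set ν := 1 + ‖(1 : Matrix (Fin m) (Fin m) ℂ)‖ with hν
  have hν1 : 1 ≤ ν := le_add_of_nonneg_right (norm_nonneg _)
  have hc0 : ∀ k, 0 < c k := fun k => zero_lt_one.trans_le (hc k)
  refine ⟨fun k => c k * ν ^ (2 * k + 1), fun k => (2 * k + 1) * (C₀ * T) + 1,
    fun k => mul_pos (hc0 k) (by positivity), fun k => by positivity, fun A hA => ?_⟩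
  obtain ⟨R, Q, hR, hRQ, hRX, hest⟩ := hsol A hA
  set N := (supNorm g A).toReal with hN
  have hN0 : 0 ≤ N := ENNReal.toReal_nonneg
  refine ⟨R, Q, hR, hRQ, hRX, fun k => ?_, fun hskew k => ?_⟩
  · have hexp : 1 ≤ Real.exp (C₀ * N * T) := Real.one_le_exp (by positivity)
    have h := hest (ν * Real.exp (C₀ * N * T)) (one_le_mul_of_one_le_of_one_le hν1 hexp)
      (fun b S Q hb _ hS hQ => by
        have h1 : ‖(1 : Matrix (Fin m) (Fin m) ℂ)‖ * Real.exp (‖b‖ * T) ≤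
            ν * Real.exp (C₀ * N * T) := by
          gcongr
          exact le_add_of_nonneg_left zero_le_one
        exact ⟨hS.norm_le.trans h1, hQ.norm_le.trans h1⟩) k
    have h2 : c k * (ν * Real.exp (C₀ * N * T)) ^ (2 * k + 1) ≤
        c k * ν ^ (2 * k + 1) * Real.exp (((2 * k + 1) * (C₀ * T) + 1) * N) := by
      rw [mul_pow, ← Real.exp_nat_mul, ← mul_assoc]
      have := hc0 k
      refine mul_le_mul_of_nonneg_left (Real.exp_le_exp.2 ?_) (by positivity)
      push_cast
      linarith
    have h3 := mul_le_mul_left (ENNReal.ofReal_le_ofReal h2) ((1 + ckNorm g 𝒜 k A) ^ k)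
    exact ⟨h.1.trans h3, h.2.trans h3⟩
  · refine hest ν hν1 (fun b S Q _ hb hS hQ => ?_) k
    have h2 : ‖(1 : Matrix (Fin m) (Fin m) ℂ)‖ ≤ ν := le_add_of_nonneg_left zero_le_one
    refine norm_propagator_le_of_skewAdjoint (zero_le_one.trans hν1)
      (fun x hx => (frobenius_norm_of_star_mul_self hx).trans_le h2) (fun t => ?_) hS hQ
    -- being skew-adjoint is the linear equation `star x + x = 0`
    have h1 := hb (((starL' ℝ : Matrix (Fin m) (Fin m) ℂ ≃L[ℝ] Matrix (Fin m) (Fin m) ℂ) :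
      Matrix (Fin m) (Fin m) ℂ →L[ℝ] Matrix (Fin m) (Fin m) ℂ) + ContinuousLinearMap.id ℝ _)
      (fun p => by
        change star (A p) + A p = 0
        rw [skewAdjoint.mem_iff.1 (hskew p), neg_add_cancel]) t
    exact eq_neg_of_add_eq_zero_left h1

end Matrix

end XRay

end

theorem theorem2p1 (d : ℕ) [NeZero d] (hd : 2 ≤ d)
    (M : Type*) [TopologicalSpace M] [T2Space M] [CompactSpace M]
    [ChartedSpace (EuclideanHalfSpace d) M] [IsManifold (𝓡∂ d) ∞ M]
    (g : XRay.Metric d M) (hconv : XRay.StrictlyConvexBoundary g) (hnt : XRay.NonTrapping g)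
    (𝒜 : XRay.FiniteAtlas d M) (m : ℕ) :
    ∃ c₁ c₂ : ℕ → ℝ, (∀ k, 0 < c₁ k) ∧ (∀ k, 0 < c₂ k) ∧
      ∀ A : XRay.UnitSphereBundle g → Matrix (Fin m) (Fin m) ℂ, XRay.SmoothOnSM g A →
        ∃ R : XRay.UnitSphereBundle g → GL (Fin m) ℂ,
          XRay.IsIntegratingFactor g A R ∧
          (∀ k : ℕ,
            XRay.ckNorm g 𝒜 k (fun p => (R p : Matrix (Fin m) (Fin m) ℂ)) ≤
              ENNReal.ofReal (c₁ k * Real.exp (c₂ k * (XRay.supNorm g A).toReal)) *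
                (1 + XRay.ckNorm g 𝒜 k A) ^ k ∧
            XRay.ckNorm g 𝒜 k (fun p => ((R p)⁻¹ : GL (Fin m) ℂ).val) ≤
              ENNReal.ofReal (c₁ k * Real.exp (c₂ k * (XRay.supNorm g A).toReal)) *
                (1 + XRay.ckNorm g 𝒜 k A) ^ k) ∧
          ((∀ p, A p ∈ skewAdjoint (Matrix (Fin m) (Fin m) ℂ)) →
            ∀ k : ℕ,
              XRay.ckNorm g 𝒜 k (fun p => (R p : Matrix (Fin m) (Fin m) ℂ)) ≤
                ENNReal.ofReal (c₁ k) * (1 + XRay.ckNorm g 𝒜 k A) ^ k ∧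
              XRay.ckNorm g 𝒜 k (fun p => ((R p)⁻¹ : GL (Fin m) ℂ).val) ≤
                ENNReal.ofReal (c₁ k) * (1 + XRay.ckNorm g 𝒜 k A) ^ k) := by

  obtain ⟨c₁, c₂, hc₁, hc₂, h⟩ := XRay.exists_matrix_integratingFactor hnt 𝒜 m
  refine ⟨c₁, c₂, hc₁, hc₂, fun A hA => ?_⟩
  obtain ⟨R, Q, hR, hRQ, hRX, hgen, hskew⟩ := h A hA
  exact ⟨fun p => ⟨R p, Q p, (hRQ p).1, (hRQ p).2⟩, ⟨hR, hRX⟩, hgen, hskew⟩
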